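/- Let $\kappa$ be a field and let $E/\kappa$ be a finite field extension which is the compositum $E=KL$ of two subextensions $K/\kappa$ and $L/\kappa$ that are cyclic Galois and linearly disjoint over $\kappa$. Let $\sigma$ and $\tau$ be generators of $\operatorname{Gal}(K/\kappa)$ and $\operatorname{Gal}(L/\kappa)$. Let $T=\mathrm{R}^1_{E/\kappa}\mathbb{G}_m$ be the norm one torus, so that $T(A)=\ker\bigl(N\colon (A\otimes_\kappa E)^\times\to A^\times\bigr)$ for every commutative $\kappa$-algebra $A$. Let $T(\kappa)/\mathrm{R}$ be the group of R-equivalence classes of $T(\kappa)$: two points of $T(\kappa)$ are directly R-equivalent if they are in the image of $\kappa$-points of $\mathbb{A}^1_\kappa$ under some rational map $\mathbb{A}^1_\kappa\dashrightarrow T$, and R-equivalence is the transitive closure of this relation. For a cyclic extension $F/k$ of degree $n$, a generator $\rho$ of $\operatorname{Gal}(F/k)$ and $z\in k^\times$, let $(F/k,\rho,z)$ be the cyclic algebra, i.e. the $k$-algebra generated by $F$ and an element $u$ with $uc=\rho(c)u$ for $c\in F$ and $u^n=z$. For a central simple algebra $D$ over a field $k$, let $\operatorname{SK}_1(D)=\{d\in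 D^\times \mid \operatorname{Nrd}(d)=1\}/[D^\times,D^\times]$, where $\operatorname{Nrd}$ is the reduced norm. Write $k=\kappa(x,y)$ and $k'=\kappa((x))((y))$, and let $$D=(K(x,y)/k,\sigma,x)\otimes_k(L(x,y)/k,\tau,y),\qquad D'=k'\otimes_k D,$$ where $\sigma$ and $\tau$ are extended to $K(x,y)$ and $L(x,y)$ so as to fix $x$ and $y$. Then there are group homomorphisms $i\colon T(\kappa)/\mathrm{R}\to\operatorname{SK}_1(D)$ and $j\colon\operatorname{SK}_1(D')\to T(\kappa)/\mathrm{R}$ such that: (a) the composition $$T(\kappa)/\mathrm{R}\xrightarrow{\ i\ }\operatorname{SK}_1(D)\longrightarrow\operatorname{SK}_1(D')\xrightarrow{\ j\ }T(\kappa)/\mathrm{R}$$ is the identity, where the middle map is the natural one, induced by $d\mapsto 1\otimes d$; (b) the maps $\operatorname{SK}_1(D)\to\operatorname{SK}_1(D')\xrightarrow{\ j\ }T(\kappa)/\mathrm{R}$ and $j\colon\operatorname{SK}_1(D')\to T(\kappa)/\mathrm{R}$ are surjective; moreover, if $\operatorname{char}(\kappa)$ does not divide $[K:\kappa][L:\kappa]$,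 then $j$ is an isomorphism. -/

import Mathlib

open scoped TensorProduct

noncomputable section

universe u v w

/-! ### Reduced norms, `SL₁` and `SK₁` -/

/-- `IsReducedNorm k D d c`: the element `c` of the field `k` is the reduced norm of the element `d`
of the central simple `k`-algebra `D`. That is, `c` is the determinant of `d` under the splittings
of `D`, i.e. under the `k`-algebra homomorphisms from `D` to the `n × n` matrices over an
extension field `Ω` of `k`, where `n ^ 2 = [D : k]` (such a homomorphism induces an isomorphism
from `Ω ⊗ D` to the matrix algebra; one exists when `Ω` is algebraically closed, and the
determinant of `d` is the same element of `k` for all of them). -/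
def IsReducedNorm (k : Type u) (D : Type v) [Field k] [Ring D] [Algebra k D] (d : D) (c : k) :
    Prop :=
  ∀ (Ω : Type u) [Field Ω] [Algebra k Ω] (n : ℕ) (φ : D →ₐ[k] Matrix (Fin n) (Fin n) Ω),
    n ^ 2 = Module.finrank k D → (φ d).det = algebraMap k Ω c

/-- The group `SL₁(D)(k)` of elements of `Dˣ` of reduced norm `1`. -/
def SL1 (k : Type u) (D : Type v) [Field k] [Ring D] [Algebra k D] : Subgroup Dˣ where
  carrier := {g | IsReducedNorm k D (g : D) 1}
  one_mem' := by
    intro Ω _ _ n φ _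
    simp
  mul_mem' := by
    intro a b ha hb Ω _ _ n φ hn
    have h1 := ha Ω n φ hn
    have h2 := hb Ω n φ hn
    rw [Units.val_mul, map_mul, Matrix.det_mul, h1, h2, map_one, one_mul]
  inv_mem' := by
    intro a ha Ω _ _ n φ hn
    have h1 := ha Ω n φ hn
    have h2 : (φ ((a⁻¹ : Dˣ) : D)).det * (φ (a : D)).det = 1 := by
      rw [← Matrix.det_mul, ← map_mul, Units.inv_mul, map_one, Matrix.det_one]
    rw [h1, map_one, mul_one] at h2
    rw [h2, map_one]

/-- `SK₁(D) = SL₁(D)(k) / [Dˣ, Dˣ]`. -/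
abbrev SK1 (k : Type u) (D : Type v) [Field k] [Ring D] [Algebra k D] : Type v :=
  SL1 k D ⧸ (commutator Dˣ).subgroupOf (SL1 k D)

section BaseChange

variable (k k' : Type u) (D : Type v) [Field k] [Field k'] [Algebra k k'] [Ring D] [Algebra k D]

/-- The map `Dˣ → (k' ⊗ D)ˣ` induced by `d ↦ 1 ⊗ d`. -/
def unitsBaseChange : Dˣ →* (k' ⊗[k] D)ˣ :=
  Units.map ((Algebra.TensorProduct.includeRight : D →ₐ[k] k' ⊗[k] D) : D →* k' ⊗[k] D)

theorem unitsBaseChange_mem (g : Dˣ) (hg : g ∈ SL1 k D) :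
    unitsBaseChange k k' D g ∈ SL1 k' (k' ⊗[k] D) := by
  intro Ω _ _ n φ hn
  let _ : Algebra k Ω := ((algebraMap k' Ω).comp (algebraMap k k')).toAlgebra
  have : IsScalarTower k k' Ω := IsScalarTower.of_algebraMap_eq fun _ => rfl
  have h := hg Ω n ((φ.restrictScalars k).comp Algebra.TensorProduct.includeRight)
    (by rw [hn, Module.finrank_baseChange])
  rw [map_one] at h ⊢
  exact h

/-- The map `SL₁(D)(k) → SL₁(D)(k')`. -/
def SL1.baseChange : SL1 k D →* SL1 k' (k' ⊗[k] D) :=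
  ((unitsBaseChange k k' D).comp (SL1 k D).subtype).codRestrict _
    fun g => unitsBaseChange_mem k k' D g g.2

/-- The natural map `SK₁(D) → SK₁(D ⊗ k')`. -/
def SK1.baseChange : SK1 k D →* SK1 k' (k' ⊗[k] D) :=
  QuotientGroup.map _ _ (SL1.baseChange k k' D) (by
    intro g hg
    rw [Subgroup.mem_comap, Subgroup.mem_subgroupOf]
    rw [Subgroup.mem_subgroupOf] at hg
    have h : Subgroup.map (unitsBaseChange k k' D) (commutator Dˣ) ≤ commutator _ := by
      rw [commutator_def, Subgroup.map_commutator]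
      exact Subgroup.commutator_mono le_top le_top
    exact h ⟨_, hg, rfl⟩)

end BaseChange

/-! ### Cyclic algebras -/

section Cyclic

variable {k : Type u} {F : Type v} [CommRing k] [CommRing F] [Algebra k F]

/-- The defining relations of the cyclic algebra `(F/k, σ, z)`, on generators `some c` (`c ∈ F`)
and `none` (the element usually called `u`): the elements of `F` satisfy the relations that hold
in the `k`-algebra `F`, and `u c = σ(c) u` for `c ∈ F`, and `u ^ [F : k] = z`. -/
inductive CyclicAlgebra.Rel (σ : F ≃ₐ[k] F) (z : k) :
    FreeAlgebra k (Option F) → FreeAlgebra k (Option F) → Prop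
  | add (c d : F) : CyclicAlgebra.Rel σ z (FreeAlgebra.ι k (some (c + d)))
      (FreeAlgebra.ι k (some c) + FreeAlgebra.ι k (some d))
  | mul (c d : F) : CyclicAlgebra.Rel σ z (FreeAlgebra.ι k (some (c * d)))
      (FreeAlgebra.ι k (some c) * FreeAlgebra.ι k (some d))
  | scalar (r : k) : CyclicAlgebra.Rel σ z (FreeAlgebra.ι k (some (algebraMap k F r)))
      (algebraMap k (FreeAlgebra k (Option F)) r)
  | conj (c : F) : CyclicAlgebra.Rel σ z (FreeAlgebra.ι k none * FreeAlgebra.ι k (some c))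
      (FreeAlgebra.ι k (some (σ c)) * FreeAlgebra.ι k none)
  | pow : CyclicAlgebra.Rel σ z (FreeAlgebra.ι k (none : Option F) ^ Module.finrank k F)
      (algebraMap k (FreeAlgebra k (Option F)) z)

/-- The cyclic algebra `(F/k, σ, z)`, where `F/k` is a cyclic extension of degree `n`, `σ` is a
generator of its Galois group and `z ∈ kˣ`: the `k`-algebra generated by `F` and an element `u` with
`u c = σ(c) u` for `c ∈ F` and `u ^ n = z`. -/
def CyclicAlgebra (σ : F ≃ₐ[k] F) (z : k) : Type (max u v) :=
  RingQuot (CyclicAlgebra.Rel σ z)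

instance (σ : F ≃ₐ[k] F) (z : k) : Ring (CyclicAlgebra σ z) :=
  inferInstanceAs (Ring (RingQuot (CyclicAlgebra.Rel σ z)))

instance (σ : F ≃ₐ[k] F) (z : k) : Algebra k (CyclicAlgebra σ z) :=
  inferInstanceAs (Algebra k (RingQuot (CyclicAlgebra.Rel σ z)))

end Cyclic

/-! ### The norm one torus and R-equivalence -/

section Torus

variable (κ : Type u) (E : Type v) [Field κ] [Field E] [Algebra κ E]

/-- The group of `A`-points of the norm one torus `R¹_{E/κ} 𝔾ₘ`, for a commutative `κ`-algebra `A`: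
the kernel of the norm `(A ⊗ E)ˣ → Aˣ`. -/
def NormOneTorus (A : Type w) [CommRing A] [Algebra κ A] : Subgroup (A ⊗[κ] E)ˣ :=
  (Units.map (Algebra.norm A : A ⊗[κ] E →* A)).ker

variable {A : Type*} {B : Type*} [CommRing A] [Algebra κ A] [CommRing B] [Algebra κ B]

theorem NormOneTorus.norm_map [FiniteDimensional κ E] (f : A →ₐ[κ] B) (x : A ⊗[κ] E) :
    Algebra.norm B (Algebra.TensorProduct.map f (AlgHom.id κ E) x) = f (Algebra.norm A x) := by
  let _ : Algebra A B := f.toRingHom.toAlgebra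
  have : IsScalarTower κ A B := IsScalarTower.of_algebraMap_eq fun r => (f.commutes r).symm
  let e : B ⊗[A] (A ⊗[κ] E) ≃ₐ[B] B ⊗[κ] E := Algebra.TensorProduct.cancelBaseChange κ A B B E
  have he : ∀ y : A ⊗[κ] E, e (1 ⊗ₜ y) = Algebra.TensorProduct.map f (AlgHom.id κ E) y := by
    intro y
    induction y with
    | zero => simp
    | add a b ha hb => rw [TensorProduct.tmul_add, map_add, map_add, ha, hb]
    | tmul a c =>
      rw [Algebra.TensorProduct.cancelBaseChange_tmul, Algebra.TensorProduct.map_tmul,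
        Algebra.smul_def, mul_one]
      rfl
  rw [← he, Algebra.norm_eq_of_algEquiv, Algebra.norm_apply, Algebra.norm_apply]
  have h1 : LinearMap.mul B (B ⊗[A] (A ⊗[κ] E)) (1 ⊗ₜ x) =
      (LinearMap.mul A (A ⊗[κ] E) x).baseChange B := by
    ext y
    simp
  exact (congrArg LinearMap.det h1).trans (LinearMap.det_baseChange _)

theorem NormOneTorus.mem_iff (x : (A ⊗[κ] E)ˣ) :
    x ∈ NormOneTorus κ E A ↔ Algebra.norm A (x : A ⊗[κ] E) = 1 := by
  rw [NormOneTorus, MonoidHom.mem_ker, Units.ext_iff]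
  rfl

/-- The homomorphism `T(A) → T(B)` induced by `A → B`, for `T = R¹_{E/κ} 𝔾ₘ`. -/
def NormOneTorus.map [FiniteDimensional κ E] (f : A →ₐ[κ] B) :
    NormOneTorus κ E A →* NormOneTorus κ E B :=
  ((Units.map (Algebra.TensorProduct.map f (AlgHom.id κ E) : A ⊗[κ] E →* B ⊗[κ] E)).comp
    (NormOneTorus κ E A).subtype).codRestrict _ (by
      intro x
      rw [NormOneTorus.mem_iff]
      refine (NormOneTorus.norm_map κ E f ((x : (A ⊗[κ] E)ˣ) : A ⊗[κ] E)).trans ?_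
      rw [(NormOneTorus.mem_iff κ E _).1 x.2, map_one])

theorem NormOneTorus.map_algebraMap [FiniteDimensional κ E] (f : A →ₐ[κ] κ)
    (P : NormOneTorus κ E κ) :
    NormOneTorus.map κ E f (NormOneTorus.map κ E (Algebra.ofId κ A) P) = P := by
  apply Subtype.ext
  apply Units.ext
  change Algebra.TensorProduct.map f (AlgHom.id κ E)
    (Algebra.TensorProduct.map (Algebra.ofId κ A) (AlgHom.id κ E) _) = _
  rw [← AlgHom.comp_apply, ← Algebra.TensorProduct.map_comp]
  have h : f.comp (Algebra.ofId κ A) = AlgHom.id κ κ := by ext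
  rw [h, AlgHom.id_comp, Algebra.TensorProduct.map_id, AlgHom.id_apply]
  rfl

variable [FiniteDimensional κ E]

/-- Two points `P, Q ∈ T(κ)` of `T = R¹_{E/κ} 𝔾ₘ` are directly R-equivalent if they are in the image
of `κ`-points of `𝔸¹` under a rational map from `𝔸¹` to `T`. Such a rational map is a `κ`-morphism to
`T` from a nonempty open subset `Spec κ[t]_g` of `𝔸¹`, i.e. an element `r ∈ T(κ[t]_g)`; the
`κ`-points of this open subset are the `κ`-algebra homomorphisms `κ[t]_g → κ`. -/
def DirectlyREquiv (P Q : NormOneTorus κ E κ) : Prop :=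
  ∃ g : Polynomial κ, g ≠ 0 ∧ ∃ r : NormOneTorus κ E (Localization.Away g),
    ∃ a b : Localization.Away g →ₐ[κ] κ,
      NormOneTorus.map κ E a r = P ∧ NormOneTorus.map κ E b r = Q

/-- R-equivalence on `T(κ)`: the transitive closure of direct R-equivalence. -/
def REquiv : NormOneTorus κ E κ → NormOneTorus κ E κ → Prop :=
  Relation.TransGen (DirectlyREquiv κ E)

theorem DirectlyREquiv.mul_left {P Q : NormOneTorus κ E κ} (S : NormOneTorus κ E κ)
    (h : DirectlyREquiv κ E P Q) : DirectlyREquiv κ E (S * P) (S * Q) := by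
  obtain ⟨g, hg, r, a, b, rfl, rfl⟩ := h
  refine ⟨g, hg, NormOneTorus.map κ E (Algebra.ofId κ _) S * r, a, b, ?_, ?_⟩ <;>
    rw [map_mul, NormOneTorus.map_algebraMap]

theorem DirectlyREquiv.symm {P Q : NormOneTorus κ E κ} (h : DirectlyREquiv κ E P Q) :
    DirectlyREquiv κ E Q P := by
  obtain ⟨g, hg, r, a, b, ha, hb⟩ := h
  exact ⟨g, hg, r, b, a, hb, ha⟩

theorem DirectlyREquiv.refl (P : NormOneTorus κ E κ) : DirectlyREquiv κ E P P := by
  let f : Localization.Away (1 : Polynomial κ) →ₐ[κ] κ :=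
    IsLocalization.liftAlgHom (M := Submonoid.powers (1 : Polynomial κ))
      (f := Polynomial.aeval (0 : κ)) (by rintro ⟨_, n, rfl⟩; simp)
  exact ⟨1, one_ne_zero, NormOneTorus.map κ E (Algebra.ofId κ _) P, f, f,
    NormOneTorus.map_algebraMap κ E f P, NormOneTorus.map_algebraMap κ E f P⟩

theorem REquiv.mul_left {P Q : NormOneTorus κ E κ} (S : NormOneTorus κ E κ)
    (h : REquiv κ E P Q) : REquiv κ E (S * P) (S * Q) :=
  Relation.TransGen.lift (fun P => S * P) (fun _ _ h => DirectlyREquiv.mul_left κ E S h) _ _ h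

theorem REquiv.symm {P Q : NormOneTorus κ E κ} (h : REquiv κ E P Q) : REquiv κ E Q P :=
  haveI : Std.Symm (DirectlyREquiv κ E) := ⟨fun _ _ h => DirectlyREquiv.symm κ E h⟩
  Relation.TransGen.stdSymm.symm _ _ h

/-- The subgroup `R T(κ)` of R-trivial elements of `T(κ)`: those R-equivalent to the identity. -/
def RTrivial : Subgroup (NormOneTorus κ E κ) where
  carrier := {P | REquiv κ E 1 P}
  one_mem' := .single (DirectlyREquiv.refl κ E 1)
  mul_mem' := by
    intro P Q hP hQ
    have h := REquiv.mul_left κ E P hQ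
    rw [mul_one] at h
    exact Relation.TransGen.trans hP h
  inv_mem' := by
    intro P hP
    have h := REquiv.mul_left κ E P⁻¹ (REquiv.symm κ E hP)
    rw [inv_mul_cancel, mul_one] at h
    exact h

/-- The group `T(κ)/R` of R-equivalence classes of the norm one torus `T = R¹_{E/κ} 𝔾ₘ`. -/
abbrev TorusModR : Type (max u v) := NormOneTorus κ E κ ⧸ RTrivial κ E

end Torus

/-! ### The fields `κ(x, y)` and `κ((x))((y))` -/

section Fields

/-- The field `κ(x, y)` of rational functions in two variables. -/
abbrev RatFunc₂ (κ : Type u) [Field κ] : Type u := FractionRing (MvPolynomial (Fin 2) κ)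

/-- The field `κ((x))((y))` of iterated Laurent series. -/
abbrev LaurentSeries₂ (κ : Type u) [Field κ] : Type u := LaurentSeries (LaurentSeries κ)

/-- The element `x` of `κ(x, y)`. -/
def RatFunc₂.x (κ : Type u) [Field κ] : RatFunc₂ κ := 
  algebraMap (MvPolynomial (Fin 2) κ) (RatFunc₂ κ) (MvPolynomial.X 0)

/-- The element `y` of `κ(x, y)`. -/
def RatFunc₂.y (κ : Type u) [Field κ] : RatFunc₂ κ := 
  algebraMap (MvPolynomial (Fin 2) κ) (RatFunc₂ κ) (MvPolynomial.X 1)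

/-- The element `x` of `κ((x))((y))`. -/
def LaurentSeries₂.x (κ : Type u) [Field κ] : LaurentSeries₂ κ :=
  HahnSeries.C (HahnSeries.single 1 1)

/-- The element `y` of `κ((x))((y))`. -/
def LaurentSeries₂.y (κ : Type u) [Field κ] : LaurentSeries₂ κ := HahnSeries.single 1 1

/-- The homomorphism `κ[x, y] → κ((x))((y))`. -/
def polyToLaurent (κ : Type u) [Field κ] : MvPolynomial (Fin 2) κ →+* LaurentSeries₂ κ :=
  MvPolynomial.eval₂Hom (HahnSeries.C.comp HahnSeries.C) ![LaurentSeries₂.x κ, LaurentSeries₂.y κ]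

theorem coeff_polyToLaurent (κ : Type u) [Field κ] (p : MvPolynomial (Fin 2) κ)
    (m : Fin 2 →₀ ℕ) :
    ((polyToLaurent κ p).coeff (m 1 : ℤ)).coeff (m 0 : ℤ) = MvPolynomial.coeff m p := by
  induction p using MvPolynomial.induction_on' with
  | add p q hp hq => simp [map_add, hp, hq]
  | monomial u a =>
    have h : polyToLaurent κ (MvPolynomial.monomial u a) =
        HahnSeries.single (u 1 : ℤ) (HahnSeries.single (u 0 : ℤ) a) := by
      rw [polyToLaurent, MvPolynomial.coe_eval₂Hom, MvPolynomial.eval₂_monomial,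
        Finsupp.prod_fintype _ _ (by simp), Fin.prod_univ_two]
      simp [LaurentSeries₂.x, LaurentSeries₂.y, HahnSeries.single_pow, HahnSeries.C_apply,
        HahnSeries.single_mul_single]
    rw [h, MvPolynomial.coeff_monomial, HahnSeries.coeff_single]
    by_cases hu : u = m
    · subst hu
      simp
    · rw [if_neg hu]
      split_ifs with h1
      · rw [HahnSeries.coeff_single_of_ne]
        intro h0
        apply hu
        ext i
        fin_cases i
        · exact_mod_cast h0.symm
        · exact_mod_cast h1.symm
      · simp

theorem polyToLaurent_injective (κ : Type u) [Field κ] :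
    Function.Injective (polyToLaurent κ) := by
  intro p q h
  ext m
  rw [← coeff_polyToLaurent, ← coeff_polyToLaurent, h]

/-- The embedding `κ(x, y) → κ((x))((y))` over `κ` sending `x` to `x` and `y` to `y`. -/
def ratToLaurent (κ : Type u) [Field κ] : RatFunc₂ κ →+* LaurentSeries₂ κ :=
  IsFractionRing.lift (g := polyToLaurent κ) (polyToLaurent_injective κ)

instance (κ : Type u) [Field κ] : Algebra (RatFunc₂ κ) (LaurentSeries₂ κ) :=
  (ratToLaurent κ).toAlgebra

variable {κ : Type u} {K : Type v} [Field κ] [Field K] [Algebra κ K]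

attribute [local instance] MvPolynomial.algebraMvPolynomial FractionRing.liftAlgebra

/-- The automorphism of `K(x, y)` over `κ(x, y)` that extends the automorphism `σ` of `K` over `κ`
and fixes `x` and `y`. -/
def RatFunc₂.extend (σ : K ≃ₐ[κ] K) : RatFunc₂ K ≃ₐ[RatFunc₂ κ] RatFunc₂ K :=
  IsFractionRing.fieldEquivOfAlgEquiv (A := MvPolynomial (Fin 2) κ) (B := MvPolynomial (Fin 2) K)
    (C := MvPolynomial (Fin 2) K) (RatFunc₂ κ) (RatFunc₂ K) (RatFunc₂ K)
    (AlgEquiv.ofRingEquiv (f := MvPolynomial.mapEquiv (Fin 2) σ.toRingEquiv) (by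
      intro p
      rw [MvPolynomial.algebraMap_def, MvPolynomial.mapEquiv_apply, MvPolynomial.map_map]
      congr 1
      ext c
      · simp
      · simp))

/-- The cyclic algebra `(K(x, y)/κ(x, y), σ, z)` attached to a generator `σ` of the Galois group of
`K/κ` and an element `z` of `κ(x, y)`. -/
abbrev RatFuncCyclicAlgebra (σ : K ≃ₐ[κ] K) (z : RatFunc₂ κ) : Type (max u v) :=
  CyclicAlgebra (RatFunc₂.extend σ) z

end Fields

end

/-! Write `n = [K : κ]`, `m = [L : κ]`, `G = Gal(E/κ)`. Both sides of the theorem are compared with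
the quotient of `Eˣ` by the subgroup `I` generated by the elements `g(a) / a` with `g ∈ G`.

The torus. The classes `T(κ)/R` form the group of norm one elements of `Eˣ` modulo `I`
(`mem_RTrivial_iff`). The path `t ↦ g(ta + 1 - t) / (ta + 1 - t)` joins `1` to `g(a) / a`.
Conversely, a rational map to `T` is a quotient `P / Q` of polynomials over `E` with equal norms. By
unique factorization in `E[t]`, the prime factors of `P` can be matched with conjugates of them
dividing `Q`, and at a point of `κ` conjugate polynomials take conjugate values. So the values of `P
/ Q` at the points of `κ` all lie in one class modulo `I`.

The map `i`. The field `E` lies in `D`, whose degree is `[E : κ]`, and `G` acts on `E` by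
conjugation with products of `u` and `v`. Hence the reduced norm of `a ∈ E` is its norm
(`isReducedNorm_norm`), and `g(a) / a` is a commutator.

The map `j`. Adjoin roots `X ^ n = x` and `Y ^ m = y`. Let `E` act on `E((X))((Y))` by
multiplication, `u` as `X σ` and `v` as `Y τ`. Applying elements of `D'` to `1` identifies `D'` with
`E((X))((Y))` under a twisted product. A nonzero element has a lexicographically first term `a Y ^ j
X ^ i`, and the leading coefficient of a product is `a σ ^ i τ ^ j (a')`, so leading coefficients
are multiplicative modulo `I`. The action is linear over `κ((X))((Y))`, and its determinant is the
reduced norm; comparing leading terms, reduced norm `1` forces `i = j = 0` and `a` of norm `1`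
(`HasLeading.norm_eq_one`). The leading term of `1 ⊗ a` is `a`, so the composition in (a) is the
identity, and surjectivity follows.

Injectivity when `nm` is invertible in `κ`. Commutators reduce to leading term `1`. Such a unit is a
product of one near `1` in the `X`-adic sense and free of `Y`, and one near `1` in the `Y`-adic
sense. Conjugation by `u`, `v` and a primitive element `θ` of `E` acts coefficientwise, and every
series is the sum of a central one and differences of elements and their conjugates: `θ` handles the
exponents outside `mℤ × nℤ`, averaging over `G` the others. Successive approximation turns this into
a statement on units: modulo commutators each factor is central (`exists_central_congr`). A central
`f` with residue `1` and reduced norm `f ^ (nm) = 1` equals `1`. -/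

set_option linter.unusedSectionVars false

noncomputable section

/-! ### Coefficientwise constructions on iterated Laurent series -/

namespace DoubleLaurent

variable {R S : Type*} [CommRing R] [CommRing S]

/-- The ring homomorphism between Laurent series rings that applies `f` to all coefficients. -/
def mapHom {R S : Type*} [Ring R] [Ring S] (f : R →+* S) :
    HahnSeries ℤ R →+* HahnSeries ℤ S where
  toFun h := h.map f
  map_zero' := by ext; simp
  map_one' := by
    ext a
    rw [HahnSeries.map_coeff, HahnSeries.coeff_one, HahnSeries.coeff_one]
    split_ifs <;> simp
  map_add' x y := by ext; simp
  map_mul' x y := HahnSeries.map_mul (f : R →ₙ+* S)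

@[simp] theorem coeff_mapHom (f : R →+* S) (h : HahnSeries ℤ R) (a : ℤ) :
    (mapHom f h).coeff a = f (h.coeff a) := rfl

/-- The additive map between Laurent series that applies `T a` to the coefficient at `a`. -/
def coeffwise {A B : Type*} [AddCommGroup A] [AddCommGroup B] (T : ℤ → A →+ B) :
    HahnSeries ℤ A →+ HahnSeries ℤ B where
  toFun h := ⟨fun a => T a (h.coeff a), h.isPWO_support.mono fun a ha h0 => ha (by
    simp only [h0, map_zero])⟩
  map_zero' := by ext; simp
  map_add' x y := by ext; simp

/-- The coefficient of `Y ^ j X ^ i` in an iterated Laurent series. -/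
def c {R : Type*} [Zero R] (h : HahnSeries ℤ (HahnSeries ℤ R)) (j i : ℤ) : R := (h.coeff j).coeff i

theorem ext_c {R : Type*} [Zero R] {h h' : HahnSeries ℤ (HahnSeries ℤ R)}
    (H : ∀ j i, c h j i = c h' j i) : h = h' := by
  ext j i
  exact H j i

@[simp] theorem c_add (h h' : HahnSeries ℤ (HahnSeries ℤ R)) (j i : ℤ) :
    c (h + h') j i = c h j i + c h' j i := by simp [c]

@[simp] theorem c_sub (h h' : HahnSeries ℤ (HahnSeries ℤ R)) (j i : ℤ) :
    c (h - h') j i = c h j i - c h' j i := by simp [c]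

@[simp] theorem c_zero (j i : ℤ) : c (0 : HahnSeries ℤ (HahnSeries ℤ R)) j i = 0 := by simp [c]

@[simp] theorem c_sum {ι : Type*} (s : Finset ι) (f : ι → HahnSeries ℤ (HahnSeries ℤ R)) (j i : ℤ) :
    c (∑ a ∈ s, f a) j i = ∑ a ∈ s, c (f a) j i := by simp [c, HahnSeries.coeff_sum]

theorem c_one (j i : ℤ) :
    c (1 : HahnSeries ℤ (HahnSeries ℤ R)) j i = if j = 0 ∧ i = 0 then 1 else 0 := by
  rw [c, HahnSeries.coeff_one]
  split_ifs with h1 h2 h2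
  · simp [HahnSeries.coeff_one, h2.2]
  · simp only [HahnSeries.coeff_one, ite_eq_right_iff]
    exact fun h => absurd ⟨h1, h⟩ h2
  · exact absurd h2.1 h1
  · simp

/-- The homomorphism of iterated Laurent series rings that applies `f` to all coefficients. -/
def map (f : R →+* S) : HahnSeries ℤ (HahnSeries ℤ R) →+* HahnSeries ℤ (HahnSeries ℤ S) :=
  mapHom (mapHom f)

@[simp] theorem c_map (f : R →+* S) (h : HahnSeries ℤ (HahnSeries ℤ R)) (j i : ℤ) :
    c (map f h) j i = f (c h j i) := rfl

/-- The additive map that applies `T j i` to the coefficient at `Y ^ j X ^ i`. -/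
def coeffwise₂ (T : ℤ → ℤ → R →+ S) :
    HahnSeries ℤ (HahnSeries ℤ R) →+ HahnSeries ℤ (HahnSeries ℤ S) :=
  coeffwise fun j => coeffwise (T j)

@[simp] theorem c_coeffwise₂ (T : ℤ → ℤ → R →+ S) (h : HahnSeries ℤ (HahnSeries ℤ R)) (j i : ℤ) :
    c (coeffwise₂ T h) j i = T j i (c h j i) := rfl

/-- The monomial `a Y ^ j X ^ i`. -/
def mono (j i : ℤ) (a : R) : HahnSeries ℤ (HahnSeries ℤ R) :=
  HahnSeries.single j (HahnSeries.single i a)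

theorem mono_mul_mono (j i j' i' : ℤ) (a b : R) :
    mono j i a * mono j' i' b = mono (j + j') (i + i') (a * b) := by
  simp [mono, HahnSeries.single_mul_single]

theorem mono_zero_one : mono 0 0 (1 : R) = 1 := rfl

theorem mono_pow (j i : ℤ) (a : R) (k : ℕ) : mono j i a ^ k = mono (k * j) (k * i) (a ^ k) := by
  simp [mono, HahnSeries.single_pow]

theorem mono_add (j i : ℤ) (a b : R) : mono j i (a + b) = mono j i a + mono j i b := by
  simp [mono]

@[simp] theorem c_mono_mul (j i : ℤ) (a : R) (h : HahnSeries ℤ (HahnSeries ℤ R)) (j' i' : ℤ) :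
    c (mono j i a * h) j' i' = a * c h (j' - j) (i' - i) := by
  simp [c, mono, HahnSeries.coeff_single_mul]

theorem c_mono (j i : ℤ) (a : R) (j' i' : ℤ) :
    c (mono j i a) j' i' = if j' = j ∧ i' = i then a else 0 := by
  rw [← mul_one (mono j i a), c_mono_mul, c_one]
  simp [sub_eq_zero]

@[simp] theorem map_mono (f : R →+* S) (j i : ℤ) (a : R) : map f (mono j i a) = mono j i (f a) := by
  refine ext_c fun j' i' => ?_
  rw [c_map, c_mono, c_mono]
  split_ifs <;> simp

theorem mono_mul_cancel (j i : ℤ) (h : HahnSeries ℤ (HahnSeries ℤ R)) :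
    mono j i 1 * (mono (-j) (-i) 1 * h) = h := by
  rw [← mul_assoc, mono_mul_mono]
  simp [mono_zero_one]

theorem mono_mul_cancel' (j i : ℤ) (h : HahnSeries ℤ (HahnSeries ℤ R)) :
    mono (-j) (-i) 1 * (mono j i 1 * h) = h := by
  rw [← mul_assoc, mono_mul_mono]
  simp [mono_zero_one]

/-! ### The order filtration and the ring of integral series -/

/-- The Laurent series of order at least `N`. -/
def filt (A : Type*) [AddCommGroup A] (N : ℤ) : AddSubgroup (HahnSeries ℤ A) where
  carrier := {h | ∀ j < N, h.coeff j = 0}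
  zero_mem' := by simp
  add_mem' := by
    intro a b ha hb j hj
    simp [ha j hj, hb j hj]
  neg_mem' := by
    intro a ha j hj
    simp [ha j hj]

theorem mem_filt {A : Type*} [AddCommGroup A] {N : ℤ} {h : HahnSeries ℤ A} :
    h ∈ filt A N ↔ ∀ j < N, h.coeff j = 0 := Iff.rfl

theorem mem_filt_iff {A : Type*} [AddCommGroup A] {N : ℤ} {h : HahnSeries ℤ A} :
    h ∈ filt A N ↔ (N : WithTop ℤ) ≤ h.orderTop := by
  rw [HahnSeries.le_orderTop_iff_forall]
  simp [mem_filt]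

theorem mul_mem_filt {a b : ℤ} {f g : HahnSeries ℤ R} (hf : f ∈ filt R a) (hg : g ∈ filt R b) :
    f * g ∈ filt R (a + b) := by
  rw [mem_filt_iff] at *
  push_cast
  exact (add_le_add hf hg).trans HahnSeries.orderTop_add_le_mul

theorem C_mem_filt (a : R) : HahnSeries.C a ∈ filt R 0 := by
  intro j hj
  rw [HahnSeries.C_apply, HahnSeries.coeff_single_of_ne hj.ne]

theorem sub_C_mem_filt {f : HahnSeries ℤ R} (hf : f ∈ filt R 0) :
    f - HahnSeries.C (f.coeff 0) ∈ filt R 1 := by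
  intro j hj
  rcases (Int.lt_add_one_iff.1 (by simpa using hj) : j ≤ 0).lt_or_eq with h | rfl
  · rw [HahnSeries.coeff_sub, hf j h, C_mem_filt _ j h, sub_zero]
  · simp [HahnSeries.C_apply]

/-- After splitting off the constant term of `f`, the remainder has order at least `1` and cannot
contribute in order `0`. -/
theorem coeff_zero_mul {f g : HahnSeries ℤ R} (hf : f ∈ filt R 0) (hg : g ∈ filt R 0) :
    (f * g).coeff 0 = f.coeff 0 * g.coeff 0 := by
  have h : f * g = HahnSeries.C (f.coeff 0) * g + (f - HahnSeries.C (f.coeff 0)) * g := by ring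
  rw [h, HahnSeries.coeff_add, mul_mem_filt (sub_C_mem_filt hf) hg 0 (by norm_num), add_zero,
    HahnSeries.C_apply, HahnSeries.coeff_single_zero_mul]

/-- The ring of iterated Laurent series without terms `Y ^ j X ^ i` for `(j, i) < (0, 0)` in the
lexicographic order. -/
def integers (R : Type*) [CommRing R] : Subring (HahnSeries ℤ (HahnSeries ℤ R)) where
  carrier := {h | h ∈ filt (HahnSeries ℤ R) 0 ∧ h.coeff 0 ∈ filt R 0}
  one_mem' := ⟨C_mem_filt 1, by
    rw [HahnSeries.coeff_one, if_pos rfl]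
    exact C_mem_filt 1⟩
  zero_mem' := ⟨zero_mem _, zero_mem _⟩
  mul_mem' := by
    rintro a b ⟨ha, ha'⟩ ⟨hb, hb'⟩
    refine ⟨by simpa using mul_mem_filt ha hb, ?_⟩
    rw [coeff_zero_mul ha hb]
    simpa using mul_mem_filt ha' hb'
  add_mem' := by
    rintro a b ⟨ha, ha'⟩ ⟨hb, hb'⟩
    exact ⟨add_mem ha hb, by simpa using add_mem ha' hb'⟩
  neg_mem' := by
    rintro a ⟨ha, ha'⟩
    exact ⟨neg_mem ha, by simpa using neg_mem ha'⟩

theorem mem_integers {h : HahnSeries ℤ (HahnSeries ℤ R)} :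
    h ∈ integers R ↔ ∀ j i, (j < 0 ∨ j = 0 ∧ i < 0) → c h j i = 0 := by
  constructor
  · rintro ⟨h1, h2⟩ j i (hj | ⟨rfl, hi⟩)
    · rw [c, h1 j hj, HahnSeries.coeff_zero]
    · exact h2 i hi
  · intro H
    refine ⟨fun j hj => ?_, fun i hi => H 0 i (Or.inr ⟨rfl, hi⟩)⟩
    ext i
    exact H j i (Or.inl hj)

theorem c_zero_mul {f g : HahnSeries ℤ (HahnSeries ℤ R)} (hf : f ∈ integers R)
    (hg : g ∈ integers R) : c (f * g) 0 0 = c f 0 0 * c g 0 0 := by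
  rw [c, coeff_zero_mul hf.1 hg.1, coeff_zero_mul hf.2 hg.2]
  rfl

/-- The residue map, sending an integral series to its constant coefficient. -/
def res (R : Type*) [CommRing R] : integers R →+* R where
  toFun h := c (h : HahnSeries ℤ (HahnSeries ℤ R)) 0 0
  map_one' := by simp [c_one]
  map_zero' := by simp
  map_add' x y := by simp
  map_mul' x y := c_zero_mul x.2 y.2

theorem res_apply (h : integers R) : res R h = c (h : HahnSeries ℤ (HahnSeries ℤ R)) 0 0 := rfl

theorem map_mem_integers (f : R →+* S) {h : HahnSeries ℤ (HahnSeries ℤ R)} (hh : h ∈ integers R) :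
    map f h ∈ integers S := by
  rw [mem_integers] at *
  intro j i hji
  rw [c_map, hh j i hji, map_zero]

theorem mono_mem_integers (a : R) : mono 0 0 a ∈ integers R := by
  rw [mem_integers]
  intro j i h
  rw [c_mono, if_neg]
  omega

/-- A nonzero iterated Laurent series is a monomial times an integral series with nonzero
residue. -/
theorem exists_leading {h : HahnSeries ℤ (HahnSeries ℤ R)} (hh : h ≠ 0) :
    ∃ j i : ℤ, c h j i ≠ 0 ∧ mono (-j) (-i) 1 * h ∈ integers R := by
  have h1 : h.coeff h.order ≠ 0 := by rwa [Ne, HahnSeries.coeff_order_eq_zero]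
  have h2 : (h.coeff h.order).coeff (h.coeff h.order).order ≠ 0 := by
    rwa [Ne, HahnSeries.coeff_order_eq_zero]
  refine ⟨h.order, (h.coeff h.order).order, h2, ?_⟩
  rw [mem_integers]
  rintro j i (hj | ⟨rfl, hi⟩)
  · have h3 : h.coeff (j - -h.order) = 0 := HahnSeries.coeff_eq_zero_of_lt_order (by omega)
    rw [c_mono_mul, c, h3, HahnSeries.coeff_zero, mul_zero]
  · rw [c_mono_mul, c, one_mul, zero_sub, neg_neg]
    exact HahnSeries.coeff_eq_zero_of_lt_order (by omega)

/-! ### Scaling the exponents -/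

/-- The ring homomorphism `h(X) ↦ h(X ^ n)` on Laurent series. -/
def scaleHom (R : Type*) [Ring R] (n : ℕ) [NeZero n] : HahnSeries ℤ R →+* HahnSeries ℤ R :=
  HahnSeries.embDomainRingHom (AddMonoidHom.mulLeft (n : ℤ))
    (fun a b h => mul_left_cancel₀ (Nat.cast_ne_zero.2 (NeZero.ne n)) h)
    (fun a b => mul_le_mul_iff_right₀ (by exact_mod_cast Nat.pos_of_ne_zero (NeZero.ne n)))

theorem coeff_scaleHom_mul (n : ℕ) [NeZero n] (h : HahnSeries ℤ R) (a : ℤ) :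
    (scaleHom R n h).coeff (n * a) = h.coeff a :=
  HahnSeries.embDomain_coeff (f := ⟨⟨AddMonoidHom.mulLeft (n : ℤ), _⟩, _⟩)

theorem coeff_scaleHom_of_not_dvd (n : ℕ) [NeZero n] (h : HahnSeries ℤ R) (a : ℤ)
    (ha : ¬ (n : ℤ) ∣ a) : (scaleHom R n h).coeff a = 0 := by
  refine HahnSeries.embDomain_of_notMem_range (f := ⟨⟨AddMonoidHom.mulLeft (n : ℤ), _⟩, _⟩) ?_
  rintro ⟨b, rfl⟩
  exact ha (dvd_mul_right _ _)

/-- The ring homomorphism `h(X, Y) ↦ h(X ^ n, Y ^ m)` on iterated Laurent series. -/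
def scale (R : Type*) [CommRing R] (n m : ℕ) [NeZero n] [NeZero m] :
    HahnSeries ℤ (HahnSeries ℤ R) →+* HahnSeries ℤ (HahnSeries ℤ R) :=
  (scaleHom _ m).comp (mapHom (scaleHom R n))

variable (n m : ℕ)

theorem ext_c_scale {h h' : HahnSeries ℤ (HahnSeries ℤ R)}
    (h0 : ∀ j i : ℤ, ¬ ((m : ℤ) ∣ j ∧ (n : ℤ) ∣ i) → c h j i = c h' j i)
    (h1 : ∀ j i : ℤ, c h (m * j) (n * i) = c h' (m * j) (n * i)) : h = h' := by
  refine ext_c fun j i => ?_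
  by_cases hji : (m : ℤ) ∣ j ∧ (n : ℤ) ∣ i
  · obtain ⟨⟨j, rfl⟩, ⟨i, rfl⟩⟩ := hji
    exact h1 j i
  · exact h0 j i hji

variable [NeZero n] [NeZero m]

@[simp] theorem c_scale_mul (h : HahnSeries ℤ (HahnSeries ℤ R)) (j i : ℤ) :
    c (scale R n m h) (m * j) (n * i) = c h j i := by
  simp [c, scale, coeff_scaleHom_mul]

theorem c_scale_of_not_dvd (h : HahnSeries ℤ (HahnSeries ℤ R)) (j i : ℤ)
    (hji : ¬ ((m : ℤ) ∣ j ∧ (n : ℤ) ∣ i)) : c (scale R n m h) j i = 0 := by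
  rw [c, scale, RingHom.comp_apply]
  by_cases hj : (m : ℤ) ∣ j
  · obtain ⟨j, rfl⟩ := hj
    rw [coeff_scaleHom_mul, coeff_mapHom, coeff_scaleHom_of_not_dvd]
    exact fun hi => hji ⟨dvd_mul_right _ _, hi⟩
  · rw [coeff_scaleHom_of_not_dvd _ _ _ hj, HahnSeries.coeff_zero]

theorem scale_mono (j i : ℤ) (a : R) : scale R n m (mono j i a) = mono (m * j) (n * i) a := by
  refine ext_c_scale n m (fun j' i' h => ?_) (fun j' i' => ?_)
  · rw [c_scale_of_not_dvd _ _ _ _ _ h, c_mono, if_neg]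
    rintro ⟨rfl, rfl⟩
    exact h ⟨dvd_mul_right _ _, dvd_mul_right _ _⟩
  · rw [c_scale_mul, c_mono, c_mono]
    simp [NeZero.ne n, NeZero.ne m]

theorem map_scale (f : R →+* S) (h : HahnSeries ℤ (HahnSeries ℤ R)) :
    map f (scale R n m h) = scale S n m (map f h) := by
  refine ext_c_scale n m (fun j i hji => ?_) (fun j i => ?_)
  · rw [c_map, c_scale_of_not_dvd _ _ _ _ _ hji, c_scale_of_not_dvd _ _ _ _ _ hji, map_zero]
  · simp

theorem scale_injective : Function.Injective (scale R n m) := by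
  intro h h' H
  refine ext_c fun j i => ?_
  rw [← c_scale_mul n m, H, c_scale_mul]

/-- A series in which only exponents divisible by `n`, resp. `m`, occur is a series in
`X ^ n`, resp. `Y ^ m`. -/
theorem exists_scale_eq (h : HahnSeries ℤ (HahnSeries ℤ R))
    (hh : ∀ j i : ℤ, ¬ ((m : ℤ) ∣ j ∧ (n : ℤ) ∣ i) → c h j i = 0) : ∃ h', scale R n m h' = h := by
  have aux : ∀ {A : Type _} [AddCommGroup A] (k : ℕ) [NeZero k] (f : HahnSeries ℤ A),
      (Function.support fun a : ℤ => f.coeff (k * a)).IsPWO := by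
    intro A _ k _ f
    have hk : (0 : ℤ) < k := by exact_mod_cast Nat.pos_of_ne_zero (NeZero.ne k)
    by_cases hf : f = 0
    · subst hf
      simp
    rw [Set.isPWO_iff_isWF]
    -- The bound works for either sign of the order: `a < -|order|` implies `k a ≤ a < order`,
    -- because `a` is negative and `k ≥ 1`.
    refine BddBelow.isWF ⟨-|f.order|, fun a ha => ?_⟩
    by_contra! hlt
    refine ha (HahnSeries.coeff_eq_zero_of_lt_order ?_)
    have h1 := neg_abs_le f.order
    have h2 := abs_nonneg f.order
    nlinarith
  refine ⟨⟨fun j => ⟨fun i => c h (m * j) (n * i), aux n _⟩, (aux m h).mono ?_⟩, ?_⟩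
  · intro j hj h0
    refine hj ?_
    ext i
    exact congrArg (fun f => HahnSeries.coeff f ((n : ℤ) * i)) h0
  · refine ext_c_scale n m (fun j i hji => ?_) (fun j i => ?_)
    · rw [c_scale_of_not_dvd _ _ _ _ _ hji, hh j i hji]
    · rw [c_scale_mul]
      rfl

end DoubleLaurent
end

noncomputable section

namespace DoubleLaurent

/-! ### The grading by the Galois group and the twisted product -/

section Twist

open scoped Classical

variable {κ E : Type*} [Field κ] [Field E] [Algebra κ E]

/-- `σ` and `τ` are commuting automorphisms of orders `n` and `m` that generate the automorphism
group of `E/κ` as a direct product. -/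
structure IsBicyclic (σ τ : E ≃ₐ[κ] E) (n m : ℕ) : Prop where
  comm : σ * τ = τ * σ
  eq_one_iff : ∀ j i : ℤ, σ ^ i * τ ^ j = 1 ↔ (m : ℤ) ∣ j ∧ (n : ℤ) ∣ i
  surjective : ∀ g : E ≃ₐ[κ] E, ∃ j i : ℤ, σ ^ i * τ ^ j = g

theorem IsBicyclic.mul {σ τ : E ≃ₐ[κ] E} {n m : ℕ} (h : IsBicyclic σ τ n m) (j i j' i' : ℤ) :
    σ ^ i * τ ^ j * (σ ^ i' * τ ^ j') = σ ^ (i + i') * τ ^ (j + j') := by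
  have h1 : Commute (τ ^ j) (σ ^ i') := (show Commute τ σ from h.comm.symm).zpow_zpow j i'
  rw [zpow_add, zpow_add, mul_assoc, ← mul_assoc (τ ^ j), h1.eq]
  simp only [mul_assoc]

/-- Exponents of equal degree form a coset of `mℤ × nℤ`, so a homogeneous series is a monomial times
a series in `X ^ n` and `Y ^ m`. -/
theorem IsBicyclic.eq_iff {σ τ : E ≃ₐ[κ] E} {n m : ℕ} (h : IsBicyclic σ τ n m) (j i j' i' : ℤ) :
    σ ^ i * τ ^ j = σ ^ i' * τ ^ j' ↔ (m : ℤ) ∣ j - j' ∧ (n : ℤ) ∣ i - i' := by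
  rw [← h.eq_one_iff, sub_eq_add_neg, sub_eq_add_neg, ← h.mul, zpow_neg, zpow_neg]
  have h1 : (σ ^ i')⁻¹ * (τ ^ j')⁻¹ = (σ ^ i' * τ ^ j')⁻¹ := by
    rw [mul_inv_rev, (((show Commute σ τ from h.comm).zpow_zpow i' j').inv_inv).eq]
  rw [h1, mul_inv_eq_one]

variable (σ τ : E ≃ₐ[κ] E)

/-- The homogeneous component of degree `g`: the terms `Y ^ j X ^ i` with `σ ^ i τ ^ j = g`. -/
def comp (g : E ≃ₐ[κ] E) :
    HahnSeries ℤ (HahnSeries ℤ E) →+ HahnSeries ℤ (HahnSeries ℤ E) :=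
  coeffwise₂ fun j i => if σ ^ i * τ ^ j = g then AddMonoidHom.id E else 0

theorem c_comp (g : E ≃ₐ[κ] E) (t : HahnSeries ℤ (HahnSeries ℤ E)) (j i : ℤ) :
    c (comp σ τ g t) j i = if σ ^ i * τ ^ j = g then c t j i else 0 := by
  rw [comp, c_coeffwise₂]
  split_ifs <;> rfl

theorem comp_of_homogeneous {g : E ≃ₐ[κ] E} {t : HahnSeries ℤ (HahnSeries ℤ E)}
    (ht : ∀ j i : ℤ, σ ^ i * τ ^ j ≠ g → c t j i = 0) (g' : E ≃ₐ[κ] E) :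
    comp σ τ g' t = if g = g' then t else 0 := by
  refine ext_c fun j i => ?_
  rw [c_comp]
  by_cases h : σ ^ i * τ ^ j = g
  · rw [h]
    split_ifs <;> simp
  · rw [ht j i h]
    split_ifs <;> simp [ht j i h]

theorem map_algebraMap_map (g : E ≃ₐ[κ] E) (f : HahnSeries ℤ (HahnSeries ℤ κ)) :
    map (g : E →+* E) (map (algebraMap κ E) f) = map (algebraMap κ E) f :=
  ext_c fun j i => by simp

theorem comp_mem_integers {t : HahnSeries ℤ (HahnSeries ℤ E)} {j i : ℤ}
    (ht : mono (-j) (-i) 1 * t ∈ integers E) (g : E ≃ₐ[κ] E) :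
    mono (-j) (-i) 1 * comp σ τ g t ∈ integers E := by
  rw [mem_integers] at *
  intro j' i' h
  have := ht j' i' h
  rw [c_mono_mul, c_comp] at *
  split_ifs <;> simp_all

variable [FiniteDimensional κ E]

theorem sum_comp (t : HahnSeries ℤ (HahnSeries ℤ E)) : ∑ g, comp σ τ g t = t := by
  refine ext_c fun j i => ?_
  simp [c_comp]

/-- The twisted product of iterated Laurent series, in which `X e = σ(e) X` and `Y e = τ(e) Y`
for `e ∈ E`. -/
def twist (t h : HahnSeries ℤ (HahnSeries ℤ E)) : HahnSeries ℤ (HahnSeries ℤ E) :=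
  ∑ g, comp σ τ g t * map (g : E →+* E) h

theorem twist_add_left (t t' h : HahnSeries ℤ (HahnSeries ℤ E)) :
    twist σ τ (t + t') h = twist σ τ t h + twist σ τ t' h := by
  simp [twist, add_mul, Finset.sum_add_distrib]

theorem twist_zero_left (h : HahnSeries ℤ (HahnSeries ℤ E)) : twist σ τ 0 h = 0 := by
  simp [twist]

theorem twist_of_homogeneous {g : E ≃ₐ[κ] E} {t : HahnSeries ℤ (HahnSeries ℤ E)}
    (ht : ∀ j i : ℤ, σ ^ i * τ ^ j ≠ g → c t j i = 0) (h : HahnSeries ℤ (HahnSeries ℤ E)) :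
    twist σ τ t h = t * map (g : E →+* E) h := by
  simp [twist, comp_of_homogeneous σ τ ht, ite_mul]

/-- The automorphisms fix coefficients in `κ`. Hence the twisted product is linear in its right
factor over all of `κ((X))((Y))`, not only over `κ((x))((y))`; this is what yields a matrix
representation of degree `nm`. -/
theorem twist_algebraMap_mul (t h : HahnSeries ℤ (HahnSeries ℤ E))
    (f : HahnSeries ℤ (HahnSeries ℤ κ)) :
    twist σ τ t (map (algebraMap κ E) f * h) = map (algebraMap κ E) f * twist σ τ t h := by
  simp only [twist, map_mul, map_algebraMap_map, Finset.mul_sum]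
  exact Finset.sum_congr rfl fun _ _ => by ring

/-- Twisted multiplication by a series with leading term `a Y ^ j X ^ i` is, up to the shift by
`Y ^ j X ^ i`, integral with reduction `e ↦ a σ ^ i τ ^ j (e)`. -/
theorem twist_leading {t : HahnSeries ℤ (HahnSeries ℤ E)} {j i : ℤ}
    (ht : mono (-j) (-i) 1 * t ∈ integers E) {h : HahnSeries ℤ (HahnSeries ℤ E)}
    (hh : h ∈ integers E) :
    mono (-j) (-i) 1 * twist σ τ t h ∈ integers E ∧
      c (mono (-j) (-i) 1 * twist σ τ t h) 0 0 =
        c t j i * (σ ^ i * τ ^ j : E ≃ₐ[κ] E) (c h 0 0) := by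
  have h1 : mono (-j) (-i) 1 * twist σ τ t h =
      ∑ g, mono (-j) (-i) 1 * comp σ τ g t * map (g : E →+* E) h := by
    simp only [twist, Finset.mul_sum, mul_assoc]
  have h2 := comp_mem_integers σ τ ht
  rw [h1]
  refine ⟨sum_mem fun g _ => mul_mem (h2 g) (map_mem_integers _ hh), ?_⟩
  -- Only the component of degree `σ ^ i τ ^ j` contains the term at `Y ^ j X ^ i`; after the shift
  -- all others have residue `0`.
  rw [c_sum, Finset.sum_eq_single (σ ^ i * τ ^ j)]
  · rw [c_zero_mul (h2 _) (map_mem_integers _ hh), c_mono_mul, c_comp, c_map]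
    simp
  · intro g _ hg
    rw [c_zero_mul (h2 _) (map_mem_integers _ hh), c_mono_mul, c_comp, if_neg]
    · simp
    · simpa using hg.symm
  · simp

end Twist

end DoubleLaurent
end

noncomputable section

/-! ### The algebra over `κ((x))((y))` as twisted Laurent series -/

open DoubleLaurent

/-- A model of the tensor product of cyclic algebras `(K/k', σ, x) ⊗ (L/k', τ, y)`, `E = KL`, over
`k' = κ((x))((y))`: a `k'`-algebra `B` of dimension at most `(nm)²` that acts on `E((X))((Y))`
(where `X ^ n = x` and `Y ^ m = y`) and contains `E`, acting by multiplication, and units `u`, `v`,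
acting as `X σ` and `Y τ`. -/
structure SplitModel {κ E : Type*} [Field κ] [Field E] [Algebra κ E] (σ τ : E ≃ₐ[κ] E) (n m : ℕ)
    [NeZero n] [NeZero m] (B : Type*) [Ring B] [Algebra (LaurentSeries₂ κ) B] where
  bicyclic : IsBicyclic σ τ n m
  finrank_eq : Module.finrank κ E = n * m
  act : B →+* AddMonoid.End (LaurentSeries₂ E)
  act_algebraMap (f : LaurentSeries₂ κ) (h : LaurentSeries₂ E) :
    act (algebraMap _ B f) h = map (algebraMap κ E) (scale κ n m f) * h
  ι : E →+* B
  act_ι (e : E) (h : LaurentSeries₂ E) : act (ι e) h = mono 0 0 e * h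
  u : Bˣ
  v : Bˣ
  act_u (h : LaurentSeries₂ E) : act u h = mono 0 1 1 * map (σ : E →+* E) h
  act_v (h : LaurentSeries₂ E) : act v h = mono 1 0 1 * map (τ : E →+* E) h
  finite : Module.Finite (LaurentSeries₂ κ) B
  finrank_le : Module.finrank (LaurentSeries₂ κ) B ≤ (n * m) ^ 2

namespace SplitModel

variable {κ E : Type*} [Field κ] [Field E] [Algebra κ E] {σ τ : E ≃ₐ[κ] E} {n m : ℕ}
  [NeZero n] [NeZero m] {B : Type*} [Ring B] [Algebra (LaurentSeries₂ κ) B]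
  (M : SplitModel σ τ n m B)

theorem act_mul (d d' : B) (h : LaurentSeries₂ E) : M.act (d * d') h = M.act d (M.act d' h) := by
  rw [map_mul]
  rfl

theorem act_add (d d' : B) (h : LaurentSeries₂ E) : M.act (d + d') h = M.act d h + M.act d' h := by
  rw [map_add]
  rfl

theorem act_one (h : LaurentSeries₂ E) : M.act 1 h = h := by
  rw [map_one]
  rfl

theorem act_zero (h : LaurentSeries₂ E) : M.act 0 h = 0 := by
  rw [map_zero]
  rfl

theorem act_smul (f : LaurentSeries₂ κ) (d : B) (h : LaurentSeries₂ E) :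
    M.act (f • d) h = map (algebraMap κ E) (scale κ n m f) * M.act d h := by
  rw [Algebra.smul_def, act_mul, act_algebraMap]

/-- The units of `B` acting as a shift times an automorphism. -/
def w (j i : ℤ) : Bˣ := M.u ^ i * M.v ^ j

theorem act_unit_inv {w : Bˣ} {j i : ℤ} {g : E ≃ₐ[κ] E}
    (hw : ∀ h, M.act w h = mono j i 1 * map (g : E →+* E) h) (h : LaurentSeries₂ E) :
    M.act (w⁻¹ : Bˣ) h = mono (-j) (-i) 1 * map ((g⁻¹ : E ≃ₐ[κ] E) : E →+* E) h := by
  have h1 : M.act w (mono (-j) (-i) 1 * map ((g⁻¹ : E ≃ₐ[κ] E) : E →+* E) h) = h := by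
    rw [hw, map_mul, map_mono, map_one, mono_mul_cancel]
    refine ext_c fun j i => ?_
    rw [c_map, c_map]
    exact g.apply_symm_apply _
  nth_rewrite 1 [← h1]
  rw [← act_mul, Units.inv_mul, act_one]

theorem act_unit_mul {w w' : Bˣ} {j i j' i' : ℤ} {g g' : E ≃ₐ[κ] E}
    (hw : ∀ h, M.act w h = mono j i 1 * map (g : E →+* E) h)
    (hw' : ∀ h, M.act w' h = mono j' i' 1 * map (g' : E →+* E) h) (h : LaurentSeries₂ E) :
    M.act (w * w' : Bˣ) h = mono (j + j') (i + i') 1 * map ((g * g' : E ≃ₐ[κ] E) : E →+* E) h := by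
  rw [Units.val_mul, act_mul, hw', hw, map_mul, map_mono, map_one, ← mul_assoc, mono_mul_mono,
    one_mul]
  rfl

theorem act_unit_one (h : LaurentSeries₂ E) :
    M.act (1 : Bˣ) h = mono 0 0 1 * map ((1 : E ≃ₐ[κ] E) : E →+* E) h := by
  rw [Units.val_one, act_one, mono_zero_one, one_mul]
  rfl

theorem act_unit_pow {w : Bˣ} {j i : ℤ} {g : E ≃ₐ[κ] E}
    (hw : ∀ h, M.act w h = mono j i 1 * map (g : E →+* E) h) (k : ℕ) :
    ∀ h, M.act (w ^ k : Bˣ) h =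
      mono (k * j) (k * i) 1 * map ((g ^ k : E ≃ₐ[κ] E) : E →+* E) h := by
  induction k with
  | zero => simpa using M.act_unit_one
  | succ k ih =>
    intro h
    rw [pow_succ, M.act_unit_mul ih hw, ← pow_succ]
    push_cast
    rw [add_mul, add_mul, one_mul, one_mul]

theorem act_unit_zpow {w : Bˣ} {j i : ℤ} {g : E ≃ₐ[κ] E}
    (hw : ∀ h, M.act w h = mono j i 1 * map (g : E →+* E) h) (k : ℤ) :
    ∀ h, M.act (w ^ k : Bˣ) h =
      mono (k * j) (k * i) 1 * map ((g ^ k : E ≃ₐ[κ] E) : E →+* E) h := by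
  obtain ⟨k, rfl | rfl⟩ := k.eq_nat_or_neg
  · intro h
    rw [zpow_natCast, zpow_natCast, M.act_unit_pow hw]
  · intro h
    rw [zpow_neg, zpow_neg, zpow_natCast, zpow_natCast, M.act_unit_inv (M.act_unit_pow hw k),
      neg_mul, neg_mul]

theorem act_w (j i : ℤ) (h : LaurentSeries₂ E) :
    M.act (M.w j i) h = mono j i 1 * map ((σ ^ i * τ ^ j : E ≃ₐ[κ] E) : E →+* E) h := by
  rw [w, M.act_unit_mul (M.act_unit_zpow M.act_u i) (M.act_unit_zpow M.act_v j)]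
  simp

/-- Evaluation of the action at `1`. -/
def ev : B →+ LaurentSeries₂ E where
  toFun d := M.act d 1
  map_zero' := M.act_zero 1
  map_add' d d' := M.act_add d d' 1

theorem ev_apply (d : B) : M.ev d = M.act d 1 := rfl

theorem ev_smul (f : LaurentSeries₂ κ) (d : B) :
    M.ev (f • d) = map (algebraMap κ E) (scale κ n m f) * M.ev d := M.act_smul f d 1

theorem ev_ι_mul (e : E) (d : B) : M.ev (M.ι e * d) = mono 0 0 e * M.ev d := by
  rw [ev_apply, act_mul, act_ι, ev_apply]

theorem ev_w (j i : ℤ) : M.ev (M.w j i) = mono j i 1 := by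
  rw [ev_apply, act_w, map_one, mul_one]

theorem ev_one : M.ev 1 = 1 := M.act_one 1

section Basis

/-- Exponents `(j, i)` with `σ ^ i τ ^ j = g`. -/
def deg (g : E ≃ₐ[κ] E) : ℤ × ℤ :=
  ((M.bicyclic.surjective g).choose, (M.bicyclic.surjective g).choose_spec.choose)

theorem deg_spec (g : E ≃ₐ[κ] E) : σ ^ (M.deg g).2 * τ ^ (M.deg g).1 = g :=
  (M.bicyclic.surjective g).choose_spec.choose_spec

/-- The family `e_b u ^ i v ^ j` in `B`, where `e_b` runs through a basis of `E/κ` and `u ^ i v ^ j`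
through representatives for the Galois group. -/
def family {ι : Type*} (b : Module.Basis ι κ E) (p : (E ≃ₐ[κ] E) × ι) : B :=
  M.ι (b p.2) * M.w (M.deg p.1).1 (M.deg p.1).2

variable {ι : Type*} (b : Module.Basis ι κ E)

theorem ev_family (p : (E ≃ₐ[κ] E) × ι) :
    M.ev (M.family b p) = mono (M.deg p.1).1 (M.deg p.1).2 (b p.2) := by
  rw [family, ev_ι_mul, ev_w, mono_mul_mono, mul_one, zero_add, zero_add]

theorem c_ev_smul_family (p : (E ≃ₐ[κ] E) × ι) (f : LaurentSeries₂ κ) (j i : ℤ) :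
    c (M.ev (f • M.family b p)) j i = c (scale κ n m f) (j - (M.deg p.1).1) (i - (M.deg p.1).2) •
      b p.2 := by
  rw [ev_smul, ev_family, mul_comm, c_mono_mul, c_map, Algebra.smul_def, mul_comm]

/-- Scalars from `κ((x))((y))` involve only exponents in `mℤ × nℤ`, which have trivial degree, so
they do not change the degree of a member of the family. -/
theorem ev_smul_family_homogeneous (p : (E ≃ₐ[κ] E) × ι) (f : LaurentSeries₂ κ) (j i : ℤ)
    (h : σ ^ i * τ ^ j ≠ p.1) : c (M.ev (f • M.family b p)) j i = 0 := by
  rw [c_ev_smul_family, c_scale_of_not_dvd, zero_smul]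
  rwa [← M.bicyclic.eq_iff, M.deg_spec]

variable [FiniteDimensional κ E]

theorem act_smul_family (p : (E ≃ₐ[κ] E) × ι) (f : LaurentSeries₂ κ) (h : LaurentSeries₂ E) :
    M.act (f • M.family b p) h = twist σ τ (M.ev (f • M.family b p)) h := by
  rw [twist_of_homogeneous σ τ (M.ev_smul_family_homogeneous b p f), M.ev_smul, act_smul, family,
    act_mul, act_ι, act_w, ev_ι_mul, ev_w, M.deg_spec]
  ring

/-- The coefficient at `(m j, n i)` shifted by the exponents of `g` sees only the members of the
family of degree `g`, and there a relation becomes a `κ`-linear relation between the basis elements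
of `E`. Both the independence of the family and the injectivity of `ev` come from this. -/
theorem eq_zero_of_ev_sum_eq_zero [Fintype ι] (f : (E ≃ₐ[κ] E) × ι → LaurentSeries₂ κ)
    (hf : M.ev (∑ p, f p • M.family b p) = 0) : f = 0 := by
  ext1 ⟨g, a⟩
  refine ext_c fun j i => ?_
  have h1 : c (M.ev (∑ p, f p • M.family b p)) (m * j + (M.deg g).1) (n * i + (M.deg g).2) =
      ∑ a, c (f (g, a)) j i • b a := by
    rw [map_sum, c_sum, Fintype.sum_prod_type, Finset.sum_eq_single g]
    · refine Finset.sum_congr rfl fun a _ => ?_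
      rw [c_ev_smul_family, add_sub_cancel_right, add_sub_cancel_right, c_scale_mul]
    -- A degree `g'` that contributes at this exponent has exponents congruent to those of `g`,
    -- hence equals `g`.
    · intro g' _ hg'
      refine Finset.sum_eq_zero fun a _ => M.ev_smul_family_homogeneous b _ _ _ _ ?_
      rw [← M.deg_spec g'] at hg'
      rw [← M.deg_spec g', Ne, M.bicyclic.eq_iff]
      rw [Ne, ← M.deg_spec g, M.bicyclic.eq_iff] at hg'
      contrapose! hg'
      rw [← M.deg_spec g] at hg'
      rw [← dvd_neg, ← dvd_neg (a := (n : ℤ))]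
      refine ⟨?_, ?_⟩
      · simpa using (Int.dvd_add_right (dvd_mul_right (m : ℤ) j)).1
          (by simpa [add_sub_assoc, M.deg_spec] using hg'.1)
      · simpa using (Int.dvd_add_right (dvd_mul_right (n : ℤ) i)).1
          (by simpa [add_sub_assoc, M.deg_spec] using hg'.2)
    · simp
  rw [hf, c_zero] at h1
  exact Fintype.linearIndependent_iff.1 b.linearIndependent _ h1.symm a

theorem linearIndependent_family [Fintype ι] :
    LinearIndependent (LaurentSeries₂ κ) (M.family b) := by
  rw [Fintype.linearIndependent_iff]
  intro f hf p
  rw [M.eq_zero_of_ev_sum_eq_zero b f (by rw [hf, map_zero])]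
  rfl

theorem card_index (M : SplitModel σ τ n m B) (b : Module.Basis ι κ E) [IsGalois κ E] [Fintype ι] :
    Fintype.card ((E ≃ₐ[κ] E) × ι) = (n * m) ^ 2 := by
  rw [Fintype.card_prod, ← Nat.card_eq_fintype_card, IsGalois.card_aut_eq_finrank,
    ← Module.finrank_eq_card_basis b, M.finrank_eq, sq]

/-- The presentation bounds the dimension from above; the independent family, of `|G| · [E : κ]`
elements, bounds it from below. -/
theorem finrank_model (M : SplitModel σ τ n m B) [IsGalois κ E] : Module.finrank (LaurentSeries₂ κ) B = (n * m) ^ 2 := by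
  have := M.finite
  let b := Module.finBasis κ E
  refine le_antisymm M.finrank_le ?_
  rw [← M.card_index b]
  exact (M.linearIndependent_family b).fintype_card_le_finrank

/-- The family `e_b u ^ i v ^ j` is a basis of `B`. -/
theorem exists_eq_sum [IsGalois κ E] [Fintype ι] (d : B) :
    ∃ f : (E ≃ₐ[κ] E) × ι → LaurentSeries₂ κ, d = ∑ p, f p • M.family b p := by
  have := M.finite
  have hN : 0 < n * m := Nat.pos_of_ne_zero (mul_ne_zero (NeZero.ne n) (NeZero.ne m))
  have : Nonempty ((E ≃ₐ[κ] E) × ι) := by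
    rw [← Fintype.card_pos_iff, M.card_index b]
    positivity
  let B' := basisOfLinearIndependentOfCardEqFinrank (M.linearIndependent_family b)
    (by rw [M.card_index b, M.finrank_model])
  refine ⟨B'.repr d, ?_⟩
  conv_lhs => rw [← B'.sum_repr d]
  simp [B']

theorem ev_injective [IsGalois κ E] : Function.Injective M.ev := by
  rw [injective_iff_map_eq_zero]
  intro d hd
  obtain ⟨f, rfl⟩ := M.exists_eq_sum (Module.finBasis κ E) d
  rw [M.eq_zero_of_ev_sum_eq_zero _ f hd]
  refine Finset.sum_eq_zero fun p _ => ?_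
  rw [Pi.zero_apply, Algebra.smul_def, map_zero, zero_mul]

/-- Elements of `B` act by twisted multiplication. -/
theorem act_eq_twist [IsGalois κ E] (d : B) (h : LaurentSeries₂ E) :
    M.act d h = twist σ τ (M.ev d) h := by
  obtain ⟨f, rfl⟩ := M.exists_eq_sum (Module.finBasis κ E) d
  induction (Finset.univ : Finset ((E ≃ₐ[κ] E) × Fin _)) using Finset.cons_induction with
  | empty => simp [twist_zero_left]
  | cons a s ha ih => rw [Finset.sum_cons, act_add, map_add, twist_add_left, ih, act_smul_family]

theorem ev_mul [IsGalois κ E] (d d' : B) : M.ev (d * d') = twist σ τ (M.ev d) (M.ev d') := by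
  rw [ev_apply, act_mul, act_eq_twist, ← ev_apply]

/-- Divided by its monomial, a homogeneous component becomes a series in `X ^ n` and `Y ^ m`; its
coordinates in a basis of `E/κ` are the scalars to use. -/
theorem ev_surjective [IsGalois κ E] : Function.Surjective M.ev := by
  intro t
  let b := Module.finBasis κ E
  have h1 : ∀ g : E ≃ₐ[κ] E, ∃ d, M.ev d = comp σ τ g t := by
    intro g
    obtain ⟨h0, hh0⟩ := exists_scale_eq n m (mono (-(M.deg g).1) (-(M.deg g).2) 1 * comp σ τ g t)
      (fun j i hji => by
        have h := M.bicyclic.eq_iff (j - -(M.deg g).1) (i - -(M.deg g).2) (M.deg g).1 (M.deg g).2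
        rw [M.deg_spec] at h
        rw [c_mono_mul, c_comp, if_neg, mul_zero]
        rw [h]
        simpa using hji)
    refine ⟨∑ a, (coeffwise₂ (fun _ _ => (b.coord a).toAddMonoidHom) h0) • M.family b (g, a), ?_⟩
    rw [← mono_mul_cancel (M.deg g).1 (M.deg g).2 (comp σ τ g t), ← hh0, map_sum]
    simp only [ev_smul, ev_family, map_scale]
    have h2 : h0 = ∑ a, map (algebraMap κ E)
        (coeffwise₂ (fun _ _ => (b.coord a).toAddMonoidHom) h0) * mono 0 0 (b a) := by
      refine ext_c fun j i => ?_
      rw [c_sum]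
      conv_lhs => rw [← b.sum_repr (c h0 j i)]
      refine Finset.sum_congr rfl fun a _ => ?_
      rw [mul_comm, c_mono_mul, Algebra.smul_def, mul_comm]
      simp
    conv_rhs => rw [h2, map_sum, Finset.mul_sum]
    refine Finset.sum_congr rfl fun a _ => ?_
    rw [map_mul, scale_mono, mul_left_comm, mono_mul_mono]
    simp
  choose d hd using h1
  refine ⟨∑ g, d g, ?_⟩
  rw [map_sum]
  simp only [hd, sum_comp]

end Basis

end SplitModel
end

noncomputable section

/-! ### Leading terms -/

open DoubleLaurent

/-- The subgroup of `Eˣ` generated by the elements `g(a) / a` for `g` in the automorphism group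
of `E/κ`. -/
def augmentationSubgroup (κ E : Type*) [Field κ] [Field E] [Algebra κ E] : Subgroup Eˣ :=
  Subgroup.closure {x | ∃ (g : E ≃ₐ[κ] E) (a : Eˣ), x = Units.map (g : E →* E) a / a}

namespace SplitModel

section Coordinates

variable {κ E : Type*} [Field κ] [Field E] [Algebra κ E]

variable {ι : Type*} (b : Module.Basis ι κ E)

/-- The coordinate of a series, with respect to a basis of `E/κ`. -/
def coordinate (a : ι) : LaurentSeries₂ E →+ LaurentSeries₂ κ :=
  coeffwise₂ fun _ _ => (b.coord a).toAddMonoidHom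

theorem c_coordinate (a : ι) (h : LaurentSeries₂ E) (j i : ℤ) :
    c (coordinate b a h) j i = b.repr (c h j i) a := rfl

theorem sum_coordinate [Fintype ι] (h : LaurentSeries₂ E) :
    ∑ a, map (algebraMap κ E) (coordinate b a h) * mono 0 0 (b a) = h := by
  refine ext_c fun j i => ?_
  rw [c_sum]
  conv_rhs => rw [← b.sum_repr (c h j i)]
  refine Finset.sum_congr rfl fun a _ => ?_
  rw [mul_comm, c_mono_mul, Algebra.smul_def, mul_comm]
  simp [c_coordinate]

theorem coordinate_sum [Fintype ι] (f : ι → LaurentSeries₂ κ) (a : ι) :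
    coordinate b a (∑ a', map (algebraMap κ E) (f a') * mono 0 0 (b a')) = f a := by
  refine ext_c fun j i => ?_
  have h : ∀ a', c (map (algebraMap κ E) (f a') * mono 0 0 (b a')) j i = c (f a') j i • b a' := by
    intro a'
    rw [mul_comm, c_mono_mul, Algebra.smul_def, mul_comm]
    simp
  rw [c_coordinate, c_sum, Finset.sum_congr rfl fun a' _ => h a', b.repr_sum_self]

end Coordinates

variable {κ : Type u} {E : Type v} [Field κ] [Field E] [Algebra κ E] {σ τ : E ≃ₐ[κ] E} {n m : ℕ}
  [NeZero n] [NeZero m] {B : Type w} [Ring B] [Algebra (LaurentSeries₂ κ) B]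
  (M : SplitModel σ τ n m B)

/-- The element `d` has leading term `a u ^ i v ^ j`. -/
def HasLeading (d : B) (j i : ℤ) (a : E) : Prop :=
  a ≠ 0 ∧ ∀ h ∈ integers E, mono (-j) (-i) 1 * M.act d h ∈ integers E ∧
    c (mono (-j) (-i) 1 * M.act d h) 0 0 = a * (σ ^ i * τ ^ j : E ≃ₐ[κ] E) (c h 0 0)

variable {M}

theorem HasLeading.c_ev {d : B} {j i : ℤ} {a : E} (h : M.HasLeading d j i a) :
    c (M.ev d) j i = a := by
  have := (h.2 1 (one_mem _)).2
  rw [c_mono_mul, c_one, if_pos ⟨rfl, rfl⟩, map_one (σ ^ i * τ ^ j), mul_one, one_mul] at this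
  simpa [ev_apply] using this

theorem HasLeading.c_ev_of_lt {d : B} {j i : ℤ} {a : E} (h : M.HasLeading d j i a) {j' i' : ℤ}
    (hlt : j' < j ∨ j' = j ∧ i' < i) : c (M.ev d) j' i' = 0 := by
  have := mem_integers.1 (h.2 1 (one_mem _)).1 (j' - j) (i' - i) (by omega)
  rw [c_mono_mul, one_mul] at this
  simpa [ev_apply] using this

/-- A leading exponent is the lexicographically first one with a nonzero coefficient in `ev d`, so
neither of two can precede the other. -/
theorem HasLeading.unique {d : B} {j i j' i' : ℤ} {a a' : E} (h : M.HasLeading d j i a)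
    (h' : M.HasLeading d j' i' a') : j = j' ∧ i = i' ∧ a = a' := by
  have h1 : ¬ (j' < j ∨ j' = j ∧ i' < i) := fun hlt => h'.1 (by
    rw [← h'.c_ev, h.c_ev_of_lt hlt])
  have h2 : ¬ (j < j' ∨ j = j' ∧ i < i') := fun hlt => h.1 (by
    rw [← h.c_ev, h'.c_ev_of_lt hlt])
  obtain rfl : j = j' := by omega
  obtain rfl : i = i' := by omega
  exact ⟨rfl, rfl, h.c_ev.symm.trans h'.c_ev⟩

theorem hasLeading_ι {a : E} (ha : a ≠ 0) : M.HasLeading (M.ι a) 0 0 a := by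
  refine ⟨ha, fun h hh => ?_⟩
  have h1 : mono (-0) (-0) 1 * M.act (M.ι a) h = mono 0 0 a * h := by
    rw [act_ι, neg_zero, mono_zero_one, one_mul]
  rw [h1]
  refine ⟨mul_mem (mono_mem_integers a) hh, ?_⟩
  simp

theorem nontrivial_model (M : SplitModel σ τ n m B) : Nontrivial B := by
  refine ⟨⟨1, 0, fun h => ?_⟩⟩
  have h1 := M.ev_one
  rw [h, map_zero] at h1
  exact zero_ne_one h1

theorem mk_map_eq (g : E ≃ₐ[κ] E) (a : Eˣ) :
    (QuotientGroup.mk (Units.map (g : E →* E) a) : Eˣ ⧸ augmentationSubgroup κ E) =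
      QuotientGroup.mk a := by
  rw [QuotientGroup.eq_iff_div_mem]
  exact Subgroup.subset_closure ⟨g, a, rfl⟩

variable [FiniteDimensional κ E] [IsGalois κ E]

theorem act_algebraMap_mul (d : B) (f : LaurentSeries₂ κ) (h : LaurentSeries₂ E) :
    M.act d (map (algebraMap κ E) f * h) = map (algebraMap κ E) f * M.act d h := by
  rw [act_eq_twist, act_eq_twist, twist_algebraMap_mul]

/-- Multiplication by the variables commutes with the whole action, in contrast to `u` and `v`,
which act as `X σ` and `Y τ` and do not commute with `E`. -/
theorem act_mono_mul (d : B) (j i : ℤ) (h : LaurentSeries₂ E) :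
    M.act d (mono j i 1 * h) = mono j i 1 * M.act d h := by
  have := act_algebraMap_mul (M := M) d (mono j i 1) h
  rwa [map_mono, map_one] at this

/-- Shifts commute with the action, so the normalized action of a product is the composition of the
normalized actions. The reductions `e ↦ a σ ^ i τ ^ j (e)` compose in the same way. -/
theorem HasLeading.mul {d d' : B} {j i j' i' : ℤ} {a a' : E} (h : M.HasLeading d j i a)
    (h' : M.HasLeading d' j' i' a') :
    M.HasLeading (d * d') (j + j') (i + i') (a * (σ ^ i * τ ^ j : E ≃ₐ[κ] E) a') := by
  refine ⟨mul_ne_zero h.1 (by simpa using h'.1), fun t ht => ?_⟩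
  have h1 : mono (-(j + j')) (-(i + i')) 1 * M.act (d * d') t =
      mono (-j) (-i) 1 * M.act d (mono (-j') (-i') 1 * M.act d' t) := by
    rw [act_mul, act_mono_mul, ← mul_assoc, mono_mul_mono, one_mul, neg_add, neg_add]
  have h2 := h'.2 t ht
  have h3 := h.2 _ h2.1
  rw [h1]
  refine ⟨h3.1, ?_⟩
  rw [h3.2, h2.2, map_mul, mul_assoc, ← AlgEquiv.mul_apply, M.bicyclic.mul]

theorem exists_hasLeading {d : B} (hd : d ≠ 0) : ∃ j i a, M.HasLeading d j i a := by
  have h1 : M.ev d ≠ 0 := fun h => hd (M.ev_injective (by rw [h, map_zero]))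
  obtain ⟨j, i, h2, h3⟩ := exists_leading h1
  refine ⟨j, i, _, h2, fun h hh => ?_⟩
  rw [act_eq_twist]
  exact twist_leading σ τ h3 hh

theorem exists_hasLeading_unit (d : Bˣ) :
    ∃ p : ℤ × ℤ × Eˣ, M.HasLeading d p.1 p.2.1 p.2.2 := by
  have := M.nontrivial_model
  obtain ⟨j, i, a, h⟩ := exists_hasLeading (M := M) d.ne_zero
  exact ⟨⟨j, i, Units.mk0 a h.1⟩, h⟩

variable (M)

/-- The homomorphism that sends a unit to the class of its leading coefficient. -/
def leading : Bˣ →* Eˣ ⧸ augmentationSubgroup κ E where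
  toFun d := QuotientGroup.mk (exists_hasLeading_unit (M := M) d).choose.2.2
  map_one' := by
    have h := (exists_hasLeading_unit (M := M) 1).choose_spec
    have h1 := hasLeading_ι (M := M) (a := 1) one_ne_zero
    rw [map_one] at h1
    exact congrArg QuotientGroup.mk (Units.ext (h.unique h1).2.2 : _ = (1 : Eˣ))
  map_mul' d d' := by
    have h := (exists_hasLeading_unit (M := M) d).choose_spec
    have h' := (exists_hasLeading_unit (M := M) d').choose_spec
    have h1 := (exists_hasLeading_unit (M := M) (d * d')).choose_spec
    set p := (exists_hasLeading_unit (M := M) d).choose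
    set p' := (exists_hasLeading_unit (M := M) d').choose
    have h2 : (exists_hasLeading_unit (M := M) (d * d')).choose.2.2 =
        p.2.2 * Units.map ((σ ^ p.2.1 * τ ^ p.1 : E ≃ₐ[κ] E) : E →* E) p'.2.2 :=
      Units.ext (h1.unique (h.mul h')).2.2
    rw [h2, QuotientGroup.mk_mul, mk_map_eq]

variable {M}

theorem leading_eq {d : Bˣ} {j i : ℤ} {a : Eˣ} (h : M.HasLeading d j i a) :
    M.leading d = QuotientGroup.mk a := by
  have h1 := (exists_hasLeading_unit (M := M) d).choose_spec
  change QuotientGroup.mk _ = _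
  rw [Units.ext (h1.unique h).2.2]

/-! ### The reduced norm -/

variable (κ n m) in
/-- The field `κ((X))((Y))` as an extension of `κ((x))((y))` with `x = X ^ n` and `y = Y ^ m`. -/
def RamifiedLaurent : Type u :=
  have _ := n
  have _ := m
  LaurentSeries₂ κ

instance : Field (RamifiedLaurent κ n m) := inferInstanceAs (Field (LaurentSeries₂ κ))

instance : Algebra (LaurentSeries₂ κ) (RamifiedLaurent κ n m) :=
  RingHom.toAlgebra (scale κ n m : LaurentSeries₂ κ →+* LaurentSeries₂ κ)

variable {ι : Type*} [Fintype ι] [DecidableEq ι] (b : Module.Basis ι κ E)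

variable (M)

/-- The matrix by which `d` acts. -/
def repMatrix (d : B) : Matrix ι ι (LaurentSeries₂ κ) :=
  Matrix.of fun a a' => coordinate b a (M.act d (mono 0 0 (b a')))

theorem sum_repMatrix (d : B) (a' : ι) :
    ∑ a, map (algebraMap κ E) (M.repMatrix b d a a') * mono 0 0 (b a) =
      M.act d (mono 0 0 (b a')) :=
  sum_coordinate b _

theorem repMatrix_mul (d d' : B) :
    M.repMatrix b (d * d') = M.repMatrix b d * M.repMatrix b d' := by
  ext1 a a'
  have h1 : M.act (d * d') (mono 0 0 (b a')) =
      ∑ x, map (algebraMap κ E) ((M.repMatrix b d * M.repMatrix b d') x a') * mono 0 0 (b x) := by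
    rw [act_mul, ← sum_repMatrix, map_sum]
    simp only [act_algebraMap_mul, Matrix.mul_apply, map_sum, Finset.sum_mul, map_mul]
    rw [Finset.sum_comm]
    refine Finset.sum_congr rfl fun a _ => ?_
    rw [← sum_repMatrix, Finset.mul_sum]
    exact Finset.sum_congr rfl fun _ _ => by ring
  rw [repMatrix, Matrix.of_apply, h1, coordinate_sum]

theorem repMatrix_algebraMap (f : LaurentSeries₂ κ) :
    M.repMatrix b (algebraMap _ B f) = Matrix.scalar ι (scale κ n m f) := by
  ext1 a a'
  have h1 : M.act (algebraMap _ B f) (mono 0 0 (b a')) =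
      ∑ x, map (algebraMap κ E) (Matrix.scalar ι (scale κ n m f) x a') * mono 0 0 (b x) := by
    rw [act_algebraMap, Finset.sum_eq_single a']
    · simp
    · intro x _ hx
      simp [hx]
    · simp
  rw [repMatrix, Matrix.of_apply, h1, coordinate_sum]

/-- The representation of `B` by matrices over `κ((X))((Y))`. -/
def rep : B →ₐ[LaurentSeries₂ κ] Matrix ι ι (RamifiedLaurent κ n m) where
  toFun d := M.repMatrix b d
  map_one' := by
    have := M.repMatrix_algebraMap b 1
    rwa [map_one, map_one, map_one] at this
  map_mul' := M.repMatrix_mul b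
  map_zero' := by
    have := M.repMatrix_algebraMap b 0
    rwa [map_zero, map_zero, map_zero] at this
  map_add' d d' := by
    ext1 a a'
    change coordinate b a (M.act (d + d') _) = _
    rw [act_add, map_add]
    rfl
  commutes' f := M.repMatrix_algebraMap b f

/-- The action is a splitting of degree `nm` over `κ((X))((Y))`, so its determinant is one of those
that define the reduced norm. -/
theorem det_rep_eq_one {d : Bˣ} (hd : d ∈ SL1 (LaurentSeries₂ κ) B) :
    (M.repMatrix (Module.finBasisOfFinrankEq κ E M.finrank_eq) d).det = 1 := by
  have := hd (RamifiedLaurent κ n m) (n * m)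
    (M.rep (Module.finBasisOfFinrankEq κ E M.finrank_eq)) M.finrank_model.symm
  rwa [map_one] at this

variable {M}

/-- Divided by the leading monomial, the matrix is integral, and its residue is the matrix over `κ`
of `e ↦ a σ ^ i τ ^ j (e)`. The determinant commutes with the residue map, and the monomial comes
out once for each row. -/
theorem HasLeading.det {d : B} {j i : ℤ} {a : E} (h : M.HasLeading d j i a) :
    ∃ f ∈ integers κ, (M.repMatrix b d).det = mono j i 1 ^ Fintype.card ι * f ∧
      c f 0 0 = Algebra.norm κ a *
        LinearMap.det ((σ ^ i * τ ^ j : E ≃ₐ[κ] E).toLinearEquiv : E →ₗ[κ] E) := by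
  have h1 : ∀ x y, mono (-j) (-i) 1 * M.repMatrix b d x y ∈ integers κ ∧
      c (mono (-j) (-i) 1 * M.repMatrix b d x y) 0 0 =
        b.repr (a * (σ ^ i * τ ^ j : E ≃ₐ[κ] E) (b y)) x := by
    intro x y
    obtain ⟨h2, h3⟩ := h.2 _ (mono_mem_integers (b y))
    have h4 : mono (-j) (-i) 1 * M.repMatrix b d x y =
        coordinate b x (mono (-j) (-i) 1 * M.act d (mono 0 0 (b y))) := by
      refine ext_c fun j' i' => ?_
      rw [c_coordinate, c_mono_mul, c_mono_mul, one_mul, one_mul]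
      rfl
    rw [h4]
    refine ⟨?_, ?_⟩
    · rw [mem_integers] at *
      intro j' i' hlt
      rw [c_coordinate, h2 j' i' hlt]
      simp
    · rw [c_coordinate, h3, c_mono, if_pos ⟨rfl, rfl⟩]
  let R : Matrix ι ι (integers κ) := Matrix.of fun x y => ⟨_, (h1 x y).1⟩
  have hR : M.repMatrix b d = mono j i (1 : κ) • (integers κ).subtype.mapMatrix R := by
    ext1 x y
    exact (mono_mul_cancel j i _).symm
  refine ⟨R.det, R.det.2, ?_, ?_⟩
  · rw [hR, Matrix.det_smul]
    exact congrArg _ (RingHom.map_det (integers κ).subtype R).symm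
  · rw [← res_apply, RingHom.map_det, Algebra.norm_apply, ← LinearMap.det_comp,
      ← LinearMap.det_toMatrix b]
    congr 1
    ext1 x y
    rw [LinearMap.toMatrix_apply]
    exact (h1 x y).2

/-- The leading term of an element of reduced norm `1`. -/
theorem HasLeading.norm_eq_one {d : Bˣ} (hd : d ∈ SL1 (LaurentSeries₂ κ) B) {j i : ℤ} {a : E}
    (h : M.HasLeading d j i a) : j = 0 ∧ i = 0 ∧ Algebra.norm κ a = 1 := by
  obtain ⟨f, hf, h1, h2⟩ := h.det (Module.finBasisOfFinrankEq κ E M.finrank_eq)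
  rw [M.det_rep_eq_one hd, Fintype.card_fin, mono_pow, one_pow] at h1
  -- Determinant `1` forces `f` to be a pure monomial. Its residue is nonzero, so its exponents must
  -- be zero.
  have h3 : f = mono (-(((n * m : ℕ) : ℤ) * j)) (-(((n * m : ℕ) : ℤ) * i)) 1 := by
    rw [← mul_one (mono (-_) (-_) _), h1, mono_mul_cancel']
  have h4 : c f 0 0 ≠ 0 := by
    rw [h2]
    exact mul_ne_zero (Algebra.norm_ne_zero_iff.2 h.1) (LinearEquiv.isUnit_det' _).ne_zero
  rw [h3, c_mono] at h4
  have h5 : j = 0 ∧ i = 0 := by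
    have hn := NeZero.ne n
    have hm := NeZero.ne m
    by_contra hne
    refine h4 (if_neg fun h6 => hne ?_)
    simpa [hn, hm] using h6
  obtain ⟨rfl, rfl⟩ := h5
  refine ⟨rfl, rfl, ?_⟩
  rw [h3, c_mono] at h2
  simpa using h2.symm

/-- A scalar acts by a scalar matrix of size `nm`, and passing from `x`, `y` to `X ^ n`, `Y ^ m` is
injective. -/
theorem pow_eq_one_of_mem_SL1 (M : SplitModel σ τ n m B) {d : Bˣ} (hd : d ∈ SL1 (LaurentSeries₂ κ) B) {f : LaurentSeries₂ κ}
    (h : (d : B) = algebraMap _ B f) : f ^ (n * m) = 1 := by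
  have := M.det_rep_eq_one hd
  rw [h, repMatrix_algebraMap, Matrix.scalar_apply, Matrix.det_diagonal, Finset.prod_const,
    Finset.card_univ, Fintype.card_fin, ← map_pow] at this
  exact scale_injective n m (this.trans (map_one _).symm)

end SplitModel
end

noncomputable section

/-! ### R-equivalence on the norm one torus -/

section TorusR

variable {κ : Type u} {E : Type v} [Field κ] [Field E] [Algebra κ E] [FiniteDimensional κ E]

open Polynomial

/-- The matrix of the conjugates of a basis is invertible. -/
theorem det_conjugates_ne_zero {ι : Type*} [Fintype ι] [DecidableEq ι] (b : Module.Basis ι κ E)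
    (f : ι ≃ (E ≃ₐ[κ] E)) : (Matrix.of fun g a => f g (b a)).det ≠ 0 := by
  intro h
  obtain ⟨v, hv, h0⟩ := Matrix.exists_vecMul_eq_zero_iff.2 h
  refine hv ?_
  have h1 := (linearIndependent_toLinearMap κ E E).comp (fun g => ((f g : E ≃ₐ[κ] E) : E →ₐ[κ] E))
    (fun x y hxy => f.injective (AlgEquiv.ext fun e => DFunLike.congr_fun hxy e))
  rw [Fintype.linearIndependent_iff] at h1
  ext1 x
  refine h1 v (b.ext fun a => ?_) x
  have := congrFun h0 a
  simpa [Matrix.vecMul, dotProduct] using this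

/-- The norm of `A ⊗ E` over `A` is the product of the conjugates. -/
theorem norm_tensor_eq_prod [IsGalois κ E] {A F : Type*} [CommRing A] [Algebra κ A] [CommRing F]
    [Algebra κ F] (α : A →ₐ[κ] F) (β : E →ₐ[κ] F) (x : A ⊗[κ] E) :
    α (Algebra.norm A x) =
      ∏ g : E ≃ₐ[κ] E, Algebra.TensorProduct.productMap α (β.comp (g : E →ₐ[κ] E)) x := by
  classical
  have hcard : Fintype.card (Fin (Module.finrank κ E)) = Fintype.card (E ≃ₐ[κ] E) := by
    rw [Fintype.card_fin, ← Nat.card_eq_fintype_card, IsGalois.card_aut_eq_finrank]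
  let b := (Module.finBasis κ E).reindex (Fintype.equivOfCardEq hcard)
  let b' : Module.Basis (E ≃ₐ[κ] E) A (A ⊗[κ] E) := Algebra.TensorProduct.basis A b
  let P := fun g : E ≃ₐ[κ] E => Algebra.TensorProduct.productMap α (β.comp (g : E →ₐ[κ] E))
  let D : Matrix (E ≃ₐ[κ] E) (E ≃ₐ[κ] E) F :=
    (β : E →+* F).mapMatrix (Matrix.of fun g a => g (b a))
  have hD : IsUnit D.det := by
    rw [← RingHom.map_det]
    exact (isUnit_iff_ne_zero.2 (det_conjugates_ne_zero b (Equiv.refl _))).map (β : E →+* F)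
  have hP : ∀ g a, P g (b' a) = D g a := by
    intro g a
    simp [P, b', D, Algebra.TensorProduct.basis_apply]
  -- The matrix of conjugates turns multiplication by `x` into the diagonal matrix of the conjugates
  -- of `x`. Its determinant is a unit, so it cancels when determinants are compared.
  have hDM : D * (α : A →+* F).mapMatrix (Algebra.leftMulMatrix b' x) =
      Matrix.diagonal (fun g => P g x) * D := by
    ext1 g a
    rw [Matrix.diagonal_mul, ← hP, ← map_mul, ← b'.sum_repr (x * b' a), map_sum, Matrix.mul_apply]
    refine Finset.sum_congr rfl fun y _ => ?_
    have h1 : P g (b'.repr (x * b' a) y • b' y) = α (b'.repr (x * b' a) y) * P g (b' y) := by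
      rw [Algebra.smul_def, map_mul]
      congr 1
      simp [P]
    rw [h1, hP, mul_comm, RingHom.mapMatrix_apply, Matrix.map_apply,
      Algebra.leftMulMatrix_eq_repr_mul]
    rfl
  have h2 := congrArg Matrix.det hDM
  rw [Matrix.det_mul, Matrix.det_mul, Matrix.det_diagonal, mul_comm, ← RingHom.map_det] at h2
  rw [Algebra.norm_eq_matrix_det b']
  exact hD.mul_right_cancel h2

/-- The homomorphism `T(κ) → Eˣ`. -/
def NormOneTorus.toUnits : NormOneTorus κ E κ →* Eˣ :=
  (Units.map (Algebra.TensorProduct.lid κ E : κ ⊗[κ] E →* E)).comp (NormOneTorus κ E κ).subtype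

omit [FiniteDimensional κ E] in
theorem NormOneTorus.val_toUnits (P : NormOneTorus κ E κ) :
    (toUnits P : E) = Algebra.TensorProduct.lid κ E ((P : (κ ⊗[κ] E)ˣ) : κ ⊗[κ] E) := rfl

omit [FiniteDimensional κ E] in
theorem NormOneTorus.toUnits_injective :
    Function.Injective (NormOneTorus.toUnits : NormOneTorus κ E κ →* Eˣ) := by
  intro P Q h
  apply Subtype.ext
  apply Units.ext
  have h1 := congrArg Units.val h
  rw [val_toUnits, val_toUnits] at h1
  exact (Algebra.TensorProduct.lid κ E).injective h1

omit [FiniteDimensional κ E] in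
theorem NormOneTorus.norm_lid (x : κ ⊗[κ] E) :
    Algebra.norm κ (Algebra.TensorProduct.lid κ E x) = Algebra.norm κ x :=
  Algebra.norm_eq_of_algEquiv (Algebra.TensorProduct.lid κ E) x

omit [FiniteDimensional κ E] in
theorem NormOneTorus.norm_toUnits (P : NormOneTorus κ E κ) :
    Algebra.norm κ (toUnits P : E) = 1 := by
  rw [val_toUnits, norm_lid]
  exact (NormOneTorus.mem_iff κ E _).1 P.2

omit [FiniteDimensional κ E] in
theorem NormOneTorus.exists_toUnits_eq {a : Eˣ} (ha : Algebra.norm κ (a : E) = 1) :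
    ∃ P : NormOneTorus κ E κ, toUnits P = a := by
  refine ⟨⟨Units.map ((Algebra.TensorProduct.lid κ E).symm : E →* κ ⊗[κ] E) a, ?_⟩, ?_⟩
  · rw [NormOneTorus.mem_iff, ← norm_lid]
    simpa using ha
  · ext
    rw [val_toUnits]
    simp

/-- If two polynomials over `E` have proportional norms, then the ratios of their values at the
points of `κ` agree modulo the elements `g(a) / a`. -/
theorem exists_eval_mem_augmentation [IsGalois κ E] (P : E[X]) (hP : P ≠ 0) :
    ∀ (Q : E[X]) (e₀ : E), e₀ ≠ 0 →
      ∏ g : E ≃ₐ[κ] E, P.map (g : E →+* E) = C e₀ * ∏ g : E ≃ₐ[κ] E, Q.map (g : E →+* E) →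
      ∃ e : Eˣ, ∀ x y : Eˣ, ∀ t : κ, P.eval (algebraMap κ E t) = x →
        Q.eval (algebraMap κ E t) = y → x / y / e ∈ augmentationSubgroup κ E := by
  have hone : ∀ R : E[X], R.map ((1 : E ≃ₐ[κ] E) : E →+* E) = R := fun R => by
    ext k
    simp
  induction P using UniqueFactorizationMonoid.induction_on_prime with
  | h₁ => exact absurd rfl hP
  | h₂ P hu =>
    intro Q e₀ he₀ h
    -- If `P` is constant then so is its norm, hence the norm of `Q` and `Q` itself; the ratio of
    -- values is then one fixed element.
    have hQ : IsUnit Q := by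
      have h1 : IsUnit (∏ g : E ≃ₐ[κ] E, P.map (g : E →+* E)) :=
        Finset.prod_induction _ IsUnit (fun _ _ => IsUnit.mul) isUnit_one
          fun g _ => hu.map (mapRingHom (g : E →+* E))
      rw [h] at h1
      have h2 := isUnit_of_dvd_unit (Finset.dvd_prod_of_mem _ (Finset.mem_univ 1))
        (isUnit_of_mul_isUnit_right h1)
      rwa [hone] at h2
    obtain ⟨p, hp, rfl⟩ := Polynomial.isUnit_iff.1 hu
    obtain ⟨q, hq, rfl⟩ := Polynomial.isUnit_iff.1 hQ
    refine ⟨hp.unit / hq.unit, fun x y t hx hy => ?_⟩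
    obtain rfl : x = hp.unit := Units.ext (by simpa using hx.symm)
    obtain rfl : y = hq.unit := Units.ext (by simpa using hy.symm)
    rw [div_self']
    exact one_mem _
  | h₃ P p hP0 hp ih =>
    intro Q e₀ he₀ h
    -- A prime factor `p` of `P` divides some conjugate `g(Q)`, so `g⁻¹(p)` divides `Q`. Since `p`
    -- and `g⁻¹(p)` have the same norm, they can be removed from `P` and `Q` without disturbing the
    -- hypothesis.
    have h1 : p ∣ C e₀ * ∏ g : E ≃ₐ[κ] E, Q.map (g : E →+* E) := by
      rw [← h]
      refine dvd_trans ?_ (Finset.dvd_prod_of_mem _ (Finset.mem_univ 1))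
      rw [hone]
      exact dvd_mul_right p P
    have h2 : p ∣ ∏ g : E ≃ₐ[κ] E, Q.map (g : E →+* E) :=
      (hp.dvd_or_dvd h1).resolve_left fun h3 =>
        hp.not_isUnit (isUnit_of_dvd_unit h3 (isUnit_C.2 (isUnit_iff_ne_zero.2 he₀)))
    obtain ⟨g, -, hg⟩ := (hp.dvd_finsetProd_iff _).1 h2
    have hinv : ∀ R : E[X], (R.map (g : E →+* E)).map ((g⁻¹ : E ≃ₐ[κ] E) : E →+* E) = R := by
      intro R
      ext k
      simp
    obtain ⟨Q', rfl⟩ : p.map ((g⁻¹ : E ≃ₐ[κ] E) : E →+* E) ∣ Q := by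
      rw [← hinv Q]
      exact Polynomial.map_dvd _ hg
    have h3 : ∏ g' : E ≃ₐ[κ] E, (p.map ((g⁻¹ : E ≃ₐ[κ] E) : E →+* E)).map (g' : E →+* E) =
        ∏ g' : E ≃ₐ[κ] E, p.map (g' : E →+* E) := by
      refine Fintype.prod_equiv (Equiv.mulRight g⁻¹) _ _ fun g' => ?_
      rw [Polynomial.map_map]
      rfl
    have h4 : ∏ g' : E ≃ₐ[κ] E, p.map (g' : E →+* E) ≠ 0 :=
      Finset.prod_ne_zero_iff.2 fun g' _ =>
        (Polynomial.map_ne_zero_iff (RingHom.injective _)).2 hp.ne_zero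
    obtain ⟨e, he⟩ := ih hP0 Q' e₀ he₀ (by
      refine mul_left_cancel₀ h4 ?_
      simp only [Polynomial.map_mul, Finset.prod_mul_distrib, h3] at h
      rw [h]
      ring)
    refine ⟨e, fun x y t hx hy => ?_⟩
    rw [eval_mul] at hx hy
    have hp0 : p.eval (algebraMap κ E t) ≠ 0 := fun h0 => x.ne_zero (by rw [← hx, h0, zero_mul])
    have hP0 : P.eval (algebraMap κ E t) ≠ 0 := fun h0 => x.ne_zero (by rw [← hx, h0, mul_zero])
    -- Points of `κ` are fixed by `g⁻¹`, so removing the two factors changes the ratio of values by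
    -- an element of the form `g⁻¹(a) / a`, for every `t`. Hence the same `e` still serves all
    -- points at once.
    have hq : (p.map ((g⁻¹ : E ≃ₐ[κ] E) : E →+* E)).eval (algebraMap κ E t) =
        g⁻¹ (p.eval (algebraMap κ E t)) := by
      have h5 : algebraMap κ E t = ((g⁻¹ : E ≃ₐ[κ] E) : E →+* E) (algebraMap κ E t) := by simp
      conv_lhs => rw [h5]
      exact eval_map_apply _ _
    have hQ0 : Q'.eval (algebraMap κ E t) ≠ 0 := fun h0 => y.ne_zero (by rw [← hy, h0, mul_zero])
    have h6 := he (Units.mk0 _ hP0) (Units.mk0 _ hQ0) t rfl rfl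
    have h7 : Units.map ((g⁻¹ : E ≃ₐ[κ] E) : E →* E) (Units.mk0 _ hp0) / Units.mk0 _ hp0 ∈
        augmentationSubgroup κ E := Subgroup.subset_closure ⟨_, _, rfl⟩
    have hx' : x = Units.mk0 _ hp0 * Units.mk0 _ hP0 := Units.ext hx.symm
    have hy' : y = Units.map ((g⁻¹ : E ≃ₐ[κ] E) : E →* E) (Units.mk0 _ hp0) * Units.mk0 _ hQ0 := by
      ext
      rw [← hy, hq]
      rfl
    have h8 := mul_mem (inv_mem h7) h6
    rw [hx', hy']
    convert h8 using 1
    rw [inv_div, div_mul_div_comm, mul_div_mul_comm, mul_div_assoc, mul_div_mul_comm]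

/-- Clearing denominators in `κ[t]_g ⊗ E`. -/
theorem exists_clear_denominator {A : Type*} [CommRing A] [Algebra κ A] [Algebra κ[X] A]
    [IsScalarTower κ κ[X] A] (g : κ[X]) [IsLocalization.Away g A] (x : A ⊗[κ] E) :
    ∃ (s : ℕ) (p : κ[X] ⊗[κ] E), (algebraMap κ[X] A (g ^ s) ⊗ₜ[κ] (1 : E)) * x =
      Algebra.TensorProduct.map (IsScalarTower.toAlgHom κ κ[X] A) (AlgHom.id κ E) p := by
  induction x with
  | zero => exact ⟨0, 0, by simp⟩
  | tmul a e =>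
    obtain ⟨s, p, h⟩ := IsLocalization.Away.surj g a
    refine ⟨s, p ⊗ₜ e, ?_⟩
    rw [Algebra.TensorProduct.tmul_mul_tmul, Algebra.TensorProduct.map_tmul, map_pow, mul_comm, h,
      one_mul]
    rfl
  | add x y hx hy =>
    obtain ⟨s, p, hp⟩ := hx
    obtain ⟨t, q, hq⟩ := hy
    refine ⟨s + t, ((g ^ t) ⊗ₜ 1) * p + ((g ^ s) ⊗ₜ 1) * q, ?_⟩
    have h1 : algebraMap κ[X] A (g ^ (s + t)) ⊗ₜ[κ] (1 : E) =
        (algebraMap κ[X] A (g ^ s) ⊗ₜ[κ] (1 : E)) * (algebraMap κ[X] A (g ^ t) ⊗ₜ[κ] (1 : E)) := by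
      rw [Algebra.TensorProduct.tmul_mul_tmul, pow_add, map_mul, one_mul]
    have h2 : ∀ k : ℕ, Algebra.TensorProduct.map (IsScalarTower.toAlgHom κ κ[X] A) (AlgHom.id κ E)
        ((g ^ k) ⊗ₜ 1) = algebraMap κ[X] A (g ^ k) ⊗ₜ[κ] (1 : E) := fun k => rfl
    rw [map_add, map_mul, map_mul, ← hp, ← hq, h2, h2, h1]
    ring

/-- The value of a point of the torus at a place is unchanged modulo the elements `g(a) / a`. -/
theorem toUnits_map_div_mem [IsGalois κ E] {g : κ[X]} (hg : g ≠ 0)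
    (r : NormOneTorus κ E (Localization.Away g)) (a b : Localization.Away g →ₐ[κ] κ) :
    NormOneTorus.toUnits (NormOneTorus.map κ E a r) /
      NormOneTorus.toUnits (NormOneTorus.map κ E b r) ∈ augmentationSubgroup κ E := by
  let A := Localization.Away g
  let x : A ⊗[κ] E := ((r : (A ⊗[κ] E)ˣ) : A ⊗[κ] E)
  have hx : Algebra.norm A x = 1 := (NormOneTorus.mem_iff κ E _).1 r.2
  obtain ⟨s, p, hp⟩ := exists_clear_denominator (A := A) g x
  -- Multiplied by `g ^ s`, the point becomes a polynomial `χ p` over `E`, with denominator `Q`. The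
  -- comparison of conjugates takes place in the fraction field of `E[t]`.
  let χ : κ[X] ⊗[κ] E →ₐ[κ] E[X] :=
    Algebra.TensorProduct.productMap (mapAlgHom (Algebra.ofId κ E)) CAlgHom
  let F := FractionRing E[X]
  let γ : E[X] →ₐ[κ] F := IsScalarTower.toAlgHom κ E[X] F
  have hγ : Function.Injective γ := IsFractionRing.injective E[X] F
  let Q : E[X] := (g ^ s).map (algebraMap κ E)
  have hg' : g.map (algebraMap κ E) ≠ 0 := (Polynomial.map_ne_zero_iff (RingHom.injective _)).2 hg
  have hu : ∀ y : Submonoid.powers g,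
      IsUnit ((γ.comp (mapAlgHom (Algebra.ofId κ E))) (y : κ[X])) := by
    rintro ⟨_, k, rfl⟩
    rw [map_pow]
    exact (isUnit_iff_ne_zero.2 ((map_ne_zero_iff γ hγ).2 hg')).pow k
  let α : A →ₐ[κ] F := IsLocalization.liftAlgHom (M := Submonoid.powers g) hu
  have hα : ∀ q : κ[X], α (algebraMap κ[X] A q) = γ (q.map (algebraMap κ E)) := fun q =>
    IsLocalization.lift_eq _ q
  have hconj : ∀ h : E ≃ₐ[κ] E, γ ((χ p).map (h : E →+* E)) = γ Q *
      Algebra.TensorProduct.productMap α ((γ.comp CAlgHom).comp (h : E →ₐ[κ] E)) x := by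
    intro h
    have h1 : γ Q * Algebra.TensorProduct.productMap α ((γ.comp CAlgHom).comp (h : E →ₐ[κ] E)) x =
        Algebra.TensorProduct.productMap α ((γ.comp CAlgHom).comp (h : E →ₐ[κ] E))
          ((algebraMap κ[X] A (g ^ s) ⊗ₜ[κ] (1 : E)) * x) := by
      rw [map_mul, Algebra.TensorProduct.productMap_apply_tmul, map_one, mul_one, hα]
    rw [h1, hp]
    generalize p = p'
    induction p' with
    | zero => simp
    | add y z hy hz => rw [map_add, Polynomial.map_add, map_add, hy, hz, map_add, map_add]
    | tmul q e =>
      simp only [χ, Algebra.TensorProduct.map_tmul, Algebra.TensorProduct.productMap_apply_tmul]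
      rw [Polynomial.map_mul, map_mul]
      congr 1
      · refine Eq.trans ?_ (hα q).symm
        congr 1
        ext k
        simp
      · simp
  -- The denominator `Q` has coefficients in `κ`, so it equals its conjugates, and the conjugates of
  -- `x` multiply to its norm `1`. Thus `χ p` and `Q` have equal norms.
  have hprod : ∏ h : E ≃ₐ[κ] E, (χ p).map (h : E →+* E) =
      C 1 * ∏ h : E ≃ₐ[κ] E, Q.map (h : E →+* E) := by
    apply hγ
    have hQ : ∀ h : E ≃ₐ[κ] E, Q.map (h : E →+* E) = Q := by
      intro h
      simp only [Q, Polynomial.map_map]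
      congr 1
      ext k
      simp
    simp only [map_prod, hconj, hQ, Finset.prod_mul_distrib, ← norm_tensor_eq_prod, hx, map_one,
      map_mul]
    ring
  have hQ0 : Q ≠ 0 := by
    simp only [Q, Polynomial.map_pow]
    exact pow_ne_zero _ hg'
  have hP0 : χ p ≠ 0 := by
    intro h0
    rw [h0] at hprod
    have h1 : C (1 : E) * ∏ h : E ≃ₐ[κ] E, Q.map (h : E →+* E) ≠ 0 :=
      mul_ne_zero (C_ne_zero.2 one_ne_zero) (Finset.prod_ne_zero_iff.2 fun h _ =>
        (Polynomial.map_ne_zero_iff (RingHom.injective _)).2 hQ0)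
    exact h1 (hprod.symm.trans (Finset.prod_eq_zero (Finset.mem_univ 1)
      (Polynomial.map_zero _)))
  obtain ⟨e, he⟩ := exists_eval_mem_augmentation (χ p) hP0 Q 1 one_ne_zero hprod
  -- A homomorphism to `κ` evaluates at `t`, the image of the variable; the value of the point there
  -- is `(χ p)(t) / Q(t)`, whose class `e` does not depend on `t`.
  have key : ∀ a : A →ₐ[κ] κ,
      NormOneTorus.toUnits (NormOneTorus.map κ E a r) / e ∈ augmentationSubgroup κ E := by
    intro a
    let t := a (algebraMap κ[X] A X)
    have hag : ∀ q : κ[X], a (algebraMap κ[X] A q) = q.eval t := by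
      intro q
      have h1 : (a.comp (IsScalarTower.toAlgHom κ κ[X] A)) = aeval t := by
        ext
        simp [t]
      have := DFunLike.congr_fun h1 q
      simpa [coe_aeval_eq_eval] using this
    have hy0 : Q.eval (algebraMap κ E t) ≠ 0 := by
      have h1 : IsUnit (a (algebraMap κ[X] A g)) := (IsLocalization.Away.algebraMap_isUnit g).map a
      rw [hag] at h1
      simp only [Q, eval_map_algebraMap, aeval_algebraMap_apply, coe_aeval_eq_eval]
      rw [_root_.map_ne_zero, eval_pow]
      exact pow_ne_zero _ h1.ne_zero
    have hxy : (χ p).eval (algebraMap κ E t) = Q.eval (algebraMap κ E t) *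
        NormOneTorus.toUnits (NormOneTorus.map κ E a r) := by
      have h1 : ∀ z : A ⊗[κ] E, Algebra.TensorProduct.lid κ E
          (Algebra.TensorProduct.map a (AlgHom.id κ E) ((algebraMap κ[X] A (g ^ s) ⊗ₜ[κ] (1 : E)) * z)) =
          Q.eval (algebraMap κ E t) *
            Algebra.TensorProduct.lid κ E (Algebra.TensorProduct.map a (AlgHom.id κ E) z) := by
        intro z
        rw [map_mul, map_mul, Algebra.TensorProduct.map_tmul, hag]
        congr 1
        simp only [Q, eval_map_algebraMap, aeval_algebraMap_apply, coe_aeval_eq_eval]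
        simp [Algebra.smul_def]
      refine Eq.trans ?_ (h1 x)
      rw [hp]
      generalize p = p'
      induction p' with
      | zero => simp
      | add y z hy hz => simp only [map_add, eval_add, hy, hz]
      | tmul q e =>
        simp only [χ, Algebra.TensorProduct.map_tmul, Algebra.TensorProduct.productMap_apply_tmul]
        rw [eval_mul]
        have h3 : (mapAlgHom (Algebra.ofId κ E) q).eval (algebraMap κ E t) =
            algebraMap κ E (q.eval t) := by
          change (q.map (algebraMap κ E)).eval _ = _
          simp only [eval_map_algebraMap, aeval_algebraMap_apply, coe_aeval_eq_eval]
        rw [h3]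
        simp [hag, Algebra.smul_def]
    have h2 := he (Units.mk0 _ hy0 * NormOneTorus.toUnits (NormOneTorus.map κ E a r))
      (Units.mk0 _ hy0) t hxy rfl
    rwa [mul_div_cancel_left] at h2
  have h3 := div_mem (key a) (key b)
  rwa [div_div_div_cancel_right] at h3

/-- The rational map `t ↦ g(ta + 1 - t) / (ta + 1 - t)` takes the values `1` at `0` and `g(a) / a`
at `1`. It is defined where the norm `q` of `ta + 1 - t` does not vanish, and `q(0) = 1`, `q(1) =
N(a)`. -/
theorem DirectlyREquiv.of_automorphism (g : E ≃ₐ[κ] E) (a : Eˣ) (P : NormOneTorus κ E κ)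
    (hP : NormOneTorus.toUnits P = Units.map (g : E →* E) a / a) : DirectlyREquiv κ E 1 P := by
  let x : κ[X] ⊗[κ] E := X ⊗ₜ (a : E) + (1 - X) ⊗ₜ 1
  let q : κ[X] := Algebra.norm κ[X] x
  have hev : ∀ t : κ, q.eval t = Algebra.norm κ (algebraMap κ E t * a + (1 - algebraMap κ E t)) := by
    intro t
    have h1 := NormOneTorus.norm_map κ E (aeval t : κ[X] →ₐ[κ] κ) x
    rw [coe_aeval_eq_eval, ← NormOneTorus.norm_lid] at h1
    rw [← h1]
    congr 1
    simp [x, Algebra.smul_def]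
  have h0 : q.eval 0 ≠ 0 := by
    rw [hev]
    simp
  have h1 : q.eval 1 ≠ 0 := by
    rw [hev]
    simp
  have hq : q ≠ 0 := by
    rintro h
    rw [h, eval_zero] at h0
    exact h0 rfl
  let A := Localization.Away q
  let ι : κ[X] →ₐ[κ] A := IsScalarTower.toAlgHom κ κ[X] A
  let y : A ⊗[κ] E := Algebra.TensorProduct.map ι (AlgHom.id κ E) x
  have hy : IsUnit (Algebra.norm A y) := by
    rw [NormOneTorus.norm_map]
    exact IsLocalization.Away.algebraMap_isUnit q
  -- Multiplication by `y` has invertible determinant, so it is surjective and reaches `1`.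
  obtain ⟨yu, hyu⟩ : IsUnit y := by
    rw [Algebra.norm_apply] at hy
    obtain ⟨z, hz⟩ := ((Module.End.isUnit_iff _).1
      ((LinearMap.isUnit_iff_isUnit_det _).2 hy)).2 (1 : A ⊗[κ] E)
    exact IsUnit.of_mul_eq_one z hz
  let φ : A ⊗[κ] E ≃ₐ[A] A ⊗[κ] E := Algebra.TensorProduct.congr AlgEquiv.refl g
  let r : NormOneTorus κ E A := ⟨Units.map (φ : A ⊗[κ] E →* A ⊗[κ] E) yu / yu, by
    have h2 : Units.map (Algebra.norm A : A ⊗[κ] E →* A)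
        (Units.map (φ : A ⊗[κ] E →* A ⊗[κ] E) yu) =
        Units.map (Algebra.norm A : A ⊗[κ] E →* A) yu :=
      Units.ext (Algebra.norm_eq_of_algEquiv φ (yu : A ⊗[κ] E))
    rw [NormOneTorus, MonoidHom.mem_ker, _root_.map_div, h2, div_self']⟩
  have hr : ((r : (A ⊗[κ] E)ˣ) : A ⊗[κ] E) * y = φ y := by
    rw [← hyu]
    change ((Units.map (φ : A ⊗[κ] E →* A ⊗[κ] E) yu / yu : (A ⊗[κ] E)ˣ) : A ⊗[κ] E) *
      (yu : A ⊗[κ] E) = _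
    rw [← Units.val_mul, div_mul_cancel]
    rfl
  have hpt : ∀ t : κ, q.eval t ≠ 0 → ∃ s : A →ₐ[κ] κ,
      (NormOneTorus.toUnits (NormOneTorus.map κ E s r) : E) *
        (algebraMap κ E t * a + (1 - algebraMap κ E t)) =
        g (algebraMap κ E t * a + (1 - algebraMap κ E t)) := by
    intro t ht
    have hu : ∀ z : Submonoid.powers q, IsUnit ((aeval t : κ[X] →ₐ[κ] κ) (z : κ[X])) := by
      rintro ⟨_, k, rfl⟩
      rw [map_pow]
      exact (isUnit_iff_ne_zero.2 (by rwa [coe_aeval_eq_eval])).pow k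
    let s : A →ₐ[κ] κ := IsLocalization.liftAlgHom (M := Submonoid.powers q) hu
    have hs : ∀ p : κ[X], s (algebraMap κ[X] A p) = p.eval t := fun p =>
      (IsLocalization.lift_eq _ p).trans (by simp)
    let Λ : A ⊗[κ] E →ₐ[κ] E := (Algebra.TensorProduct.lid κ E : κ ⊗[κ] E →ₐ[κ] E).comp
      (Algebra.TensorProduct.map s (AlgHom.id κ E))
    have h2 : Λ y = algebraMap κ E t * a + (1 - algebraMap κ E t) := by
      simp [Λ, y, x, ι, hs, Algebra.smul_def]
    have h3 : ∀ z, Λ (φ z) = g (Λ z) := by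
      intro z
      induction z with
      | zero => simp
      | add y z hy hz => simp only [map_add, hy, hz]
      | tmul p e => simp [Λ, φ]
    refine ⟨s, ?_⟩
    rw [← h2, ← h3, ← hr, map_mul]
    rfl
  obtain ⟨s, hs⟩ := hpt 0 h0
  obtain ⟨s', hs'⟩ := hpt 1 h1
  refine ⟨q, hq, r, s, s', ?_, ?_⟩
  · apply NormOneTorus.toUnits_injective
    ext
    simpa using hs
  · apply NormOneTorus.toUnits_injective
    rw [hP, eq_div_iff_mul_eq']
    ext
    simpa [mul_comm] using hs'

/-- The R-trivial points of the norm one torus are the products of elements `g(a) / a`. -/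
theorem mem_RTrivial_iff [IsGalois κ E] (P : NormOneTorus κ E κ) :
    P ∈ RTrivial κ E ↔ NormOneTorus.toUnits P ∈ augmentationSubgroup κ E := by
  constructor
  · intro h
    have h1 : REquiv κ E 1 P := h
    clear h
    induction h1 with
    | single h =>
      obtain ⟨g, hg, r, a, b, h1, rfl⟩ := h
      have := toUnits_map_div_mem hg r b a
      rwa [h1, map_one, div_one] at this
    | @tail Q P h1 h2 ih =>
      obtain ⟨g, hg, r, a, b, rfl, rfl⟩ := h2
      have h3 := mul_mem (toUnits_map_div_mem hg r b a) ih
      rwa [div_mul_cancel] at h3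
  · intro h
    have h1 : augmentationSubgroup κ E ≤ (RTrivial κ E).map NormOneTorus.toUnits := by
      rw [augmentationSubgroup, Subgroup.closure_le]
      rintro x ⟨g, a, rfl⟩
      have h2 : Algebra.norm κ ((Units.map (g : E →* E) a / a : Eˣ) : E) = 1 := by
        have h3 : Units.map (Algebra.norm κ : E →* κ) (Units.map (g : E →* E) a) =
            Units.map (Algebra.norm κ : E →* κ) a := Units.ext (Algebra.norm_eq_of_algEquiv g _)
        have h4 : Units.map (Algebra.norm κ : E →* κ) (Units.map (g : E →* E) a / a) = 1 := by
          rw [_root_.map_div, h3, div_self']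
        exact congrArg Units.val h4
      obtain ⟨P, hP⟩ := NormOneTorus.exists_toUnits_eq h2
      exact ⟨P, Relation.TransGen.single (DirectlyREquiv.of_automorphism g a P hP), hP⟩
    obtain ⟨Q, hQ, hQP⟩ := h1 h
    rwa [← NormOneTorus.toUnits_injective hQP]

end TorusR
end

noncomputable section

/-! ### Reduced norms of elements of a maximal subfield -/

section MaximalSubfield

/-- A common eigenvector of a generator of a finite separable extension is an eigenvector of the
whole extension. -/
theorem exists_eigenvalue_ringHom {κ E Ω V : Type*} [Field κ] [Field E] [Algebra κ E]
    [FiniteDimensional κ E] [Algebra.IsSeparable κ E] [Field Ω] [IsAlgClosed Ω] [Algebra κ Ω]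
    [AddCommGroup V] [Module Ω V] [FiniteDimensional Ω V] [Nontrivial V]
    (f : E →+* Module.End Ω V)
    (hf : ∀ c : κ, f (algebraMap κ E c) = algebraMap Ω _ (algebraMap κ Ω c)) :
    ∃ (ρ : E →+* Ω) (v : V), v ≠ 0 ∧ (∀ e, f e v = ρ e • v) ∧
      ∀ c, ρ (algebraMap κ E c) = algebraMap κ Ω c := by
  let pb := Field.powerBasisOfFiniteOfSeparable κ E
  obtain ⟨μ, hμ⟩ := Module.End.exists_eigenvalue (f pb.gen)
  obtain ⟨v, hv⟩ := hμ.exists_hasEigenvector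
  have hv0 : v ≠ 0 := hv.2
  have h1 : ∀ p : Polynomial κ, ∃ c : Ω, f (Polynomial.aeval pb.gen p) v = c • v := by
    intro p
    induction p using Polynomial.induction_on with
    | C a => exact ⟨algebraMap κ Ω a, by rw [Polynomial.aeval_C, hf]; rfl⟩
    | add p q hp hq =>
      obtain ⟨c, hc⟩ := hp
      obtain ⟨d, hd⟩ := hq
      exact ⟨c + d, by rw [map_add, map_add, LinearMap.add_apply, hc, hd, add_smul]⟩
    | monomial k a h =>
      obtain ⟨c, hc⟩ := h
      refine ⟨c * μ, ?_⟩
      rw [pow_succ', ← mul_assoc, mul_comm _ Polynomial.X, mul_assoc, map_mul, map_mul,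
        Polynomial.aeval_X, Module.End.mul_apply, hc, map_smul, hv.apply_eq_smul, smul_smul]
  have h2 : ∀ e, ∃ c : Ω, f e v = c • v := by
    intro e
    obtain ⟨p, rfl⟩ := pb.exists_eq_aeval' e
    exact h1 p
  choose ρ hρ using h2
  have hinj : ∀ {c d : Ω}, c • v = d • v → c = d := fun h => smul_left_injective Ω hv0 h
  refine ⟨⟨⟨⟨ρ, ?_⟩, ?_⟩, ?_, ?_⟩, v, hv0, hρ, ?_⟩
  · apply hinj
    rw [← hρ, map_one, one_smul]
    rfl
  · intro x y
    apply hinj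
    rw [← hρ, map_mul, Module.End.mul_apply, hρ, map_smul, hρ, smul_smul, mul_comm]
  · apply hinj
    rw [← hρ, map_zero, zero_smul]
    rfl
  · intro x y
    apply hinj
    change ρ (x + y) • v = (ρ x + ρ y) • v
    rw [← hρ, map_add, LinearMap.add_apply, hρ, hρ, add_smul]
  · intro c
    apply hinj
    change ρ _ • v = _
    rw [← hρ, hf]
    rfl

/-- If a Galois extension `E/κ` of degree `n` is contained in an algebra `D` of dimension `n²` and
the Galois group acts by inner automorphisms of `D`, then the reduced norm of an element of `E` is
its norm. -/
theorem isReducedNorm_norm {κ E : Type*} [Field κ] [Field E] [Algebra κ E] [FiniteDimensional κ E]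
    [IsGalois κ E] {k : Type u} {D : Type v} [Field k] [Algebra κ k] [Ring D] [Algebra k D]
    (ι : E →+* D) (hι : ∀ c, ι (algebraMap κ E c) = algebraMap k D (algebraMap κ k c))
    (hw : ∀ g : E ≃ₐ[κ] E, ∃ w : Dˣ, ∀ e, w * ι e = ι (g e) * w)
    (hdim : Module.finrank k D = Module.finrank κ E ^ 2) (a : E) :
    IsReducedNorm k D (ι a) (algebraMap κ k (Algebra.norm κ a)) := by
  intro Ω _ _ n φ hn
  obtain rfl : n = Module.finrank κ E := by
    rw [hdim] at hn
    exact Nat.pow_left_injective two_ne_zero hn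
  -- Eigenvectors may require an algebraically closed field; the two values can be compared there
  -- because field extensions are injective.
  let Ω' := AlgebraicClosure Ω
  let _ : Algebra κ Ω' := ((algebraMap Ω Ω').comp ((algebraMap k Ω).comp (algebraMap κ k))).toAlgebra
  have hκ : ∀ c, algebraMap κ Ω' c = algebraMap Ω Ω' (algebraMap k Ω (algebraMap κ k c)) :=
    fun _ => rfl
  let V := Fin (Module.finrank κ E) → Ω'
  let ψ : D →+* Module.End Ω' V := (Matrix.toLinAlgEquiv' (R := Ω')
    (n := Fin (Module.finrank κ E)) : _ →+* Module.End Ω' V).comp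
      ((algebraMap Ω Ω').mapMatrix.comp φ.toRingHom)
  have hψ : ∀ d, LinearMap.det (ψ d) = algebraMap Ω Ω' (φ d).det := by
    intro d
    rw [RingHom.map_det]
    exact LinearMap.det_toLin' _
  have : Nontrivial V := by
    have : Nonempty (Fin (Module.finrank κ E)) := ⟨⟨0, Module.finrank_pos⟩⟩
    exact Function.nontrivial
  obtain ⟨ρ, v, hv0, hv, hρ⟩ := exists_eigenvalue_ringHom (κ := κ) (ψ.comp ι) (fun c => by
    rw [RingHom.comp_apply, hι, hκ]
    change Matrix.toLinAlgEquiv' ((algebraMap Ω Ω').mapMatrix (φ (algebraMap k D _))) = _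
    rw [φ.commutes]
    ext1 i
    ext1
    ext1 j
    rw [Module.algebraMap_end_eq_smul_id]
    simp [Matrix.algebraMap_eq_diagonal, Matrix.diagonal_map, Matrix.toLinAlgEquiv'_apply,
      Pi.single_apply, eq_comm]
    split_ifs
    · rw [Algebra.smul_def, mul_one, IsScalarTower.algebraMap_apply k Ω Ω']
    · rfl)
  choose w hw using hw
  -- If `E` acts on `v` through `ρ`, then it acts on `w g v` through `ρ ∘ g⁻¹`.
  have hwv : ∀ g e, ψ (ι e) (ψ (w g) v) = ρ (g⁻¹ e) • ψ (w g) v := by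
    intro g e
    have h1 := hw g (g⁻¹ e)
    have h2 : g (g⁻¹ e) = e := g.apply_symm_apply e
    rw [h2] at h1
    rw [← Module.End.mul_apply, ← map_mul, ← h1, map_mul, Module.End.mul_apply]
    have h3 := hv (g⁻¹ e)
    rw [RingHom.comp_apply] at h3
    rw [h3, map_smul]
  have hw0 : ∀ g, ψ (w g) v ≠ 0 := by
    intro g h
    refine hv0 ?_
    have h1 : ψ ((w g)⁻¹ : Dˣ) (ψ (w g) v) = v := by
      rw [← Module.End.mul_apply, ← map_mul, Units.inv_mul, map_one]
      rfl
    rw [← h1, h, map_zero]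
  let pb := Field.powerBasisOfFiniteOfSeparable κ E
  -- The characters `ρ ∘ g⁻¹` differ already on a primitive element. This gives `[E : κ]`
  -- independent eigenvectors, hence a basis in which `a` is diagonal with the conjugates of `ρ(a)`
  -- as entries.
  have hli : LinearIndependent Ω' fun g : E ≃ₐ[κ] E => ψ (w g) v := by
    refine Module.End.eigenvectors_linearIndependent' (ψ (ι pb.gen)) (fun g => ρ (g⁻¹ pb.gen)) ?_ _
      fun g => ?_
    · intro g g' h
      have h1 : ((g⁻¹ : E ≃ₐ[κ] E) : E →ₐ[κ] E) = (g'⁻¹ : E ≃ₐ[κ] E) :=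
        pb.algHom_ext (ρ.injective h)
      exact inv_injective (AlgEquiv.ext fun e => DFunLike.congr_fun h1 e)
    · exact Module.End.hasEigenvector_iff.2 ⟨Module.End.mem_eigenspace_iff.2 (hwv g _), hw0 g⟩
  have : Nonempty (E ≃ₐ[κ] E) := ⟨1⟩
  let bas := basisOfLinearIndependentOfCardEqFinrank hli (by
    rw [← Nat.card_eq_fintype_card, IsGalois.card_aut_eq_finrank, Module.finrank_fin_fun])
  have hbas : ∀ g, bas g = ψ (w g) v := fun g => by simp [bas]
  apply (algebraMap Ω Ω').injective
  classical
  rw [← hψ, ← hκ, ← hρ, ← LinearMap.det_toMatrix bas, Algebra.norm_eq_prod_automorphisms, map_prod]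
  have hdiag : LinearMap.toMatrix bas bas (ψ (ι a)) = Matrix.diagonal fun g => ρ (g⁻¹ a) := by
    ext1 g g'
    rw [LinearMap.toMatrix_apply, hbas, hwv, ← hbas, map_smul, Finsupp.smul_apply, bas.repr_self,
      Matrix.diagonal_apply, Finsupp.single_apply]
    by_cases h : g = g'
    · simp [h]
    · simp [h, Ne.symm h]
  rw [hdiag, Matrix.det_diagonal]
  exact Fintype.prod_equiv (Equiv.inv _) _ _ fun _ => rfl

end MaximalSubfield
end

noncomputable section

/-! ### Successive approximation in complete filtered rings -/

/-- A complete and separated descending multiplicative filtration of a subring of `R`. -/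
structure IsCompleteFiltration {R : Type*} [Ring R] (I : ℕ → AddSubgroup R) : Prop where
  anti : Antitone I
  one_mem : 1 ∈ I 0
  mul_mem : ∀ {a b x y}, x ∈ I a → y ∈ I b → x * y ∈ I (a + b)
  eq_zero : ∀ {x}, (∀ n, x ∈ I n) → x = 0
  complete : ∀ x : ℕ → R, (∀ k, x k ∈ I k) → ∃ s, ∀ n, s - ∑ k ∈ Finset.range n, x k ∈ I n

/-- Solving `Φ x = 0` by successive approximation, where `ℓ` is the linear part of `Φ`. -/
theorem exists_eq_zero_of_approximation {R X : Type*} [AddCommGroup R] [AddCommGroup X]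
    {I : ℕ → AddSubgroup R} (hI : ∀ {x}, (∀ n, x ∈ I n) → x = 0) (hanti : Antitone I)
    {J : ℕ → AddSubgroup X} (hJanti : Antitone J)
    (hJ : ∀ x : ℕ → X, (∀ k, x k ∈ J k) → ∃ s, ∀ n, s - ∑ k ∈ Finset.range n, x k ∈ J n)
    {Φ ℓ : X → R} (h0 : Φ 0 ∈ I 1)
    (hΦ : ∀ n x y, x ∈ J 1 → y ∈ J (n + 1) → Φ (x + y) - Φ x - ℓ y ∈ I (n + 2))
    (hℓ : ∀ n y, y ∈ J n → ℓ y ∈ I n) (hs : ∀ n, ∀ e ∈ I n, ∃ y ∈ J n, ℓ y = -e) :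
    ∃ x ∈ J 1, Φ x = 0 := by
  -- One correction solves `ℓ y = -Φ x` and improves the error by one order. The conditions on `x`
  -- are premises of the conclusion, with `y = 0` as default, so that the chosen correction is a
  -- total function and can be iterated.
  have hstep : ∀ k x, ∃ y ∈ J (k + 1), x ∈ J 1 → Φ x ∈ I (k + 1) → Φ (x + y) ∈ I (k + 2) := by
    intro k x
    by_cases hx : x ∈ J 1 ∧ Φ x ∈ I (k + 1)
    · obtain ⟨y, hy, hy'⟩ := hs _ _ hx.2
      refine ⟨y, hy, fun h1 h2 => ?_⟩
      have := hΦ k x y h1 hy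
      rwa [hy', sub_neg_eq_add, sub_add_cancel] at this
    · exact ⟨0, zero_mem _, fun h1 h2 => absurd ⟨h1, h2⟩ hx⟩
  choose F hF hF' using hstep
  let x : ℕ → X := fun k => Nat.rec 0 (fun k x => x + F k x) k
  have hx : ∀ k, x (k + 1) = x k + F k (x k) := fun k => rfl
  have hmem : ∀ k, x k ∈ J 1 ∧ Φ (x k) ∈ I (k + 1) := by
    intro k
    induction k with
    | zero => exact ⟨zero_mem _, h0⟩
    | succ k ih =>
      rw [hx]
      exact ⟨add_mem ih.1 (hJanti (by omega) (hF k (x k))), hF' _ _ ih.1 ih.2⟩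
  -- The summand at `0` is `0`, so that the correction with index `k` sits at `k + 1`, in the right
  -- filtration step, and the partial sum over `range (n + 1)` is `x n`.
  obtain ⟨s, hs⟩ := hJ (fun k => Nat.casesOn k 0 fun k => F k (x k)) (by
    rintro (_ | k)
    · exact zero_mem _
    · exact hF k _)
  have hs' : ∀ n, s - x n ∈ J (n + 1) := by
    intro n
    have h1 : ∀ n, ∑ k ∈ Finset.range n, F k (x k) = x n := by
      intro n
      induction n with
      | zero => rfl
      | succ n ih => rw [Finset.sum_range_succ, ih, hx]
    have := hs (n + 1)
    rw [Finset.sum_range_succ', h1] at this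
    change s - (x n + 0) ∈ J (n + 1) at this
    rwa [add_zero] at this
  refine ⟨s, ?_, hI fun n => ?_⟩
  · simpa [x] using hs' 0
  · have h1 := hΦ n (x n) (s - x n) (hmem n).1 (hs' n)
    have h2 := hℓ _ _ (hs' n)
    have h3 : Φ s = (Φ (x n + (s - x n)) - Φ (x n) - ℓ (s - x n)) + Φ (x n) + ℓ (s - x n) := by
      rw [add_sub_cancel]
      abel
    rw [h3]
    exact add_mem (add_mem (hanti (by omega) h1) (hanti (by omega) (hmem n).2))
      (hanti (by omega) h2)

namespace IsCompleteFiltration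

variable {R : Type*} [Ring R] {I : ℕ → AddSubgroup R} (hI : IsCompleteFiltration I)

include hI

/-- The inverse is the sum of the geometric series of `-x`; both one-sided identities hold modulo
every `I n`, hence exactly. -/
theorem exists_unit {x : R} (hx : x ∈ I 1) :
    ∃ w : Rˣ, (w : R) = 1 + x ∧ ((w⁻¹ : Rˣ) : R) - 1 ∈ I 1 := by
  have hpow : ∀ k, (-x) ^ k ∈ I k := by
    intro k
    induction k with
    | zero => simpa using hI.one_mem
    | succ k ih =>
      rw [pow_succ]
      exact hI.mul_mem ih (neg_mem hx)
  obtain ⟨s, hs⟩ := hI.complete _ hpow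
  have h1 : (1 + x) ∈ I 0 := add_mem hI.one_mem (hI.anti (by omega) hx)
  have e1 : (1 + x) * s = 1 := by
    rw [← sub_eq_zero]
    refine hI.eq_zero fun n => ?_
    have h2 := mul_neg_geom_sum (-x) n
    rw [sub_neg_eq_add] at h2
    have h3 : (1 + x) * s - 1 = (1 + x) * (s - ∑ k ∈ Finset.range n, (-x) ^ k) - (-x) ^ n := by
      rw [mul_sub, h2]
      abel
    rw [h3]
    exact sub_mem (by simpa using hI.mul_mem h1 (hs n)) (hpow n)
  have e2 : s * (1 + x) = 1 := by
    rw [← sub_eq_zero]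
    refine hI.eq_zero fun n => ?_
    have h2 := geom_sum_mul_neg (-x) n
    rw [sub_neg_eq_add] at h2
    have h3 : s * (1 + x) - 1 = (s - ∑ k ∈ Finset.range n, (-x) ^ k) * (1 + x) - (-x) ^ n := by
      rw [sub_mul, h2]
      abel
    rw [h3]
    exact sub_mem (by simpa using hI.mul_mem (hs n) h1) (hpow n)
  exact ⟨⟨1 + x, s, e1, e2⟩, rfl, by simpa using hs 1⟩

/-- First-order expansion of a product of elements of `1 + I 1`. -/
theorem mul_expansion {n : ℕ} {a a' b b' y w : R} (ha' : a' - 1 ∈ I 1)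
    (hb : b - 1 ∈ I 1) (hy : y ∈ I (n + 1)) (hw : w ∈ I (n + 1))
    (hay : a' - a - y ∈ I (n + 2)) (hbw : b' - b - w ∈ I (n + 2)) :
    a' * b' - a * b - (y + w) ∈ I (n + 2) := by
  have h0 : ∀ {x : R}, x - 1 ∈ I 1 → x ∈ I 0 := fun {x} h => by
    rw [← sub_add_cancel x 1]
    exact add_mem (hI.anti (by omega) h) hI.one_mem
  have e : a' * b' - a * b - (y + w) = a' * (b' - b - w) + (a' - 1) * w + (a' - a - y) * b +
      y * (b - 1) := by noncomm_ring
  rw [e]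
  refine add_mem (add_mem (add_mem ?_ ?_) ?_) ?_
  · simpa using hI.mul_mem (h0 ha') hbw
  · simpa [add_comm, add_left_comm] using hI.mul_mem ha' hw
  · simpa using hI.mul_mem hay (h0 hb)
  · exact hI.mul_mem (a := n + 1) hy hb

theorem mul_sub_one_mem {a b : R} (ha : a - 1 ∈ I 1) (hb : b - 1 ∈ I 1) : a * b - 1 ∈ I 1 := by
  have e : a * b - 1 = (a - 1) * (b - 1) + (a - 1) + (b - 1) := by noncomm_ring
  rw [e]
  exact add_mem (add_mem (hI.anti (by omega) (hI.mul_mem ha hb)) ha) hb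

/-- If every element is a sum of an element of `Z` and elements `c x - x` with `c` among `c₁`,
`c₂`, `c₃`, respecting the filtration, then the multiplicative analogue holds in `1 + I 1`. -/
theorem exists_mul_eq {c₁ c₂ c₃ : R →+ R} (h₁ : ∀ n, ∀ x ∈ I n, c₁ x ∈ I n)
    (h₂ : ∀ n, ∀ x ∈ I n, c₂ x ∈ I n) (h₃ : ∀ n, ∀ x ∈ I n, c₃ x ∈ I n) {Z : AddSubgroup R}
    (hZ : ∀ z, (∀ n, ∃ z' ∈ Z, z - z' ∈ I n) → z ∈ Z)
    (hs : ∀ n, ∀ e ∈ I n, ∃ z ∈ I n, ∃ p ∈ I n, ∃ q ∈ I n, ∃ r ∈ I n, z ∈ Z ∧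
      e = z + (c₁ p - p) + (c₂ q - q) + (c₃ r - r)) {d : R} (hd : d - 1 ∈ I 1) :
    ∃ z ∈ I 1, ∃ p ∈ I 1, ∃ q ∈ I 1, ∃ r ∈ I 1, z ∈ Z ∧
      (1 + z) * (1 + c₁ p) * (1 + c₂ q) * (1 + c₃ r) = d * (1 + p) * (1 + q) * (1 + r) := by
  let J : ℕ → AddSubgroup (R × R × R × R) := fun n => (I n ⊓ Z).prod ((I n).prod ((I n).prod (I n)))
  have hJ : ∀ {n x}, x ∈ J n ↔ (x.1 ∈ I n ∧ x.1 ∈ Z) ∧ x.2.1 ∈ I n ∧ x.2.2.1 ∈ I n ∧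
    x.2.2.2 ∈ I n := fun {n x} => Iff.rfl
  -- The unknowns are `z`, `p`, `q`, `r`, with `z` confined to `Z`; the equation is the difference
  -- of the two products, and `ℓ` is its linear part at the identity.
  let Φ : R × R × R × R → R := fun x => (1 + x.1) * (1 + c₁ x.2.1) * (1 + c₂ x.2.2.1) *
    (1 + c₃ x.2.2.2) - d * (1 + x.2.1) * (1 + x.2.2.1) * (1 + x.2.2.2)
  let ℓ : R × R × R × R → R := fun x => x.1 + (c₁ x.2.1 - x.2.1) + (c₂ x.2.2.1 - x.2.2.1) +
    (c₃ x.2.2.2 - x.2.2.2)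
  have key : ∃ x ∈ J 1, Φ x = 0 := by
    refine exists_eq_zero_of_approximation (ℓ := ℓ) hI.eq_zero hI.anti ?_ ?_ ?_ ?_ ?_ ?_
    · intro a b hab x hx
      rw [hJ] at *
      exact ⟨⟨hI.anti hab hx.1.1, hx.1.2⟩, hI.anti hab hx.2.1, hI.anti hab hx.2.2.1,
        hI.anti hab hx.2.2.2⟩
    · intro x hx
      simp only [hJ] at hx
      obtain ⟨s, hs⟩ := hI.complete _ fun k => (hx k).1.1
      obtain ⟨s1, hs1⟩ := hI.complete _ fun k => (hx k).2.1
      obtain ⟨s2, hs2⟩ := hI.complete _ fun k => (hx k).2.2.1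
      obtain ⟨s3, hs3⟩ := hI.complete _ fun k => (hx k).2.2.2
      have hz : ∀ n, ∑ k ∈ Finset.range n, (x k).1 ∈ Z := fun n => sum_mem fun k _ => (hx k).1.2
      refine ⟨(s, s1, s2, s3), fun n => ?_⟩
      rw [hJ]
      simp only [Prod.fst_sub, Prod.snd_sub, Prod.fst_sum, Prod.snd_sum]
      exact ⟨⟨hs n, sub_mem (hZ s fun n => ⟨_, hz n, hs n⟩) (hz n)⟩, hs1 n, hs2 n, hs3 n⟩
    · simp only [Φ, Prod.fst_zero, Prod.snd_zero, map_zero, add_zero, mul_one]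
      rw [← neg_sub]
      exact neg_mem hd
    · intro n x y hx hy
      rw [hJ] at hx hy
      have u1 : ∀ {a : R}, a ∈ I 1 → 1 + a - 1 ∈ I 1 := fun h => by rwa [add_sub_cancel_left]
      have e1 : ∀ a b : R, 1 + (a + b) - (1 + a) - b ∈ I (n + 2) := fun a b => by
        have : 1 + (a + b) - (1 + a) - b = 0 := by abel
        rw [this]
        exact zero_mem _
      have e2 : ∀ (c : R →+ R) (a b : R), 1 + c (a + b) - (1 + c a) - c b ∈ I (n + 2) :=
        fun c a b => by
          rw [map_add]
          exact e1 _ _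
      have sm : ∀ {a b : R}, a ∈ I 1 → b ∈ I (n + 1) → a + b ∈ I 1 := fun h h' =>
        add_mem h (hI.anti (by omega) h')
      -- The `A`s expand the left product one factor at a time, the `B`s the right product, in which
      -- `d` is a factor with increment `0`. The difference of the two expansions has linear part `ℓ
      -- y`.
      have A1 := hI.mul_expansion (n := n) (u1 (sm hx.1.1 hy.1.1)) (u1 (h₁ _ _ hx.2.1)) hy.1.1
        (h₁ _ _ hy.2.1) (e1 _ _) (e2 c₁ _ _)
      have A2 := hI.mul_expansion (hI.mul_sub_one_mem (u1 (sm hx.1.1 hy.1.1))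
        (u1 (h₁ _ _ (sm hx.2.1 hy.2.1)))) (u1 (h₂ _ _ hx.2.2.1)) (add_mem hy.1.1 (h₁ _ _ hy.2.1))
        (h₂ _ _ hy.2.2.1) A1 (e2 c₂ _ _)
      have A3 := hI.mul_expansion (hI.mul_sub_one_mem (hI.mul_sub_one_mem (u1 (sm hx.1.1 hy.1.1))
        (u1 (h₁ _ _ (sm hx.2.1 hy.2.1)))) (u1 (h₂ _ _ (sm hx.2.2.1 hy.2.2.1))))
        (u1 (h₃ _ _ hx.2.2.2)) (add_mem (add_mem hy.1.1 (h₁ _ _ hy.2.1)) (h₂ _ _ hy.2.2.1))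
        (h₃ _ _ hy.2.2.2) A2 (e2 c₃ _ _)
      have B1 := hI.mul_expansion (n := n) hd (u1 hx.2.1) (zero_mem _) hy.2.1
        (a := d) (by simp) (e1 x.2.1 y.2.1)
      have B2 := hI.mul_expansion (hI.mul_sub_one_mem hd (u1 (sm hx.2.1 hy.2.1))) (u1 hx.2.2.1)
        (add_mem (zero_mem _) hy.2.1) hy.2.2.1 B1 (e1 _ _)
      have B3 := hI.mul_expansion (hI.mul_sub_one_mem (hI.mul_sub_one_mem hd
        (u1 (sm hx.2.1 hy.2.1))) (u1 (sm hx.2.2.1 hy.2.2.1))) (u1 hx.2.2.2)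
        (add_mem (add_mem (zero_mem _) hy.2.1) hy.2.2.1) hy.2.2.2 B2 (e1 _ _)
      convert sub_mem A3 B3 using 1
      simp only [Φ, ℓ, Prod.fst_add, Prod.snd_add]
      abel
    · intro n y hy
      rw [hJ] at hy
      exact add_mem (add_mem (add_mem hy.1.1 (sub_mem (h₁ _ _ hy.2.1) hy.2.1))
        (sub_mem (h₂ _ _ hy.2.2.1) hy.2.2.1)) (sub_mem (h₃ _ _ hy.2.2.2) hy.2.2.2)
    · intro n e he
      obtain ⟨z, hz, p, hp, q, hq, r, hr, hzZ, h⟩ := hs n (-e) (neg_mem he)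
      exact ⟨(z, p, q, r), ⟨⟨hz, hzZ⟩, hp, hq, hr⟩, h.symm⟩
  obtain ⟨⟨z, p, q, r⟩, hx, h⟩ := key
  rw [hJ] at hx
  exact ⟨z, hx.1.1, p, hx.2.1, q, hx.2.2.1, r, hx.2.2.2, hx.1.2, sub_eq_zero.1 h⟩

end IsCompleteFiltration
end

noncomputable section

/-! ### The `Y`-adic filtration, and the `X`-adic filtration on series free of `Y` -/

namespace DoubleLaurent

/-- The iterated Laurent series whose coefficients at exponents in `S` vanish. -/
def vanish (R : Type*) [CommRing R] (S : Set (ℤ × ℤ)) : AddSubgroup (HahnSeries ℤ (HahnSeries ℤ R)) where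
  carrier := {h | ∀ j i, (j, i) ∈ S → c h j i = 0}
  zero_mem' := by simp
  add_mem' := by
    intro a b ha hb j i hji
    rw [c_add, ha j i hji, hb j i hji, add_zero]
  neg_mem' := by
    intro a ha j i hji
    rw [← zero_sub, c_sub, ha j i hji, c_zero, sub_zero]

variable {R : Type*} [CommRing R]

theorem vanish_anti {S S' : Set (ℤ × ℤ)} (h : S ⊆ S') : vanish R S' ≤ vanish R S :=
  fun _ hf j i hji => hf j i (h hji)

/-- The exponents of terms not divisible by `Y ^ N`. -/
def outerExponents (N : ℕ) : Set (ℤ × ℤ) := {p | p.1 < N}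

/-- The exponents of terms that contain `Y` or are not divisible by `X ^ N`. -/
def innerExponents (N : ℕ) : Set (ℤ × ℤ) := {p | p.1 ≠ 0 ∨ p.2 < N}

theorem mem_vanish_outer {N : ℕ} {h : HahnSeries ℤ (HahnSeries ℤ R)} :
    h ∈ vanish R (outerExponents N) ↔ h ∈ filt (HahnSeries ℤ R) N := by
  constructor
  · intro H j hj
    ext i
    exact H j i hj
  · intro H j i hj
    rw [c, H j hj, HahnSeries.coeff_zero]

theorem mem_vanish_inner {N : ℕ} {h : HahnSeries ℤ (HahnSeries ℤ R)} :
    h ∈ vanish R (innerExponents N) ↔ ∃ f ∈ filt R N, h = HahnSeries.C f := by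
  constructor
  · intro H
    refine ⟨h.coeff 0, fun i hi => H 0 i (Or.inr hi), ?_⟩
    ext j i
    rw [HahnSeries.C_apply, HahnSeries.coeff_single]
    split_ifs with hj
    · rw [hj]
    · exact H j i (Or.inl hj)
  · rintro ⟨f, hf, rfl⟩ j i (hj | hi)
    · rw [c, HahnSeries.C_apply, HahnSeries.coeff_single_of_ne hj, HahnSeries.coeff_zero]
    · rw [c, HahnSeries.C_apply, HahnSeries.coeff_single]
      split_ifs
      · exact hf i hi
      · rw [HahnSeries.coeff_zero]

theorem mul_mem_vanish_outer {a b : ℕ} {f g : HahnSeries ℤ (HahnSeries ℤ R)}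
    (hf : f ∈ vanish R (outerExponents a)) (hg : g ∈ vanish R (outerExponents b)) :
    f * g ∈ vanish R (outerExponents (a + b)) := by
  rw [mem_vanish_outer] at *
  push_cast
  exact mul_mem_filt hf hg

theorem mul_mem_vanish_inner {a b : ℕ} {f g : HahnSeries ℤ (HahnSeries ℤ R)}
    (hf : f ∈ vanish R (innerExponents a)) (hg : g ∈ vanish R (innerExponents b)) :
    f * g ∈ vanish R (innerExponents (a + b)) := by
  rw [mem_vanish_inner] at *
  obtain ⟨f, hf, rfl⟩ := hf
  obtain ⟨g, hg, rfl⟩ := hg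
  refine ⟨f * g, ?_, (map_mul _ _ _).symm⟩
  push_cast
  exact mul_mem_filt hf hg

theorem outer_mono : Monotone outerExponents := fun a b h p hp => by
  change p.1 < (a : ℤ) at hp
  change p.1 < (b : ℤ)
  omega

theorem inner_mono : Monotone innerExponents := fun a b h p hp => by
  change p.1 ≠ 0 ∨ p.2 < (a : ℤ) at hp
  change p.1 ≠ 0 ∨ p.2 < (b : ℤ)
  omega

theorem outer_subset_inner : outerExponents 0 ⊆ innerExponents 0 := fun p hp => Or.inl (by
  change p.1 < ((0 : ℕ) : ℤ) at hp
  omega)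

/-- Convergence of series whose terms have increasing orders. -/
theorem exists_sum_filt {A : Type*} [AddCommGroup A] (x : ℕ → HahnSeries ℤ A)
    (hx : ∀ k : ℕ, x k ∈ filt A k) :
    ∃ s, ∀ n : ℕ, s - ∑ k ∈ Finset.range n, x k ∈ filt A n := by
  -- Only the terms with `k ≤ j` contribute in order `j`, so the sum over `k < (j + 1).toNat` is
  -- complete; it is empty for `j < 0`, which bounds the support below.
  refine ⟨⟨fun j => ∑ k ∈ Finset.range (j + 1).toNat, (x k).coeff j, BddBelow.isWF ⟨0, ?_⟩ |>.isPWO⟩,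
    fun n j hj => ?_⟩
  · intro j hj
    by_contra! hlt
    refine hj ?_
    have : (j + 1).toNat = 0 := by omega
    simp [this]
  · rw [HahnSeries.coeff_sub, HahnSeries.coeff_sum, sub_eq_zero]
    refine Finset.sum_subset (Finset.range_subset_range.2 (by omega)) fun k _ hk => ?_
    refine hx k j ?_
    rw [Finset.mem_range] at hk
    omega

theorem exists_sum_outer (x : ℕ → HahnSeries ℤ (HahnSeries ℤ R))
    (hx : ∀ k, x k ∈ vanish R (outerExponents k)) :
    ∃ s, ∀ n, s - ∑ k ∈ Finset.range n, x k ∈ vanish R (outerExponents n) := by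
  simp only [mem_vanish_outer] at *
  exact exists_sum_filt x hx

theorem exists_sum_inner (x : ℕ → HahnSeries ℤ (HahnSeries ℤ R))
    (hx : ∀ k, x k ∈ vanish R (innerExponents k)) :
    ∃ s, ∀ n, s - ∑ k ∈ Finset.range n, x k ∈ vanish R (innerExponents n) := by
  simp only [mem_vanish_inner] at *
  choose f hf hx using hx
  obtain ⟨s, hs⟩ := exists_sum_filt f hf
  refine ⟨HahnSeries.C s, fun n => ⟨_, hs n, ?_⟩⟩
  rw [map_sub, map_sum]
  simp only [hx]

/-- There is a series with prescribed coefficients, provided that they vanish where those of some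
series do. -/
theorem exists_series {R' : Type*} [CommRing R'] (h : HahnSeries ℤ (HahnSeries ℤ R))
    (P : ℤ → ℤ → R') (hP : ∀ j i, c h j i = 0 → P j i = 0) :
    ∃ h' : HahnSeries ℤ (HahnSeries ℤ R'), ∀ j i, c h' j i = P j i :=
  ⟨⟨fun j => ⟨P j, (h.coeff j).isPWO_support.mono fun i hi h0 => hi (hP j i h0)⟩,
    h.isPWO_support.mono fun j hj h0 => hj (by
      ext i
      exact hP j i (by rw [c, h0, HahnSeries.coeff_zero]))⟩, fun _ _ => rfl⟩

end DoubleLaurent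

/-! ### Averages over cyclic groups of automorphisms -/

section Averaging

variable {κ E : Type*} [Field κ] [Field E] [Algebra κ E]

/-- The average of the conjugates of `e` under a cyclic group of automorphisms differs from `e` by
an element of the form `σ(p) - p`. -/
theorem sub_average (σ : E ≃ₐ[κ] E) {n : ℕ} (hn : (n : κ) ≠ 0) (e : E) :
    e = (n : κ)⁻¹ • ∑ a ∈ Finset.range n, (σ ^ a) e +
      (σ (-(n : κ)⁻¹ • ∑ a ∈ Finset.range n, ∑ l ∈ Finset.range a, (σ ^ l) e) -
        -(n : κ)⁻¹ • ∑ a ∈ Finset.range n, ∑ l ∈ Finset.range a, (σ ^ l) e) := by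
  -- Telescoping: `σ - 1` sends the partial sum of the first `a` conjugates to `σ ^ a (e) - e`.
  -- Averaging over `a` gives the claim.
  have h1 : ∀ a : ℕ, σ (∑ l ∈ Finset.range a, (σ ^ l) e) =
      ∑ l ∈ Finset.range a, (σ ^ l) e + ((σ ^ a) e - e) := by
    intro a
    have h2 := Finset.sum_range_succ' (fun l => (σ ^ l) e) a
    rw [Finset.sum_range_succ] at h2
    rw [map_sum]
    have h3 : ∀ l, σ ((σ ^ l) e) = (σ ^ (l + 1)) e := fun l => by
      rw [pow_succ', AlgEquiv.mul_apply]
    simp only [h3]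
    rw [pow_zero, AlgEquiv.one_apply] at h2
    linear_combination -h2
  rw [map_smul, map_sum]
  simp only [h1, Finset.sum_add_distrib, Finset.sum_sub_distrib, Finset.sum_const,
    Finset.card_range]
  have h4 : (n : κ)⁻¹ • (n • e) = e := by
    rw [← Nat.cast_smul_eq_nsmul κ, smul_smul, inv_mul_cancel₀ hn, one_smul]
  rw [smul_add, smul_sub, neg_smul, neg_smul, neg_smul, h4]
  abel

theorem average_fixed (σ : E ≃ₐ[κ] E) {n : ℕ} (hσ : σ ^ n = 1) (e : E) :
    σ ((n : κ)⁻¹ • ∑ a ∈ Finset.range n, (σ ^ a) e) = (n : κ)⁻¹ • ∑ a ∈ Finset.range n, (σ ^ a) e := by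
  rw [map_smul, map_sum]
  congr 1
  have h2 := Finset.sum_range_succ' (fun l => (σ ^ l) e) n
  rw [Finset.sum_range_succ, hσ, pow_zero] at h2
  have h3 : ∀ l, σ ((σ ^ l) e) = (σ ^ (l + 1)) e := fun l => by
    rw [pow_succ', AlgEquiv.mul_apply]
  simp only [h3]
  exact (add_right_cancel h2).symm

open DoubleLaurent

/-- Every element is a sum of an element of `κ` and elements of the images of `σ - 1` and
`τ - 1`. -/
theorem DoubleLaurent.IsBicyclic.exists_decomposition [FiniteDimensional κ E] [IsGalois κ E]
    {σ τ : E ≃ₐ[κ] E} {n m : ℕ}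
    (h : IsBicyclic σ τ n m) (hn : (n : κ) ≠ 0) (hm : (m : κ) ≠ 0) (e : E) :
    ∃ (z : κ) (p q : E), e = algebraMap κ E z + (σ p - p) + (τ q - q) := by
  have hσ : σ ^ n = 1 := by simpa using (h.eq_one_iff 0 n).2 (by simp)
  have hτ : τ ^ m = 1 := by simpa using (h.eq_one_iff m 0).2 (by simp)
  have h1 := sub_average σ hn e
  set e1 := (n : κ)⁻¹ • ∑ a ∈ Finset.range n, (σ ^ a) e with he1
  have h2 := sub_average τ hm e1
  set z := (m : κ)⁻¹ • ∑ a ∈ Finset.range m, (τ ^ a) e1 with hz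
  have hz1 : τ z = z := average_fixed τ hτ e1
  -- Since `σ` commutes with powers of `τ` and fixes `e1`, averaging over `τ` keeps invariance under
  -- `σ`; so `z` is fixed by all of `G`.
  have hz2 : σ z = z := by
    rw [hz, map_smul, map_sum]
    congr 1
    refine Finset.sum_congr rfl fun a _ => ?_
    have h3 : Commute σ (τ ^ a) := (show Commute σ τ from h.comm).pow_right a
    rw [← AlgEquiv.mul_apply, h3.eq, AlgEquiv.mul_apply, average_fixed σ hσ]
  have hz3 : ∀ g : E ≃ₐ[κ] E, g z = z := by
    intro g
    obtain ⟨j, i, rfl⟩ := h.surjective g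
    let S : Subgroup (E ≃ₐ[κ] E) := MulAction.stabilizer (E ≃ₐ[κ] E) z
    exact mul_mem (S.zpow_mem (show σ ∈ S from hz2) i) (S.zpow_mem (show τ ∈ S from hz1) j)
  obtain ⟨z', hz'⟩ := (IsGalois.mem_bot_iff_fixed z).2 hz3
  have hz4 : algebraMap κ E z' = z := hz'
  obtain ⟨p, hp⟩ : ∃ p, e = e1 + (σ p - p) := ⟨_, h1⟩
  obtain ⟨q, hq⟩ : ∃ q, e1 = z + (τ q - q) := ⟨_, h2⟩
  exact ⟨z', p, q, by linear_combination hp + hq - hz4⟩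

end Averaging
end

noncomputable section

/-! ### Units close to `1` modulo commutators, and the kernel of the leading coefficient -/

open DoubleLaurent

/-- A primitive element has trivial stabilizer. If it is `0`, every automorphism fixes it, so the
group is trivial and `1` serves. -/
theorem exists_ne_zero_forall_eq_one (κ E : Type*) [Field κ] [Field E] [Algebra κ E]
    [FiniteDimensional κ E] [Algebra.IsSeparable κ E] :
    ∃ θ : E, θ ≠ 0 ∧ ∀ g : E ≃ₐ[κ] E, g θ = θ → g = 1 := by
  let pb := Field.powerBasisOfFiniteOfSeparable κ E
  have h : ∀ g : E ≃ₐ[κ] E, g pb.gen = pb.gen → g = 1 := by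
    intro g hg
    have h1 : (g : E →ₐ[κ] E) = ((1 : E ≃ₐ[κ] E) : E →ₐ[κ] E) := pb.algHom_ext hg
    exact AlgEquiv.ext fun e => DFunLike.congr_fun h1 e
  by_cases h0 : pb.gen = 0
  · exact ⟨1, one_ne_zero, fun g _ => h g (by rw [h0, map_zero])⟩
  · exact ⟨pb.gen, h0, h⟩

namespace SplitModel

variable {κ : Type u} {E : Type v} [Field κ] [Field E] [Algebra κ E] {σ τ : E ≃ₐ[κ] E} {n m : ℕ}
  [NeZero n] [NeZero m] {B : Type w} [Ring B] [Algebra (LaurentSeries₂ κ) B]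
  (M : SplitModel σ τ n m B)

/-- Conjugation by a unit. -/
def conj {B : Type*} [Ring B] (w : Bˣ) : B →+ B :=
  (AddMonoidHom.mulLeft (w : B)).comp (AddMonoidHom.mulRight ((w⁻¹ : Bˣ) : B))

theorem conj_apply {B : Type*} [Ring B] (w : Bˣ) (d : B) :
    conj w d = w * (d * (w⁻¹ : Bˣ)) := rfl

/-- The filtration of `B` given by the vanishing of coefficients. -/
def filtration (S : ℕ → Set (ℤ × ℤ)) (N : ℕ) : AddSubgroup B := (vanish E (S N)).comap M.ev

theorem mem_filtration {S : ℕ → Set (ℤ × ℤ)} {N : ℕ} {d : B} :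
    d ∈ M.filtration S N ↔ ∀ j i, (j, i) ∈ S N → c (M.ev d) j i = 0 := Iff.rfl

/-- The unit of `B` given by a nonzero element of `E`. -/
def unitι : Eˣ →* Bˣ := Units.map (M.ι : E →* B)

/-- The elements of `B` whose coefficients are those of an element of the center `κ((x))((y))`. -/
def central : AddSubgroup B where
  carrier := {d | ∀ j i, (∃ a, algebraMap κ E a = c (M.ev d) j i) ∧
    (¬ ((m : ℤ) ∣ j ∧ (n : ℤ) ∣ i) → c (M.ev d) j i = 0)}
  zero_mem' j i := by
    rw [map_zero, c_zero]
    exact ⟨⟨0, map_zero _⟩, fun _ => rfl⟩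
  add_mem' := by
    intro d d' hd hd' j i
    obtain ⟨⟨a, ha⟩, h⟩ := hd j i
    obtain ⟨⟨a', ha'⟩, h'⟩ := hd' j i
    rw [map_add, c_add]
    exact ⟨⟨a + a', by rw [map_add, ha, ha']⟩, fun hn => by rw [h hn, h' hn, add_zero]⟩
  neg_mem' := by
    intro d hd j i
    obtain ⟨⟨a, ha⟩, h⟩ := hd j i
    rw [map_neg, ← zero_sub, c_sub, c_zero]
    exact ⟨⟨0 - a, by rw [map_sub, ha, map_zero]⟩, fun hn => by rw [h hn, sub_zero]⟩

theorem ev_algebraMap (f : LaurentSeries₂ κ) :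
    M.ev (algebraMap _ B f) = map (algebraMap κ E) (scale κ n m f) := by
  rw [ev_apply, act_algebraMap, mul_one]

variable [FiniteDimensional κ E] [IsGalois κ E]

/-- Coefficients in `κ` and exponents in `mℤ × nℤ` describe exactly the image of `κ((x))((y))` under
`ev`, which is injective. -/
theorem exists_eq_algebraMap {d : B} (hd : d ∈ M.central) : ∃ f : LaurentSeries₂ κ, d = algebraMap _ B f := by
  have h0 : ∀ j i, ¬ ((m : ℤ) ∣ j ∧ (n : ℤ) ∣ i) → c (M.ev d) j i = 0 := fun j i => (hd j i).2
  choose P hP using fun j i => (hd j i).1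
  obtain ⟨h, hh⟩ := exists_series (M.ev d) P (fun j i hji => by
    have := hP j i
    rwa [hji, map_eq_zero] at this)
  obtain ⟨f, hf⟩ := exists_scale_eq n m h (fun j i hji => by
    have := hP j i
    rwa [h0 j i hji, map_eq_zero, ← hh] at this)
  refine ⟨f, M.ev_injective (ext_c fun j i => ?_)⟩
  rw [ev_algebraMap, hf, c_map, hh, hP]

/-- The shifts of `w` and its inverse cancel, so that conjugation leaves exponents in place and
applies `g` to the coefficients. The conjugation equations can therefore be solved one coefficient
at a time, compatibly with any filtration by exponents. -/
theorem ev_conj {w : Bˣ} {j i : ℤ} {g : E ≃ₐ[κ] E}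
    (hw : ∀ h, M.act w h = mono j i 1 * map (g : E →+* E) h) (d : B) :
    M.ev (conj w d) = map (g : E →+* E) (M.ev d) := by
  have h1 := M.act_unit_inv hw 1
  rw [map_one (map _)] at h1
  rw [conj_apply, ev_apply, act_mul, act_mul, h1, act_mono_mul, hw, map_mul (map _), map_mono,
    map_one (g : E →+* E), mono_mul_cancel]
  rfl

/-- Moving `θ⁻¹` to the left past a term of degree `g` turns it into `g(θ⁻¹)`, so conjugation by `θ`
rescales each homogeneous component. -/
theorem c_ev_conj_ι (θ : Eˣ) (d : B) (j i : ℤ) :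
    c (M.ev (conj (M.unitι θ) d)) j i =
      θ * (σ ^ i * τ ^ j : E ≃ₐ[κ] E) ((θ⁻¹ : Eˣ) : E) * c (M.ev d) j i := by
  have h1 : M.act ((M.unitι θ)⁻¹ : Bˣ) 1 = mono 0 0 ((θ⁻¹ : Eˣ) : E) := by
    have := M.act_ι ((θ⁻¹ : Eˣ) : E) 1
    rw [mul_one] at this
    exact this
  have h2 : ∀ h, M.act (M.unitι θ : Bˣ) h = mono 0 0 (θ : E) * h := M.act_ι θ
  rw [conj_apply, ev_apply, act_mul, act_mul, h1, h2, c_mono_mul, act_eq_twist, twist, c_sum,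
    Finset.sum_eq_single (σ ^ i * τ ^ j)]
  · rw [mul_comm (comp _ _ _ _), map_mono, c_mono_mul, c_comp]
    simp only [sub_zero, if_true, mul_assoc]
    rfl
  · intro g _ hg
    rw [mul_comm, map_mono, c_mono_mul, c_comp, if_neg, mul_zero]
    simpa using hg.symm
  · simp

/-- Automorphisms of the coefficients and projection to a component do not enlarge supports, so
multiplicativity and completeness pass from ordinary series to the twisted product. The sets `S N`
are kept general to cover both filtrations. -/
theorem isCompleteFiltration {S : ℕ → Set (ℤ × ℤ)} (hS : Monotone S) (h0 : (0, 0) ∉ S 0)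
    (hmul : ∀ {a b : ℕ} {f g : LaurentSeries₂ E}, f ∈ vanish E (S a) → g ∈ vanish E (S b) →
      f * g ∈ vanish E (S (a + b))) (hex : ∀ j i, ∃ N, (j, i) ∈ S N)
    (hsum : ∀ x : ℕ → LaurentSeries₂ E, (∀ k, x k ∈ vanish E (S k)) →
      ∃ s, ∀ n, s - ∑ k ∈ Finset.range n, x k ∈ vanish E (S n)) :
    IsCompleteFiltration (M.filtration S) where
  anti _ _ h _ hx := vanish_anti (hS h) hx
  one_mem := by
    rw [mem_filtration]
    intro j i hji
    rw [ev_one, c_one, if_neg]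
    rintro ⟨rfl, rfl⟩
    exact h0 hji
  mul_mem := by
    intro a b x y hx hy
    change M.ev _ ∈ vanish _ _
    rw [ev_mul]
    refine sum_mem fun g _ => hmul (fun j i hji => ?_) (fun j i hji => ?_)
    · rw [c_comp, hx j i hji, ite_self]
    · rw [c_map, hy j i hji, map_zero]
  eq_zero := by
    intro x hx
    refine M.ev_injective (ext_c fun j i => ?_)
    obtain ⟨N, hN⟩ := hex j i
    rw [hx N j i hN, map_zero, c_zero]
  complete x hx := by
    obtain ⟨s, hs⟩ := hsum (fun k => M.ev (x k)) hx
    obtain ⟨s, rfl⟩ := M.ev_surjective s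
    refine ⟨s, fun n => ?_⟩
    change M.ev _ ∈ vanish _ _
    rw [map_sub, map_sum]
    exact hs n

theorem isCompleteFiltration_outer : IsCompleteFiltration (M.filtration outerExponents) :=
  M.isCompleteFiltration outer_mono (fun h => lt_irrefl _ (show (0 : ℤ) < (0 : ℕ) from h))
    mul_mem_vanish_outer (fun j _ => ⟨(j + 1).toNat, show j < ((j + 1).toNat : ℤ) by omega⟩)
    exists_sum_outer

theorem isCompleteFiltration_inner : IsCompleteFiltration (M.filtration innerExponents) :=
  M.isCompleteFiltration inner_mono
    (fun h => h.elim (fun h => h rfl) fun h => lt_irrefl _ (show (0 : ℤ) < (0 : ℕ) from h))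
    mul_mem_vanish_inner
    (fun _ i => ⟨(i + 1).toNat, Or.inr (show i < ((i + 1).toNat : ℤ) by omega)⟩)
    exists_sum_inner

/-- At an exponent outside `mℤ × nℤ`, conjugation by `θ` multiplies by a factor other than `1`, so
`r` alone suffices. At the other exponents averaging gives `E = κ + (σ - 1)E + (τ - 1)E`, where the
invertibility of `n` and `m` enters. -/
theorem exists_conj_decomposition (hn : (n : κ) ≠ 0) (hm : (m : κ) ≠ 0) {θ : Eˣ}
    (hθ : ∀ g : E ≃ₐ[κ] E, g θ = θ → g = 1) (S : ℕ → Set (ℤ × ℤ)) (N : ℕ) (e : B)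
    (he : e ∈ M.filtration S N) :
    ∃ z ∈ M.filtration S N, ∃ p ∈ M.filtration S N, ∃ q ∈ M.filtration S N,
      ∃ r ∈ M.filtration S N, z ∈ M.central ∧ e = z + (conj M.u p - p) + (conj M.v q - q) +
        (conj (M.unitι θ) r - r) := by
  -- The clause for `x = 0` keeps the supports of `z`, `p`, `q`, `r` inside that of `e`; hence they
  -- are series and lie in the same filtration step.
  have key : ∀ (j i : ℤ) (x : E), ∃ (z : κ) (p q r : E), (x = 0 → z = 0 ∧ p = 0 ∧ q = 0 ∧ r = 0) ∧
      (¬ ((m : ℤ) ∣ j ∧ (n : ℤ) ∣ i) → z = 0) ∧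
      x = algebraMap κ E z + (σ p - p) + (τ q - q) +
        (θ * (σ ^ i * τ ^ j : E ≃ₐ[κ] E) ((θ⁻¹ : Eˣ) : E) * r - r) := by
    intro j i x
    by_cases hx : x = 0
    · exact ⟨0, 0, 0, 0, fun _ => ⟨rfl, rfl, rfl, rfl⟩, fun _ => rfl, by simp [hx]⟩
    by_cases hji : (m : ℤ) ∣ j ∧ (n : ℤ) ∣ i
    · obtain ⟨z, p, q, h⟩ := M.bicyclic.exists_decomposition hn hm x
      exact ⟨z, p, q, 0, fun h => absurd h hx, fun h => absurd hji h, by simpa using h⟩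
    · have h1 : (θ * (σ ^ i * τ ^ j : E ≃ₐ[κ] E) ((θ⁻¹ : Eˣ) : E) - 1 : E) ≠ 0 := by
        intro h0
        refine hji ((M.bicyclic.eq_one_iff j i).1 (hθ _ ?_))
        have h2 := congrArg (fun y : E => y * (σ ^ i * τ ^ j : E ≃ₐ[κ] E) (θ : E)) h0
        simp only [sub_mul, zero_mul, one_mul, mul_assoc] at h2
        rw [← map_mul, Units.inv_mul, map_one, mul_one] at h2
        exact (sub_eq_zero.1 h2).symm
      refine ⟨0, 0, 0, x / (θ * (σ ^ i * τ ^ j : E ≃ₐ[κ] E) ((θ⁻¹ : Eˣ) : E) - 1),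
        fun h => absurd h hx, fun _ => rfl, ?_⟩
      rw [← sub_one_mul, mul_div_cancel₀ _ h1]
      simp
  choose z p q r h0 hz h using key
  have h0' : ∀ j i, c (M.ev e) j i = 0 → z j i (c (M.ev e) j i) = 0 ∧ p j i (c (M.ev e) j i) = 0 ∧
    q j i (c (M.ev e) j i) = 0 ∧ r j i (c (M.ev e) j i) = 0 := fun j i h => h0 j i _ h
  have lift : ∀ P : ℤ → ℤ → E, (∀ j i, c (M.ev e) j i = 0 → P j i = 0) →
      ∃ d ∈ M.filtration S N, ∀ j i, c (M.ev d) j i = P j i := by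
    intro P hP
    obtain ⟨h', hh'⟩ := exists_series (M.ev e) P hP
    obtain ⟨d, rfl⟩ := M.ev_surjective h'
    exact ⟨d, fun j i hji => (hh' j i).trans (hP j i (he j i hji)), hh'⟩
  obtain ⟨z', hz1, hz2⟩ := lift (fun j i => algebraMap κ E (z j i (c (M.ev e) j i))) fun j i h => by
    rw [(h0' j i h).1, map_zero]
  obtain ⟨p', hp1, hp2⟩ := lift _ fun j i h => (h0' j i h).2.1
  obtain ⟨q', hq1, hq2⟩ := lift _ fun j i h => (h0' j i h).2.2.1
  obtain ⟨r', hr1, hr2⟩ := lift _ fun j i h => (h0' j i h).2.2.2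
  refine ⟨z', hz1, p', hp1, q', hq1, r', hr1, fun j i => ⟨⟨_, (hz2 j i).symm⟩, fun hji => ?_⟩, ?_⟩
  · rw [hz2, hz j i _ hji, map_zero]
  · refine M.ev_injective (ext_c fun j i => ?_)
    simp only [map_add, map_sub, c_add, c_sub, M.ev_conj M.act_u, M.ev_conj M.act_v, c_ev_conj_ι,
      c_map, hz2, hp2, hq2, hr2]
    exact h j i _

theorem conj_mem_filtration {w : Bˣ} {j i : ℤ} {g : E ≃ₐ[κ] E}
    (hw : ∀ h, M.act w h = mono j i 1 * map (g : E →+* E) h) (S : ℕ → Set (ℤ × ℤ)) (N : ℕ)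
    {d : B} (hd : d ∈ M.filtration S N) : conj w d ∈ M.filtration S N := by
  intro j i hji
  rw [M.ev_conj hw, c_map, hd j i hji, map_zero]

/-- Modulo commutators, a unit close to `1` is central. -/
theorem exists_central_congr (hn : (n : κ) ≠ 0) (hm : (m : κ) ≠ 0) {S : ℕ → Set (ℤ × ℤ)}
    (hI : IsCompleteFiltration (M.filtration S)) (hex : ∀ j i, ∃ N, (j, i) ∈ S N) {d : Bˣ}
    (hd : (d : B) - 1 ∈ M.filtration S 1) :
    ∃ (f : LaurentSeries₂ κ) (w : Bˣ), (w : B) = algebraMap _ B f ∧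
      (w : B) - 1 ∈ M.filtration S 1 ∧ Abelianization.of d = Abelianization.of w := by
  obtain ⟨θ, hθ0, hθ⟩ := exists_ne_zero_forall_eq_one κ E
  obtain ⟨z, hz, p, hp, q, hq, r, hr, hzZ, h⟩ := hI.exists_mul_eq
    (c₁ := conj M.u) (c₂ := conj M.v) (c₃ := conj (M.unitι (Units.mk0 θ hθ0))) (Z := M.central)
    (fun N x hx => M.conj_mem_filtration M.act_u S N hx)
    (fun N x hx => M.conj_mem_filtration M.act_v S N hx)
    (fun N x hx j i hji => by rw [c_ev_conj_ι, hx j i hji, mul_zero])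
    (fun z hz j i => by
      obtain ⟨N, hN⟩ := hex j i
      obtain ⟨z', hz', hzz⟩ := hz N
      have h1 := hzz j i hN
      rw [map_sub, c_sub, sub_eq_zero] at h1
      rw [h1]
      exact hz' j i)
    (M.exists_conj_decomposition hn hm hθ S) hd
  obtain ⟨wz, hwz, -⟩ := hI.exists_unit hz
  obtain ⟨wp, hwp, -⟩ := hI.exists_unit hp
  obtain ⟨wq, hwq, -⟩ := hI.exists_unit hq
  obtain ⟨wr, hwr, -⟩ := hI.exists_unit hr
  have hc : ∀ (w a : Bˣ) (x : B), (a : B) = 1 + x → 1 + conj w x = (w * a * w⁻¹ : Bˣ) := by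
    intro w a x hx
    rw [Units.val_mul, Units.val_mul, hx, conj_apply, mul_add, add_mul, mul_one, Units.mul_inv,
      mul_assoc]
  obtain ⟨f, hf⟩ := M.exists_eq_algebraMap hzZ
  refine ⟨1 + f, wz, by rw [hwz, hf, map_add, map_one], by rwa [hwz, add_sub_cancel_left], ?_⟩
  -- Each factor `1 + conj w x` is a conjugate of `1 + x`; in the abelianization these cancel,
  -- leaving `1 + z` for `d`.
  rw [hc _ _ _ hwp, hc _ _ _ hwq, hc _ _ _ hwr, ← hwz, ← hwp, ← hwq, ← hwr] at h
  have h1 := congrArg Abelianization.of (Units.ext h : wz * (M.u * wp * M.u⁻¹) *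
    (M.v * wq * M.v⁻¹) * (M.unitι (Units.mk0 θ hθ0) * wr * (M.unitι (Units.mk0 θ hθ0))⁻¹) =
      d * wp * wq * wr)
  simp only [map_mul, map_inv, mul_inv_cancel_comm] at h1
  exact (mul_right_cancel (mul_right_cancel (mul_right_cancel h1))).symm

theorem commutator_le_SL1 (k : Type u) (D : Type v) [Field k] [Ring D] [Algebra k D] :
    commutator Dˣ ≤ SL1 k D := by
  rw [commutator_def, Subgroup.commutator_le]
  intro a _ b _ Ω _ _ n φ _
  have h : ∀ w : Dˣ, (φ (w : D)).det * (φ ((w⁻¹ : Dˣ) : D)).det = 1 := by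
    intro w
    rw [← Matrix.det_mul, ← map_mul, Units.mul_inv, map_one, Matrix.det_one]
  rw [commutatorElement_def]
  simp only [Units.val_mul, map_mul, Matrix.det_mul, map_one]
  rw [← mul_one (1 : Ω)]
  nth_rewrite 1 [← h a]
  rw [← h b]
  ring

/-- For `g = σ ^ i τ ^ j`, conjugation by `u ^ i v ^ j` induces `g` on `E`, so `g(a) / a` is the
commutator of `u ^ i v ^ j` and `a`. -/
theorem unitι_mem_commutator {a : Eˣ} (ha : a ∈ augmentationSubgroup κ E) :
    M.unitι a ∈ commutator Bˣ := by
  suffices augmentationSubgroup κ E ≤ (commutator Bˣ).comap M.unitι from this ha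
  rw [augmentationSubgroup, Subgroup.closure_le]
  rintro _ ⟨g, a, rfl⟩
  obtain ⟨j, i, rfl⟩ := M.bicyclic.surjective g
  have h : M.unitι (Units.map ((σ ^ i * τ ^ j : E ≃ₐ[κ] E) : E →* E) a / a) =
      M.w j i * M.unitι a * (M.w j i)⁻¹ * (M.unitι a)⁻¹ := by
    rw [map_div, div_eq_mul_inv, mul_left_inj, eq_mul_inv_iff_mul_eq]
    refine Units.ext (M.ev_injective ?_)
    have h1 : M.ev (M.unitι a : Bˣ) = mono 0 0 (a : E) := by
      rw [ev_apply]
      exact (M.act_ι _ _).trans (mul_one _)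
    rw [Units.val_mul, Units.val_mul, ev_apply, ev_apply, act_mul, act_mul, ← ev_apply,
      ← ev_apply, h1, ev_w, act_w, map_mono]
    refine (M.act_ι _ _).trans ?_
    rw [mono_mul_mono, mono_mul_mono, mul_one, one_mul, add_zero, zero_add, zero_add, add_zero]
    rfl
  rw [SetLike.mem_coe, Subgroup.mem_comap, h]
  exact Subgroup.commutator_mem_commutator (Subgroup.mem_top _) (Subgroup.mem_top _)

/-- If the degree is invertible, an element of reduced norm `1` whose leading coefficient is
trivial is a product of commutators. -/
theorem mem_commutator_of_hasLeading (hn : (n : κ) ≠ 0) (hm : (m : κ) ≠ 0) {d : Bˣ}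
    (hd : d ∈ SL1 (LaurentSeries₂ κ) B) (h : M.HasLeading d 0 0 1) : d ∈ commutator Bˣ := by
  have hint := (h.2 1 (one_mem _)).1
  rw [neg_zero, mono_zero_one, one_mul, ← ev_apply, mem_integers] at hint
  have hc := h.c_ev
  -- The part `w0` of `d` free of `Y` is `1` plus positive powers of `X`, and dividing by it leaves
  -- `1` plus terms divisible by `Y`. The lexicographic order has rank two, so each factor is
  -- treated by its own filtration.
  obtain ⟨w0, hw0⟩ := M.ev_surjective (HahnSeries.C ((M.ev (d : B)).coeff 0))
  have cw0 : ∀ j i, c (M.ev w0) j i = if j = 0 then c (M.ev (d : B)) 0 i else 0 := by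
    intro j i
    rw [hw0, c, HahnSeries.C_apply, HahnSeries.coeff_single]
    split_ifs <;> rfl
  have hmem : w0 - 1 ∈ M.filtration innerExponents 1 := by
    intro j i hji
    rw [map_sub, c_sub, ev_one, c_one, cw0]
    by_cases hj : j = 0
    · subst hj
      have hi : i < 1 := hji.elim (fun h => absurd rfl h) fun h => by simpa using h
      by_cases hi0 : i = 0
      · simp [hi0, hc]
      · simp [hi0, hint 0 i (by omega)]
    · simp [hj]
  obtain ⟨W, hW, hW'⟩ := M.isCompleteFiltration_inner.exists_unit hmem
  rw [add_sub_cancel] at hW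
  have houter : ((W⁻¹ * d : Bˣ) : B) - 1 ∈ M.filtration outerExponents 1 := by
    have h1 : ((W⁻¹ * d : Bˣ) : B) - 1 = ((W⁻¹ : Bˣ) : B) * (d - w0) := by
      rw [mul_sub, ← hW, Units.inv_mul, Units.val_mul]
    have h2 : ((W⁻¹ : Bˣ) : B) ∈ M.filtration outerExponents 0 := by
      refine vanish_anti outer_subset_inner ?_
      have h3 := add_mem (M.isCompleteFiltration_inner.anti (Nat.zero_le 1) hW')
        M.isCompleteFiltration_inner.one_mem
      rwa [sub_add_cancel] at h3
    rw [h1]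
    refine M.isCompleteFiltration_outer.mul_mem (a := 0) (b := 1) h2 fun j i hji => ?_
    have hj : j < 1 := by simpa [outerExponents] using hji
    rw [map_sub, c_sub, cw0]
    by_cases hj0 : j = 0
    · simp [hj0]
    · simp [hj0, hint j i (by omega)]
  obtain ⟨f, a, ha, ha1, hda⟩ := M.exists_central_congr hn hm M.isCompleteFiltration_inner
    (fun _ i => ⟨(i + 1).toNat, Or.inr (show i < ((i + 1).toNat : ℤ) by omega)⟩)
    (d := W) (by rwa [hW])
  obtain ⟨f', a', ha', ha1', hda'⟩ := M.exists_central_congr hn hm M.isCompleteFiltration_outer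
    (fun j _ => ⟨(j + 1).toNat, show j < ((j + 1).toNat : ℤ) by omega⟩) houter
  have hab : Abelianization.of d = Abelianization.of (a * a') := by
    rw [map_mul, ← hda, ← hda', ← map_mul, mul_inv_cancel_left]
  have hcomm : d / (a * a') ∈ commutator Bˣ := by
    rw [← Abelianization.ker_of, MonoidHom.mem_ker, map_div, hab, div_self']
  have hff : ((a * a' : Bˣ) : B) = algebraMap _ B (f * f') := by
    rw [Units.val_mul, ha, ha', map_mul]
  -- The exponents of a scalar are multiplied by the positive numbers `m` and `n`, which preserves
  -- their signs. So closeness to `1` in the algebra means an integral series with residue `1`.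
  have hres : ∀ (S : ℕ → Set (ℤ × ℤ)) (f : LaurentSeries₂ κ) (a : Bˣ), (a : B) = algebraMap _ B f →
      (a : B) - 1 ∈ M.filtration S 1 → (∀ j i : ℤ, j < 0 ∨ j = 0 ∧ i ≤ 0 → (j, i) ∈ S 1) →
      f ∈ integers κ ∧ c f 0 0 = 1 := by
    intro S f a ha ha1 hS
    have h1 : ∀ j i : ℤ, j < 0 ∨ j = 0 ∧ i ≤ 0 → c f j i = if j = 0 ∧ i = 0 then 1 else 0 := by
      intro j i hji
      have hn0 : (0 : ℤ) < n := by exact_mod_cast Nat.pos_of_ne_zero (NeZero.ne n)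
      have hm0 : (0 : ℤ) < m := by exact_mod_cast Nat.pos_of_ne_zero (NeZero.ne m)
      have h2 := ha1 (m * j) (n * i) (hS _ _ (by
        rcases hji with hj | ⟨rfl, hi⟩
        · exact Or.inl (mul_neg_of_pos_of_neg hm0 hj)
        · exact Or.inr ⟨mul_zero _, mul_nonpos_of_nonneg_of_nonpos hn0.le hi⟩))
      rw [map_sub, c_sub, ha, ev_algebraMap, ev_one, c_map, c_scale_mul, c_one, sub_eq_zero] at h2
      apply (algebraMap κ E).injective
      rw [h2]
      simp only [mul_eq_zero, hn0.ne', hm0.ne', false_or]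
      split_ifs <;> simp
    refine ⟨mem_integers.2 fun j i hji => ?_, ?_⟩
    · rw [h1 j i (by omega), if_neg (by omega)]
    · rw [h1 0 0 (by omega), if_pos ⟨rfl, rfl⟩]
  obtain ⟨hf1, hf2⟩ := hres innerExponents f a ha ha1 (fun j i hji => by
    change j ≠ 0 ∨ i < ((1 : ℕ) : ℤ)
    omega)
  obtain ⟨hf1', hf2'⟩ := hres outerExponents f' a' ha' ha1' (fun j i hji => by
    change j < ((1 : ℕ) : ℤ)
    omega)
  have hSL : a * a' ∈ SL1 (LaurentSeries₂ κ) B := by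
    have h1 := mul_mem (inv_mem (commutator_le_SL1 _ _ hcomm)) hd
    rwa [inv_div, div_mul_cancel] at h1
  have hpow := M.pow_eq_one_of_mem_SL1 hSL hff
  -- A root of unity of order dividing `nm` with residue `1`: the geometric sum `1 + F + ⋯ + F ^ (nm
  -- - 1)` has residue `nm ≠ 0`, so in `F ^ (nm) - 1 = 0` the factor `F - 1` must vanish.
  have hone : f * f' = 1 := by
    let F : integers κ := ⟨f * f', mul_mem hf1 hf1'⟩
    have hF : res κ F = 1 := by
      rw [res_apply, c_zero_mul hf1 hf1', hf2, hf2', one_mul]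
    have hFp : F ^ (n * m) = 1 := Subtype.ext hpow
    have hg := geom_sum_mul F (n * m)
    rw [hFp, sub_self] at hg
    have hg' := congrArg (Subring.subtype _) hg
    rw [map_mul, map_zero] at hg'
    rcases mul_eq_zero.1 hg' with h0 | h0
    · exfalso
      have h1 : (∑ k ∈ Finset.range (n * m), F ^ k) = 0 := Subtype.ext h0
      have h2 := congrArg (res κ) h1
      rw [map_sum, map_zero] at h2
      simp only [map_pow, hF, one_pow, Finset.sum_const, Finset.card_range, nsmul_eq_mul,
        mul_one, Nat.cast_mul] at h2
      exact mul_ne_zero hn hm h2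
    · exact sub_eq_zero.1 h0
  have haa : a * a' = 1 := Units.ext (by rw [hff, hone, map_one, Units.val_one])
  rwa [haa, div_one] at hcomm

/-- The kernel of the leading coefficient map on elements of reduced norm `1`. -/
theorem mem_commutator_of_leading_eq_one (hn : (n : κ) ≠ 0) (hm : (m : κ) ≠ 0) {d : Bˣ}
    (hd : d ∈ SL1 (LaurentSeries₂ κ) B) (h : M.leading d = 1) : d ∈ commutator Bˣ := by
  obtain ⟨⟨j, i, a⟩, hl⟩ := exists_hasLeading_unit (M := M) d
  obtain ⟨hj, hi, -⟩ := hl.norm_eq_one hd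
  dsimp only at hj hi hl
  subst hj hi
  rw [leading_eq hl, QuotientGroup.eq_one_iff] at h
  -- The leading coefficient `a` lies in the subgroup of the `g(a) / a`, so multiplication by `a⁻¹`
  -- is multiplication by a product of commutators and makes it `1`.
  have h1 := M.unitι_mem_commutator (inv_mem h)
  have h2 := (hasLeading_ι (M := M) (a⁻¹ : Eˣ).ne_zero).mul hl
  rw [zpow_zero, zpow_zero, mul_one, AlgEquiv.one_apply, Units.inv_mul, add_zero] at h2
  have h3 := M.mem_commutator_of_hasLeading hn hm (mul_mem (commutator_le_SL1 _ _ h1) hd) h2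
  rwa [Subgroup.mul_mem_cancel_left _ h1] at h3

end SplitModel
end

noncomputable section

/-! ### Cyclic algebras -/

namespace CyclicAlgebra

section

variable {k F : Type*} [CommRing k] [CommRing F] [Algebra k F] (ρ : F ≃ₐ[k] F) (z : k)

/-- The quotient map from the free algebra. -/
def mk : FreeAlgebra k (Option F) →ₐ[k] CyclicAlgebra ρ z := RingQuot.mkAlgHom k _

theorem mk_surjective : Function.Surjective (mk ρ z) := RingQuot.mkAlgHom_surjective k _

variable {ρ z} in
theorem mk_eq {x y : FreeAlgebra k (Option F)} (h : Rel ρ z x y) : mk ρ z x = mk ρ z y :=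
  RingQuot.mkAlgHom_rel k h

/-- The inclusion of `F` in the cyclic algebra `(F/k, ρ, z)`. -/
def of : F →ₐ[k] CyclicAlgebra ρ z where
  toFun c := mk ρ z (FreeAlgebra.ι k (some c))
  map_one' := by
    have := mk_eq (Rel.scalar (σ := ρ) (z := z) 1)
    rwa [map_one, map_one, map_one] at this
  map_mul' c d := by rw [mk_eq (.mul c d), map_mul]
  map_zero' := by
    have := mk_eq (Rel.scalar (σ := ρ) (z := z) 0)
    rwa [map_zero, map_zero, map_zero] at this
  map_add' c d := by rw [mk_eq (.add c d), map_add]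
  commutes' r := by rw [mk_eq (.scalar r), AlgHom.commutes]

/-- The generator `u` of the cyclic algebra `(F/k, ρ, z)`. -/
def gen : CyclicAlgebra ρ z := mk ρ z (FreeAlgebra.ι k none)

theorem gen_mul_of (c : F) : gen ρ z * of ρ z c = of ρ z (ρ c) * gen ρ z := by
  have := mk_eq (Rel.conj (σ := ρ) (z := z) c)
  rwa [map_mul, map_mul] at this

theorem gen_pow : gen ρ z ^ Module.finrank k F = algebraMap k _ z := by
  have := mk_eq (Rel.pow (σ := ρ) (z := z))
  rwa [map_pow, AlgHom.commutes] at this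

variable {ρ z}

theorem eq_top_of_mem {T : Subalgebra k (CyclicAlgebra ρ z)} (h1 : ∀ c, of ρ z c ∈ T)
    (h2 : gen ρ z ∈ T) : T = ⊤ := by
  refine SetLike.ext fun x => iff_of_true ?_ Algebra.mem_top
  obtain ⟨x, rfl⟩ := mk_surjective ρ z x
  induction x with
  | grade0 r =>
    rw [AlgHom.commutes]
    exact T.algebraMap_mem r
  | grade1 c =>
    cases c with
    | none => exact h2
    | some c => exact h1 c
  | mul x y hx hy =>
    rw [map_mul]
    exact T.mul_mem hx hy
  | add x y hx hy =>
    rw [map_add]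
    exact T.add_mem hx hy

theorem commute_of_commute {C : Type*} [Ring C] [Algebra k C] (g : CyclicAlgebra ρ z →ₐ[k] C) {y : C}
    (h1 : ∀ c, Commute (g (of ρ z c)) y) (h2 : Commute (g (gen ρ z)) y) (a : CyclicAlgebra ρ z) :
    Commute (g a) y := by
  have h := eq_top_of_mem (T := (Subalgebra.centralizer k {y}).comap g)
    (fun c => by
      rw [Subalgebra.mem_comap, Subalgebra.mem_centralizer_iff]
      rintro _ rfl
      exact (h1 c).symm) (by
      rw [Subalgebra.mem_comap, Subalgebra.mem_centralizer_iff]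
      rintro _ rfl
      exact h2.symm)
  have h3 : a ∈ (Subalgebra.centralizer k {y}).comap g := h ▸ Algebra.mem_top
  exact ((Subalgebra.mem_centralizer_iff k).1 h3 y rfl).symm

/-- The homomorphism from a cyclic algebra given by the images of `F` and `u`. -/
def lift {C : Type*} [Ring C] [Algebra k C] (f : F →ₐ[k] C) (b : C)
    (h1 : ∀ c, b * f c = f (ρ c) * b) (h2 : b ^ Module.finrank k F = algebraMap k C z) :
    CyclicAlgebra ρ z →ₐ[k] C :=
  RingQuot.liftAlgHom k ⟨FreeAlgebra.lift k fun o => o.elim b f, by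
    intro x y h
    induction h with
    | add c d => simp
    | mul c d => simp
    | scalar r => simp
    | conj c => simpa using h1 c
    | pow => simpa using h2⟩

variable {C : Type*} [Ring C] [Algebra k C] (f : F →ₐ[k] C) (b : C)
    (h1 : ∀ c, b * f c = f (ρ c) * b) (h2 : b ^ Module.finrank k F = algebraMap k C z)

theorem lift_of (c : F) : lift f b h1 h2 (of ρ z c) = f c := by
  refine (RingQuot.liftAlgHom_mkAlgHom_apply k _ _ _).trans ?_
  simp

theorem lift_gen : lift f b h1 h2 (gen ρ z) = b := by
  refine (RingQuot.liftAlgHom_mkAlgHom_apply k _ _ _).trans ?_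
  simp

end

section Field

variable {k F : Type*} [Field k] [Field F] [Algebra k F] [FiniteDimensional k F] (ρ : F ≃ₐ[k] F)
  {z : k} (hz : z ≠ 0)

/-- The generator `u` as a unit. -/
def genUnit : (CyclicAlgebra ρ z)ˣ where
  val := gen ρ z
  inv := gen ρ z ^ (Module.finrank k F - 1) * algebraMap k _ z⁻¹
  val_inv := by
    rw [← mul_assoc, ← pow_succ', Nat.sub_add_cancel Module.finrank_pos, gen_pow, ← map_mul,
      mul_inv_cancel₀ hz, map_one]
  inv_val := by
    rw [mul_assoc, Algebra.commutes, ← mul_assoc, ← pow_succ,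
      Nat.sub_add_cancel Module.finrank_pos, gen_pow, ← map_mul, mul_inv_cancel₀ hz, map_one]

variable (z) in
/-- The map sending `(c_i)` to `∑ c_i u ^ i`. -/
def sumMap : (Fin (Module.finrank k F) → F) →ₗ[k] CyclicAlgebra ρ z :=
  ∑ i : Fin (Module.finrank k F), ((LinearMap.mulRight k (gen ρ z ^ (i : ℕ))).comp (of ρ z).toLinearMap).comp
    (LinearMap.proj i)

theorem sumMap_apply (a : Fin (Module.finrank k F) → F) :
    sumMap ρ z a = ∑ i, of ρ z (a i) * gen ρ z ^ (i : ℕ) := by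
  simp [sumMap]

theorem of_mul_gen_pow_mem (c : F) {i : ℕ} (hi : i < Module.finrank k F) :
    of ρ z c * gen ρ z ^ i ∈ LinearMap.range (sumMap ρ z) := by
  classical
  refine ⟨Pi.single ⟨i, hi⟩ c, ?_⟩
  rw [sumMap_apply, Finset.sum_eq_single ⟨i, hi⟩]
  · simp
  · intro j _ hj
    simp [Pi.single_eq_of_ne hj]
  · simp

/-- The elements that map the span of the `c u ^ i` to itself by left multiplication form a
subalgebra. It contains the generators, so it is everything, and `1` lies in the span. -/
theorem sumMap_surjective : Function.Surjective (sumMap ρ z) := by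
  rw [← LinearMap.range_eq_top]
  set S := LinearMap.range (sumMap ρ z) with hS
  let T : Subalgebra k (CyclicAlgebra ρ z) :=
    { carrier := {a | ∀ s ∈ S, a * s ∈ S}
      mul_mem' := fun {a b} ha hb s hs => by
        rw [mul_assoc]
        exact ha _ (hb s hs)
      add_mem' := fun {a b} ha hb s hs => by
        rw [add_mul]
        exact add_mem (ha s hs) (hb s hs)
      algebraMap_mem' := fun r s hs => by
        rw [← Algebra.smul_def]
        exact S.smul_mem r hs }
  have hT : ∀ a, (∀ (c : F) (i : ℕ), i < Module.finrank k F → a * (of ρ z c * gen ρ z ^ i) ∈ S) →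
      a ∈ T := by
    rintro a ha _ ⟨x, rfl⟩
    rw [sumMap_apply, Finset.mul_sum]
    exact sum_mem fun i _ => ha _ _ i.2
  have h1 : T = ⊤ := by
    refine eq_top_of_mem (fun c => hT _ fun d i hi => ?_) (hT _ fun d i hi => ?_)
    · rw [← mul_assoc, ← map_mul]
      exact of_mul_gen_pow_mem ρ _ hi
    · rw [← mul_assoc, gen_mul_of, mul_assoc, ← pow_succ']
      rcases (Nat.succ_le_of_lt hi).lt_or_eq with h | h
      · exact of_mul_gen_pow_mem ρ _ h
      -- At the top power, `u ^ n` wraps around to the scalar `z`, and the exponent returns to `0`.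
      · rw [← Nat.succ_eq_add_one, h, gen_pow, ← Algebra.commutes, ← Algebra.smul_def, ← map_smul]
        have := of_mul_gen_pow_mem (z := z) ρ (z • ρ d) (Module.finrank_pos (R := k) (M := F))
        rwa [pow_zero, mul_one] at this
  rw [eq_top_iff]
  intro a _
  have ha : a ∈ T := h1 ▸ Algebra.mem_top
  have h2 := ha 1 (by
    have := of_mul_gen_pow_mem (z := z) ρ 1 (Module.finrank_pos (R := k) (M := F))
    rwa [pow_zero, mul_one, map_one] at this)
  rwa [mul_one] at h2

instance finite : Module.Finite k (CyclicAlgebra ρ z) :=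
  Module.Finite.of_surjective _ (sumMap_surjective ρ)

/-- An upper bound is enough here: the lower bound for the tensor product comes from its action on
Laurent series. -/
theorem finrank_le : Module.finrank k (CyclicAlgebra ρ z) ≤ Module.finrank k F ^ 2 := by
  refine (LinearMap.finrank_le_finrank_of_surjective (sumMap_surjective ρ)).trans ?_
  rw [Module.finrank_pi_fintype, Finset.sum_const, Finset.card_univ, Fintype.card_fin, sq,
    smul_eq_mul]

end Field

end CyclicAlgebra

/-! ### Extension of scalars to rational functions -/

section RatFunc

section

attribute [local instance] MvPolynomial.algebraMvPolynomial FractionRing.liftAlgebra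

/-- The algebra structure of `K(x, y)` over `κ(x, y)`. -/
abbrev RatFunc₂.algebra (κ : Type u) (K : Type v) [Field κ] [Field K] [Algebra κ K] :
    Algebra (RatFunc₂ κ) (RatFunc₂ K) := inferInstance

end

variable {κ : Type u} {K : Type v} [Field κ] [Field K] [Algebra κ K]

section

attribute [local instance] MvPolynomial.algebraMvPolynomial FractionRing.liftAlgebra

/-- For `K` finite over `κ`, the field `K(x, y)` is the tensor product of `κ(x, y)` and `K`. -/
theorem RatFunc₂.finrank_eq [FiniteDimensional κ K] :
    Module.finrank (RatFunc₂ κ) (RatFunc₂ K) = Module.finrank κ K := by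
  rw [← (Algebra.IsPushout.equiv κ (RatFunc₂ κ) K (RatFunc₂ K)).toLinearEquiv.finrank_eq,
    Module.finrank_baseChange]

instance RatFunc₂.finiteDimensional [FiniteDimensional κ K] :
    FiniteDimensional (RatFunc₂ κ) (RatFunc₂ K) :=
  Module.Finite.equiv (Algebra.IsPushout.equiv κ (RatFunc₂ κ) K (RatFunc₂ K)).toLinearEquiv

/-- Ring homomorphisms from `κ(x, y)` to a field are determined by the images of `κ`, `x`, `y`. -/
theorem RatFunc₂.ringHom_ext {A : Type*} [CommRing A] {f g : RatFunc₂ κ →+* A}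
    (h : ∀ c : κ, f (algebraMap κ _ c) = g (algebraMap κ _ c)) (hx : f (RatFunc₂.x κ) = g (RatFunc₂.x κ))
    (hy : f (RatFunc₂.y κ) = g (RatFunc₂.y κ)) : f = g := by
  refine IsLocalization.ringHom_ext (nonZeroDivisors (MvPolynomial (Fin 2) κ)) ?_
  refine MvPolynomial.ringHom_ext (fun c => ?_) (fun i => ?_)
  · exact h c
  · fin_cases i
    · exact hx
    · exact hy

theorem RatFunc₂.algebraMap_poly (p : MvPolynomial (Fin 2) κ) :
    algebraMap (RatFunc₂ κ) (RatFunc₂ K) (algebraMap _ _ p) =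
      algebraMap (MvPolynomial (Fin 2) K) _ (p.map (algebraMap κ K)) := by
  rw [← IsScalarTower.algebraMap_apply (MvPolynomial (Fin 2) κ),
    IsScalarTower.algebraMap_apply (MvPolynomial (Fin 2) κ) (MvPolynomial (Fin 2) K)]
  rfl

theorem RatFunc₂.algebraMap_C (c : κ) :
    algebraMap κ (RatFunc₂ κ) c = algebraMap (MvPolynomial (Fin 2) κ) _ (MvPolynomial.C c) :=
  IsScalarTower.algebraMap_apply κ (MvPolynomial (Fin 2) κ) (RatFunc₂ κ) c

theorem RatFunc₂.algebraMap_algebraMap (c : κ) :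
    algebraMap (RatFunc₂ κ) (RatFunc₂ K) (algebraMap κ _ c) = algebraMap K _ (algebraMap κ K c) := by
  rw [algebraMap_C, algebraMap_C, algebraMap_poly, MvPolynomial.map_C]

theorem RatFunc₂.algebraMap_x :
    algebraMap (RatFunc₂ κ) (RatFunc₂ K) (RatFunc₂.x κ) = RatFunc₂.x K := by
  rw [x, algebraMap_poly, MvPolynomial.map_X, x]

theorem RatFunc₂.algebraMap_y :
    algebraMap (RatFunc₂ κ) (RatFunc₂ K) (RatFunc₂.y κ) = RatFunc₂.y K := by
  rw [y, algebraMap_poly, MvPolynomial.map_X, y]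

theorem RatFunc₂.extend_algebraMap (ρ : K ≃ₐ[κ] K) (c : K) :
    RatFunc₂.extend ρ (algebraMap K _ c) = algebraMap K _ (ρ c) := by
  rw [algebraMap_C, algebraMap_C, extend, IsFractionRing.fieldEquivOfAlgEquiv_algebraMap]
  congr 1
  exact MvPolynomial.map_C _ _

end

attribute [local instance] RatFunc₂.algebra

theorem RatFunc₂.extend_x (ρ : K ≃ₐ[κ] K) :
    RatFunc₂.extend ρ (RatFunc₂.x K) = RatFunc₂.x K := by
  rw [← algebraMap_x (κ := κ), AlgEquiv.commutes]

theorem RatFunc₂.extend_y (ρ : K ≃ₐ[κ] K) :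
    RatFunc₂.extend ρ (RatFunc₂.y K) = RatFunc₂.y K := by
  rw [← algebraMap_y (κ := κ), AlgEquiv.commutes]

theorem ratToLaurent_poly (p : MvPolynomial (Fin 2) κ) :
    ratToLaurent κ (algebraMap _ _ p) = polyToLaurent κ p :=
  IsFractionRing.lift_algebraMap (polyToLaurent_injective κ) p

theorem ratToLaurent_algebraMap (c : κ) :
    ratToLaurent κ (algebraMap κ _ c) = DoubleLaurent.mono 0 0 c := by
  rw [RatFunc₂.algebraMap_C, ratToLaurent_poly, polyToLaurent, MvPolynomial.coe_eval₂Hom,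
    MvPolynomial.eval₂_C]
  rfl

theorem ratToLaurent_x : ratToLaurent κ (RatFunc₂.x κ) = DoubleLaurent.mono 0 1 1 := by
  rw [RatFunc₂.x, ratToLaurent_poly, polyToLaurent, MvPolynomial.coe_eval₂Hom,
    MvPolynomial.eval₂_X]
  rfl

theorem ratToLaurent_y : ratToLaurent κ (RatFunc₂.y κ) = DoubleLaurent.mono 1 0 1 := by
  rw [RatFunc₂.y, ratToLaurent_poly, polyToLaurent, MvPolynomial.coe_eval₂Hom,
    MvPolynomial.eval₂_X]
  rfl

end RatFunc
end

noncomputable section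

/-! ### Automorphisms of a compositum of linearly disjoint extensions -/

section Compositum

open DoubleLaurent

variable {κ : Type u} {E : Type v} [Field κ] [Field E] [Algebra κ E] [FiniteDimensional κ E]
  {K L : IntermediateField κ E}

theorem IntermediateField.LinearDisjoint.finrank_eq_mul (hdisj : K.LinearDisjoint L)
    (hcomp : K ⊔ L = ⊤) : Module.finrank κ E = Module.finrank κ K * Module.finrank κ L := by
  rw [← hdisj.finrank_sup, hcomp, IntermediateField.finrank_top']

theorem isGalois_of_sup_eq_top [IsGalois κ K] [IsGalois κ L] (hcomp : K ⊔ L = ⊤) : IsGalois κ E := by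
  have h : IsGalois κ (K ⊔ L : IntermediateField κ E) := inferInstance
  rw [hcomp] at h
  exact IsGalois.of_algEquiv IntermediateField.topEquiv

/-- The isomorphism `K ⊗ L ≃ E`. -/
def compositumEquiv (hdisj : K.LinearDisjoint L) (hcomp : K ⊔ L = ⊤) : K ⊗[κ] L ≃ₐ[κ] E :=
  AlgEquiv.ofBijective (Algebra.TensorProduct.productMap K.val L.val) (by
    have h1 : Function.Injective (Algebra.TensorProduct.productMap K.val L.val) :=
      Subalgebra.linearDisjoint_iff_injective.1 (IntermediateField.linearDisjoint_iff'.1 hdisj)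
    refine ⟨h1, (LinearMap.injective_iff_surjective_of_finrank_eq_finrank
      (f := (Algebra.TensorProduct.productMap K.val L.val).toLinearMap) ?_).1 h1⟩
    rw [Module.finrank_tensorProduct, hdisj.finrank_eq_mul hcomp])

theorem compositumEquiv_tmul (hdisj : K.LinearDisjoint L) (hcomp : K ⊔ L = ⊤) (a : K) (b : L) :
    compositumEquiv hdisj hcomp (a ⊗ₜ b) = a * b :=
  Algebra.TensorProduct.productMap_apply_tmul K.val L.val a b

theorem compositum_induction (hdisj : K.LinearDisjoint L) (hcomp : K ⊔ L = ⊤) {p : E → Prop}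
    (h : ∀ (a : K) (b : L), p (a * b)) (hadd : ∀ x y, p x → p y → p (x + y)) (e : E) : p e := by
  obtain ⟨t, rfl⟩ := (compositumEquiv hdisj hcomp).surjective e
  induction t with
  | zero => simpa using h 0 0
  | tmul a b =>
    rw [compositumEquiv_tmul]
    exact h a b
  | add x y hx hy =>
    rw [map_add]
    exact hadd _ _ hx hy

/-- The automorphism of `E = KL` acting as `σ` on `K` and as `τ` on `L`. -/
def compositumAut (hdisj : K.LinearDisjoint L) (hcomp : K ⊔ L = ⊤) (σ : K ≃ₐ[κ] K)
    (τ : L ≃ₐ[κ] L) : E ≃ₐ[κ] E :=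
  ((compositumEquiv hdisj hcomp).symm.trans (Algebra.TensorProduct.congr σ τ)).trans
    (compositumEquiv hdisj hcomp)

variable (hdisj : K.LinearDisjoint L) (hcomp : K ⊔ L = ⊤)

theorem compositumAut_mul (σ : K ≃ₐ[κ] K) (τ : L ≃ₐ[κ] L) (a : K) (b : L) :
    compositumAut hdisj hcomp σ τ (a * b) = σ a * τ b := by
  rw [← compositumEquiv_tmul hdisj hcomp, compositumAut, AlgEquiv.trans_apply, AlgEquiv.trans_apply,
    AlgEquiv.symm_apply_apply, Algebra.TensorProduct.congr_apply, Algebra.TensorProduct.map_tmul,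
    compositumEquiv_tmul]
  rfl

theorem compositumAut_left (σ : K ≃ₐ[κ] K) (τ : L ≃ₐ[κ] L) (a : K) :
    compositumAut hdisj hcomp σ τ a = σ a := by
  simpa using compositumAut_mul hdisj hcomp σ τ a 1

theorem compositumAut_right (σ : K ≃ₐ[κ] K) (τ : L ≃ₐ[κ] L) (b : L) :
    compositumAut hdisj hcomp σ τ b = τ b := by
  simpa using compositumAut_mul hdisj hcomp σ τ 1 b

theorem compositum_ext {g g' : E ≃ₐ[κ] E} (h1 : ∀ a : K, g a = g' a) (h2 : ∀ b : L, g b = g' b)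
    (hdisj : K.LinearDisjoint L) (hcomp : K ⊔ L = ⊤) : g = g' := by
  refine AlgEquiv.ext fun e => ?_
  induction e using compositum_induction hdisj hcomp with
  | h a b => rw [map_mul, map_mul, h1, h2]
  | hadd x y hx hy => rw [map_add, map_add, hx, hy]

/-- `Gal(K/κ) × Gal(L/κ) → Gal(E/κ)`. -/
def compositumAutHom : (K ≃ₐ[κ] K) × (L ≃ₐ[κ] L) →* (E ≃ₐ[κ] E) where
  toFun p := compositumAut hdisj hcomp p.1 p.2
  map_one' := compositum_ext (fun a => by rw [compositumAut_left]; rfl)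
    (fun a => by rw [compositumAut_right]; rfl) hdisj hcomp
  map_mul' p q := compositum_ext
    (fun a => by
      rw [compositumAut_left, AlgEquiv.mul_apply, compositumAut_left, compositumAut_left]
      rfl)
    (fun a => by
      rw [compositumAut_right, AlgEquiv.mul_apply, compositumAut_right, compositumAut_right]
      rfl) hdisj hcomp

theorem compositumAutHom_injective : Function.Injective (compositumAutHom hdisj hcomp) := by
  rintro ⟨σ, τ⟩ ⟨σ', τ'⟩ h
  refine Prod.ext (AlgEquiv.ext fun a => Subtype.ext ?_) (AlgEquiv.ext fun a => Subtype.ext ?_)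
  · exact (compositumAut_left hdisj hcomp σ τ a).symm.trans
      ((DFunLike.congr_fun h (a : E)).trans (compositumAut_left hdisj hcomp σ' τ' a))
  · exact (compositumAut_right hdisj hcomp σ τ a).symm.trans
      ((DFunLike.congr_fun h (a : E)).trans (compositumAut_right hdisj hcomp σ' τ' a))

theorem compositumAutHom_surjective [IsGalois κ K] [IsGalois κ L] :
    Function.Surjective (compositumAutHom hdisj hcomp) := by
  intro g
  refine ⟨(g.restrictNormal K, g.restrictNormal L), compositum_ext (fun a => ?_) (fun a => ?_)
    hdisj hcomp⟩
  · exact (compositumAut_left hdisj hcomp _ _ a).trans (g.restrictNormal_commutes K a)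
  · exact (compositumAut_right hdisj hcomp _ _ a).trans (g.restrictNormal_commutes L a)

/-- Linear disjointness identifies `Gal(E/κ)` with the product of the two Galois groups, in which
the generators have orders `[K : κ]` and `[L : κ]`. -/
theorem isBicyclic_compositumAut [IsGalois κ K] [IsGalois κ L] {σ : K ≃ₐ[κ] K} {τ : L ≃ₐ[κ] L}
    (hσ : ∀ g : K ≃ₐ[κ] K, g ∈ Subgroup.zpowers σ) (hτ : ∀ g : L ≃ₐ[κ] L, g ∈ Subgroup.zpowers τ) :
    IsBicyclic (compositumAut hdisj hcomp σ 1) (compositumAut hdisj hcomp 1 τ)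
      (Module.finrank κ K) (Module.finrank κ L) := by
  have h : ∀ j i : ℤ, compositumAut hdisj hcomp σ 1 ^ i * compositumAut hdisj hcomp 1 τ ^ j =
      compositumAutHom hdisj hcomp (σ ^ i, τ ^ j) := by
    intro j i
    have h1 : ((σ ^ i, τ ^ j) : (K ≃ₐ[κ] K) × (L ≃ₐ[κ] L)) = (σ, 1) ^ i * (1, τ) ^ j := by
      simp
    rw [h1, map_mul, map_zpow, map_zpow]
    rfl
  refine ⟨?_, fun j i => ?_, fun g => ?_⟩
  · change compositumAutHom hdisj hcomp (σ, 1) * compositumAutHom hdisj hcomp (1, τ) =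
      compositumAutHom hdisj hcomp (1, τ) * compositumAutHom hdisj hcomp (σ, 1)
    rw [← map_mul, ← map_mul]
    simp
  · rw [h, map_eq_one_iff _ (compositumAutHom_injective hdisj hcomp), Prod.mk_eq_one,
      ← orderOf_dvd_iff_zpow_eq_one, ← orderOf_dvd_iff_zpow_eq_one,
      orderOf_eq_card_of_forall_mem_zpowers hσ, orderOf_eq_card_of_forall_mem_zpowers hτ,
      IsGalois.card_aut_eq_finrank, IsGalois.card_aut_eq_finrank, and_comm]
  · obtain ⟨⟨a, b⟩, rfl⟩ := compositumAutHom_surjective hdisj hcomp g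
    obtain ⟨i, rfl⟩ := hσ a
    obtain ⟨j, rfl⟩ := hτ b
    exact ⟨j, i, h j i⟩

end Compositum
end

noncomputable section

/-! ### The action of the tensor product of cyclic algebras on iterated Laurent series -/

section Action

open DoubleLaurent

attribute [local instance] RatFunc₂.algebra

section Shift

variable {κ E : Type*} [Field κ] [Field E] [Algebra κ E]

/-- The operator `h ↦ Y ^ j X ^ i g(h)`. -/
def shiftFun (j i : ℤ) (g : E ≃ₐ[κ] E) : LaurentSeries₂ E →+ LaurentSeries₂ E :=
  (AddMonoidHom.mulLeft (mono j i 1)).comp (map (g : E →+* E)).toAddMonoidHom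

theorem shiftFun_apply (j i : ℤ) (g : E ≃ₐ[κ] E) (h : LaurentSeries₂ E) :
    shiftFun j i g h = mono j i 1 * map (g : E →+* E) h := rfl

theorem shiftFun_mul (j i : ℤ) (g : E ≃ₐ[κ] E) (h h' : LaurentSeries₂ E) :
    shiftFun j i g (h * h') = map (g : E →+* E) h * shiftFun j i g h' := by
  rw [shiftFun_apply, shiftFun_apply, map_mul, mul_left_comm]

theorem shiftFun_shiftFun (j i j' i' : ℤ) (g g' : E ≃ₐ[κ] E) (h : LaurentSeries₂ E) :
    shiftFun j i g (shiftFun j' i' g' h) = shiftFun (j + j') (i + i') (g * g') h := by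
  rw [shiftFun_apply, shiftFun_apply, shiftFun_apply, map_mul, map_mono, map_one, ← mul_assoc,
    mono_mul_mono, one_mul]
  rfl

theorem shiftFun_one (h : LaurentSeries₂ E) : shiftFun 0 0 (1 : E ≃ₐ[κ] E) h = h := by
  rw [shiftFun_apply, mono_zero_one, one_mul]
  rfl

end Shift

variable (κ : Type u) (E : Type v) [Field κ] [Field E] [Algebra κ E] (n m : ℕ) [NeZero n] [NeZero m]

/-- The embedding of `κ((x))((y))` in `E((X))((Y))` with `x = X ^ n` and `y = Y ^ m`. -/
def laurentEmbedding : LaurentSeries₂ κ →+* LaurentSeries₂ E :=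
  (map (algebraMap κ E)).comp (scale κ n m)

/-- The ring `E((X))((Y))` as an algebra over `κ((x))((y))`, with `x = X ^ n` and `y = Y ^ m`. -/
def LaurentModule : Type v :=
  have _ := κ
  have _ := n
  have _ := m
  LaurentSeries₂ E

instance : CommRing (LaurentModule κ E n m) := inferInstanceAs (CommRing (LaurentSeries₂ E))

instance : Algebra (RatFunc₂ κ) (LaurentModule κ E n m) :=
  RingHom.toAlgebra (((laurentEmbedding κ E n m).comp (ratToLaurent κ) :
    RatFunc₂ κ →+* LaurentSeries₂ E) : RatFunc₂ κ →+* LaurentModule κ E n m)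

/-- The embedding of `κ((x))((y))` in `E((X))((Y))` over `κ(x, y)`. -/
def LaurentModule.ofLaurent : LaurentSeries₂ κ →ₐ[RatFunc₂ κ] LaurentModule κ E n m where
  toRingHom := laurentEmbedding κ E n m
  commutes' _ := rfl

variable {κ E}

/-- The operator `h ↦ Y ^ j X ^ i g(h)`. -/
def shiftAut (j i : ℤ) (g : E ≃ₐ[κ] E) : Module.End (RatFunc₂ κ) (LaurentModule κ E n m) where
  toFun := shiftFun j i g
  map_add' := map_add (shiftFun j i g)
  map_smul' f h := by
    refine (shiftFun_mul j i g (laurentEmbedding κ E n m (ratToLaurent κ f)) h).trans ?_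
    rw [laurentEmbedding, RingHom.comp_apply, map_algebraMap_map]
    rfl

theorem shiftAut_mul (j i j' i' : ℤ) (g g' : E ≃ₐ[κ] E) :
    shiftAut n m j i g * shiftAut n m j' i' g' = shiftAut n m (j + j') (i + i') (g * g') :=
  LinearMap.ext fun h => shiftFun_shiftFun j i j' i' g g' h

theorem shiftAut_one : shiftAut n m 0 0 (1 : E ≃ₐ[κ] E) = 1 :=
  LinearMap.ext fun h => shiftFun_one (κ := κ) h

theorem shiftAut_pow (j i : ℤ) (g : E ≃ₐ[κ] E) (r : ℕ) :
    shiftAut n m j i g ^ r = shiftAut n m (r * j) (r * i) (g ^ r) := by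
  induction r with
  | zero => rw [pow_zero, pow_zero, Nat.cast_zero, zero_mul, zero_mul, shiftAut_one]
  | succ r ih =>
    rw [pow_succ, ih, shiftAut_mul, pow_succ]
    push_cast
    rw [add_mul, add_mul, one_mul, one_mul]

section

variable {K : Type w} [Field K] [Algebra κ K] [Algebra K E] [IsScalarTower κ K E]

/-- The embedding of `K(x, y)` in `E((X))((Y))`. -/
def ratEmbedding (K : Type w) [Field K] [Algebra K E] : RatFunc₂ K →+* LaurentSeries₂ E :=
  (laurentEmbedding K E n m).comp (ratToLaurent K)

theorem ratEmbedding_algebraMap (c : K) :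
    ratEmbedding (E := E) n m K (algebraMap K _ c) = mono 0 0 (algebraMap K E c) := by
  rw [ratEmbedding, laurentEmbedding, RingHom.comp_apply, ratToLaurent_algebraMap,
    RingHom.comp_apply, scale_mono, map_mono, mul_zero, mul_zero]

theorem ratEmbedding_x : ratEmbedding (E := E) n m K (RatFunc₂.x K) = mono 0 n 1 := by
  rw [ratEmbedding, laurentEmbedding, RingHom.comp_apply, ratToLaurent_x, RingHom.comp_apply,
    scale_mono, map_mono, mul_zero, mul_one, map_one]

theorem ratEmbedding_y : ratEmbedding (E := E) n m K (RatFunc₂.y K) = mono m 0 1 := by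
  rw [ratEmbedding, laurentEmbedding, RingHom.comp_apply, ratToLaurent_y, RingHom.comp_apply,
    scale_mono, map_mono, mul_zero, mul_one, map_one]

theorem ratEmbedding_comp :
    (ratEmbedding (E := E) n m K).comp (algebraMap (RatFunc₂ κ) (RatFunc₂ K)) =
      ratEmbedding n m κ := by
  refine RatFunc₂.ringHom_ext (fun c => ?_) ?_ ?_
  · rw [RingHom.comp_apply, RatFunc₂.algebraMap_algebraMap, ratEmbedding_algebraMap,
      ratEmbedding_algebraMap, ← IsScalarTower.algebraMap_apply]
  · rw [RingHom.comp_apply, RatFunc₂.algebraMap_x, ratEmbedding_x, ratEmbedding_x]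
  · rw [RingHom.comp_apply, RatFunc₂.algebraMap_y, ratEmbedding_y, ratEmbedding_y]

theorem map_ratEmbedding (g : E ≃ₐ[κ] E) (ρ : K ≃ₐ[κ] K)
    (hg : ∀ c, g (algebraMap K E c) = algebraMap K E (ρ c)) (f : RatFunc₂ K) :
    map (g : E →+* E) (ratEmbedding n m K f) = ratEmbedding n m K (RatFunc₂.extend ρ f) := by
  refine RingHom.congr_fun (RatFunc₂.ringHom_ext (f := RingHom.comp (map (g : E →+* E))
    (ratEmbedding n m K)) (g := RingHom.comp (ratEmbedding n m K)
      (RatFunc₂.extend ρ : RatFunc₂ K →+* RatFunc₂ K)) (fun c => ?_) ?_ ?_) f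
  · rw [RingHom.comp_apply, RingHom.comp_apply, RingHom.coe_coe, RatFunc₂.extend_algebraMap,
      ratEmbedding_algebraMap, ratEmbedding_algebraMap, map_mono, ← hg]
    rfl
  · rw [RingHom.comp_apply, RingHom.comp_apply, RingHom.coe_coe, RatFunc₂.extend_x,
      ratEmbedding_x, map_mono, map_one]
  · rw [RingHom.comp_apply, RingHom.comp_apply, RingHom.coe_coe, RatFunc₂.extend_y,
      ratEmbedding_y, map_mono, map_one]

theorem map_ratEmbedding_of_fixed (g : E ≃ₐ[κ] E)
    (hg : ∀ c, g (algebraMap K E c) = algebraMap K E c) (f : RatFunc₂ K) :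
    map (g : E →+* E) (ratEmbedding n m K f) = ratEmbedding n m K f := by
  refine RingHom.congr_fun (RatFunc₂.ringHom_ext (f := RingHom.comp (map (g : E →+* E))
    (ratEmbedding n m K)) (g := ratEmbedding n m K) (fun c => ?_) ?_ ?_) f
  · rw [RingHom.comp_apply, ratEmbedding_algebraMap, map_mono]
    exact congrArg _ (hg c)
  · rw [RingHom.comp_apply, ratEmbedding_x, map_mono, map_one]
  · rw [RingHom.comp_apply, ratEmbedding_y, map_mono, map_one]

/-- Multiplication by elements of `K(x, y)` on `E((X))((Y))`. -/
def ratMul (K : Type w) [Field K] [Algebra κ K] [Algebra K E] [IsScalarTower κ K E] :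
    RatFunc₂ K →ₐ[RatFunc₂ κ] Module.End (RatFunc₂ κ) (LaurentModule κ E n m) :=
  (Algebra.lmul (RatFunc₂ κ) (LaurentModule κ E n m)).comp
    { toRingHom := ratEmbedding (E := E) n m K
      commutes' := fun f => RingHom.congr_fun (ratEmbedding_comp (E := E) n m) f }

theorem shiftAut_mul_ratMul (j i : ℤ) (g : E ≃ₐ[κ] E) (ρ : K ≃ₐ[κ] K)
    (hg : ∀ c, g (algebraMap K E c) = algebraMap K E (ρ c)) (f : RatFunc₂ K) :
    shiftAut n m j i g * ratMul n m K f = ratMul n m K (RatFunc₂.extend ρ f) * shiftAut n m j i g := by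
  refine LinearMap.ext fun h => ?_
  refine (shiftFun_mul j i g (ratEmbedding n m K f) h).trans ?_
  rw [map_ratEmbedding n m g ρ hg]
  rfl

theorem shiftAut_commute_ratMul (j i : ℤ) (g : E ≃ₐ[κ] E)
    (hg : ∀ c, g (algebraMap K E c) = algebraMap K E c) (f : RatFunc₂ K) :
    Commute (shiftAut n m j i g) (ratMul n m K f) := by
  refine LinearMap.ext fun h => ?_
  refine (shiftFun_mul j i g (ratEmbedding n m K f) h).trans ?_
  rw [map_ratEmbedding_of_fixed n m g hg]
  rfl

variable [FiniteDimensional κ K]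

/-- In the power the automorphism becomes trivial, and the remaining monomial is the image of `z`.
This is the relation `u ^ n = z` required of the action. -/
theorem shiftAut_pow_eq_algebraMap {z : RatFunc₂ κ} {j i : ℤ} {g : E ≃ₐ[κ] E}
    (hgr : g ^ Module.finrank κ K = 1)
    (hz : ratEmbedding (E := E) n m κ z =
      mono (Module.finrank κ K * j) (Module.finrank κ K * i) 1) :
    shiftAut n m j i g ^ Module.finrank (RatFunc₂ κ) (RatFunc₂ K) = algebraMap _ _ z := by
  rw [RatFunc₂.finrank_eq, shiftAut_pow, hgr]
  refine LinearMap.ext fun h => ?_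
  refine (shiftFun_apply _ _ _ _).trans ?_
  rw [← hz]
  rfl

variable (ρ : K ≃ₐ[κ] K) (z : RatFunc₂ κ) (j i : ℤ) (g : E ≃ₐ[κ] E)
  (hg : ∀ c, g (algebraMap K E c) = algebraMap K E (ρ c))
  (hgr : g ^ Module.finrank κ K = 1)
  (hz : ratEmbedding (E := E) n m κ z =
    mono (Module.finrank κ K * j) (Module.finrank κ K * i) 1)

/-- The action of a cyclic algebra on `E((X))((Y))`. -/
def cyclicAction : RatFuncCyclicAlgebra ρ z →ₐ[RatFunc₂ κ]
    Module.End (RatFunc₂ κ) (LaurentModule κ E n m) :=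
  CyclicAlgebra.lift (ratMul n m K) (shiftAut n m j i g) (shiftAut_mul_ratMul n m j i g ρ hg)
    (shiftAut_pow_eq_algebraMap n m hgr hz)

theorem cyclicAction_of (f : RatFunc₂ K) :
    cyclicAction n m ρ z j i g hg hgr hz (CyclicAlgebra.of _ _ f) = ratMul n m K f :=
  CyclicAlgebra.lift_of _ _ (shiftAut_mul_ratMul n m j i g ρ hg)
    (shiftAut_pow_eq_algebraMap n m hgr hz) f

theorem cyclicAction_gen :
    cyclicAction n m ρ z j i g hg hgr hz (CyclicAlgebra.gen _ _) = shiftAut n m j i g :=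
  CyclicAlgebra.lift_gen _ _ (shiftAut_mul_ratMul n m j i g ρ hg)
    (shiftAut_pow_eq_algebraMap n m hgr hz)

end

end Action
end

noncomputable section

/-! ### The tensor product of the two cyclic algebras -/

section Bicyclic

open DoubleLaurent

attribute [local instance] RatFunc₂.algebra

instance finrank_neZero {κ E : Type*} [Field κ] [Field E] [Algebra κ E] [FiniteDimensional κ E] :
    NeZero (Module.finrank κ E) := ⟨Module.finrank_pos.ne'⟩

theorem RatFunc₂.x_ne_zero (κ : Type u) [Field κ] : RatFunc₂.x κ ≠ 0 := by
  rw [RatFunc₂.x, Ne, IsFractionRing.to_map_eq_zero_iff]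
  exact MvPolynomial.X_ne_zero 0

theorem RatFunc₂.y_ne_zero (κ : Type u) [Field κ] : RatFunc₂.y κ ≠ 0 := by
  rw [RatFunc₂.y, Ne, IsFractionRing.to_map_eq_zero_iff]
  exact MvPolynomial.X_ne_zero 1

variable {κ : Type u} {E : Type v} [Field κ] [Field E] [Algebra κ E] [FiniteDimensional κ E]
  {K L : IntermediateField κ E}

/-- The algebra `(K(x, y)/k, σ, x) ⊗ (L(x, y)/k, τ, y)` over `k = κ(x, y)`. -/
abbrev BicyclicAlgebra (σ : K ≃ₐ[κ] K) (τ : L ≃ₐ[κ] L) : Type (max u v) :=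
  RatFuncCyclicAlgebra σ (RatFunc₂.x κ) ⊗[RatFunc₂ κ] RatFuncCyclicAlgebra τ (RatFunc₂.y κ)

variable (σ : K ≃ₐ[κ] K) (τ : L ≃ₐ[κ] L)

theorem finrank_bicyclicAlgebra_le : Module.finrank (RatFunc₂ κ) (BicyclicAlgebra σ τ) ≤
    (Module.finrank κ K * Module.finrank κ L) ^ 2 := by
  rw [Module.finrank_tensorProduct, mul_pow]
  have h1 := CyclicAlgebra.finrank_le (RatFunc₂.extend σ) (z := RatFunc₂.x κ)
  have h2 := CyclicAlgebra.finrank_le (RatFunc₂.extend τ) (z := RatFunc₂.y κ)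
  rw [RatFunc₂.finrank_eq] at h1 h2
  exact Nat.mul_le_mul h1 h2

/-- The generator `u` of the first factor. -/
def BicyclicAlgebra.u : (BicyclicAlgebra σ τ)ˣ :=
  Units.map (Algebra.TensorProduct.includeLeft : RatFuncCyclicAlgebra σ (RatFunc₂.x κ) →ₐ[RatFunc₂ κ]
    BicyclicAlgebra σ τ).toMonoidHom
      (CyclicAlgebra.genUnit (RatFunc₂.extend σ) (RatFunc₂.x_ne_zero κ))

/-- The generator `v` of the second factor. -/
def BicyclicAlgebra.v : (BicyclicAlgebra σ τ)ˣ :=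
  Units.map (Algebra.TensorProduct.includeRight :
    RatFuncCyclicAlgebra τ (RatFunc₂.y κ) →ₐ[RatFunc₂ κ] BicyclicAlgebra σ τ).toMonoidHom
      (CyclicAlgebra.genUnit (RatFunc₂.extend τ) (RatFunc₂.y_ne_zero κ))

/-- The embedding of `K` in the first factor. -/
def BicyclicAlgebra.ofLeft : K →+* BicyclicAlgebra σ τ :=
  (Algebra.TensorProduct.includeLeft : RatFuncCyclicAlgebra σ (RatFunc₂.x κ) →ₐ[RatFunc₂ κ]
    BicyclicAlgebra σ τ).toRingHom.comp ((CyclicAlgebra.of (RatFunc₂.extend σ)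
      (RatFunc₂.x κ)).toRingHom.comp (algebraMap K (RatFunc₂ K)))

/-- The embedding of `L` in the second factor. -/
def BicyclicAlgebra.ofRight : L →+* BicyclicAlgebra σ τ :=
  (Algebra.TensorProduct.includeRight : RatFuncCyclicAlgebra τ (RatFunc₂.y κ) →ₐ[RatFunc₂ κ]
    BicyclicAlgebra σ τ).toRingHom.comp ((CyclicAlgebra.of (RatFunc₂.extend τ)
      (RatFunc₂.y κ)).toRingHom.comp (algebraMap L (RatFunc₂ L)))

theorem BicyclicAlgebra.ofLeft_apply (a : K) : ofLeft σ τ a =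
    CyclicAlgebra.of (RatFunc₂.extend σ) (RatFunc₂.x κ) (algebraMap K (RatFunc₂ K) a) ⊗ₜ 1 := rfl

theorem BicyclicAlgebra.ofRight_apply (b : L) : ofRight σ τ b =
    1 ⊗ₜ CyclicAlgebra.of (RatFunc₂.extend τ) (RatFunc₂.y κ) (algebraMap L (RatFunc₂ L) b) := rfl

theorem BicyclicAlgebra.val_u : (u σ τ : BicyclicAlgebra σ τ) =
    CyclicAlgebra.gen (RatFunc₂.extend σ) (RatFunc₂.x κ) ⊗ₜ 1 := rfl

theorem BicyclicAlgebra.val_v : (v σ τ : BicyclicAlgebra σ τ) =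
    1 ⊗ₜ CyclicAlgebra.gen (RatFunc₂.extend τ) (RatFunc₂.y κ) := rfl

theorem BicyclicAlgebra.ofLeft_algebraMap (c : κ) : ofLeft σ τ (algebraMap κ K c) =
    algebraMap (RatFunc₂ κ) _ (algebraMap κ _ c) := by
  rw [ofLeft_apply, ← RatFunc₂.algebraMap_algebraMap, AlgHom.commutes]
  rfl

theorem BicyclicAlgebra.ofRight_algebraMap (c : κ) : ofRight σ τ (algebraMap κ L c) =
    algebraMap (RatFunc₂ κ) _ (algebraMap κ _ c) := by
  rw [ofRight_apply, ← RatFunc₂.algebraMap_algebraMap, AlgHom.commutes]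
  exact (Algebra.TensorProduct.includeRight : RatFuncCyclicAlgebra τ (RatFunc₂.y κ) →ₐ[RatFunc₂ κ]
    BicyclicAlgebra σ τ).commutes _

variable (hdisj : K.LinearDisjoint L) (hcomp : K ⊔ L = ⊤)

theorem BicyclicAlgebra.commute_ofLeft_ofRight (a : K) (b : L) :
    Commute (ofLeft σ τ a) (ofRight σ τ b) := by
  change ofLeft σ τ a * ofRight σ τ b = ofRight σ τ b * ofLeft σ τ a
  rw [ofLeft_apply, ofRight_apply, Algebra.TensorProduct.tmul_mul_tmul,
    Algebra.TensorProduct.tmul_mul_tmul, one_mul, mul_one, one_mul, mul_one]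

/-- The homomorphism induced on `K ⊗ L`. -/
def BicyclicAlgebra.ofTensor : K ⊗[κ] L →+* BicyclicAlgebra σ τ :=
  letI : Algebra κ (BicyclicAlgebra σ τ) :=
    Algebra.compHom (BicyclicAlgebra σ τ) (algebraMap κ (RatFunc₂ κ))
  (Algebra.TensorProduct.lift
    (⟨ofLeft σ τ, ofLeft_algebraMap σ τ⟩ : K →ₐ[κ] BicyclicAlgebra σ τ)
    (⟨ofRight σ τ, ofRight_algebraMap σ τ⟩ : L →ₐ[κ] BicyclicAlgebra σ τ)
    (commute_ofLeft_ofRight σ τ)).toRingHom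

theorem BicyclicAlgebra.ofTensor_tmul (a : K) (b : L) :
    ofTensor σ τ (a ⊗ₜ b) = ofLeft σ τ a * ofRight σ τ b :=
  letI : Algebra κ (BicyclicAlgebra σ τ) :=
    Algebra.compHom (BicyclicAlgebra σ τ) (algebraMap κ (RatFunc₂ κ))
  Algebra.TensorProduct.lift_tmul
    (⟨ofLeft σ τ, ofLeft_algebraMap σ τ⟩ : K →ₐ[κ] BicyclicAlgebra σ τ)
    (⟨ofRight σ τ, ofRight_algebraMap σ τ⟩ : L →ₐ[κ] BicyclicAlgebra σ τ)
    (commute_ofLeft_ofRight σ τ) a b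

/-- The embedding of `E = KL`. -/
def BicyclicAlgebra.ofField : E →+* BicyclicAlgebra σ τ :=
  (ofTensor σ τ).comp (compositumEquiv hdisj hcomp).symm.toAlgHom.toRingHom

theorem BicyclicAlgebra.ofField_mul (a : K) (b : L) :
    ofField σ τ hdisj hcomp (a * b) = ofLeft σ τ a * ofRight σ τ b := by
  rw [← compositumEquiv_tmul hdisj hcomp, ← ofTensor_tmul]
  exact congrArg (ofTensor σ τ) ((compositumEquiv hdisj hcomp).symm_apply_apply _)

theorem BicyclicAlgebra.ofField_algebraMap (c : κ) :
    ofField σ τ hdisj hcomp (algebraMap κ E c) =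
      algebraMap (RatFunc₂ κ) _ (algebraMap κ _ c) := by
  have := ofField_mul σ τ hdisj hcomp (algebraMap κ K c) 1
  rw [map_one, mul_one, ofLeft_algebraMap] at this
  simpa using this

theorem BicyclicAlgebra.u_mul_ofField (e : E) : u σ τ * ofField σ τ hdisj hcomp e =
    ofField σ τ hdisj hcomp (compositumAut hdisj hcomp σ 1 e) * u σ τ := by
  induction e using compositum_induction hdisj hcomp with
  | h a b =>
    rw [compositumAut_mul, AlgEquiv.one_apply, ofField_mul, ofField_mul, ofLeft_apply, ofRight_apply,
      ofLeft_apply, val_u]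
    simp only [Algebra.TensorProduct.tmul_mul_tmul, one_mul, mul_one]
    rw [CyclicAlgebra.gen_mul_of, RatFunc₂.extend_algebraMap]
  | hadd x y hx hy => rw [map_add, map_add, map_add, mul_add, add_mul, hx, hy]

theorem BicyclicAlgebra.v_mul_ofField (e : E) : v σ τ * ofField σ τ hdisj hcomp e =
    ofField σ τ hdisj hcomp (compositumAut hdisj hcomp 1 τ e) * v σ τ := by
  induction e using compositum_induction hdisj hcomp with
  | h a b =>
    rw [compositumAut_mul, AlgEquiv.one_apply, ofField_mul, ofField_mul, ofLeft_apply, ofRight_apply,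
      ofRight_apply, val_v]
    simp only [Algebra.TensorProduct.tmul_mul_tmul, one_mul, mul_one]
    rw [CyclicAlgebra.gen_mul_of, RatFunc₂.extend_algebraMap]
  | hadd x y hx hy => rw [map_add, map_add, map_add, mul_add, add_mul, hx, hy]

section Action

theorem compositumAut_left_pow [IsGalois κ K] :
    compositumAut hdisj hcomp σ 1 ^ Module.finrank κ K = 1 := by
  have h : compositumAut hdisj hcomp σ 1 ^ Module.finrank κ K =
    compositumAutHom hdisj hcomp ((σ, 1) ^ Module.finrank κ K) :=
      (map_pow (compositumAutHom hdisj hcomp) (σ, 1) _).symm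
  rw [h, ← IsGalois.card_aut_eq_finrank κ K, Prod.pow_mk, pow_card_eq_one', one_pow]
  exact map_one _

theorem compositumAut_right_pow [IsGalois κ L] :
    compositumAut hdisj hcomp 1 τ ^ Module.finrank κ L = 1 := by
  have h : compositumAut hdisj hcomp 1 τ ^ Module.finrank κ L =
    compositumAutHom hdisj hcomp ((1, τ) ^ Module.finrank κ L) :=
      (map_pow (compositumAutHom hdisj hcomp) (1, τ) _).symm
  rw [h, ← IsGalois.card_aut_eq_finrank κ L, Prod.pow_mk, pow_card_eq_one', one_pow]
  exact map_one _

theorem compositumAut_commute :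
    compositumAut hdisj hcomp σ 1 * compositumAut hdisj hcomp 1 τ =
      compositumAut hdisj hcomp 1 τ * compositumAut hdisj hcomp σ 1 := by
  change compositumAutHom hdisj hcomp (σ, 1) * compositumAutHom hdisj hcomp (1, τ) =
    compositumAutHom hdisj hcomp (1, τ) * compositumAutHom hdisj hcomp (σ, 1)
  rw [← map_mul, ← map_mul]
  simp

variable [IsGalois κ K] [IsGalois κ L]

theorem compositumAut_algebraMap_left (a : K) : compositumAut hdisj hcomp σ τ (algebraMap K E a) =
    algebraMap K E (σ a) := compositumAut_left hdisj hcomp σ τ a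

theorem compositumAut_algebraMap_right (b : L) : compositumAut hdisj hcomp σ τ (algebraMap L E b) =
    algebraMap L E (τ b) := compositumAut_right hdisj hcomp σ τ b

/-- The vector space on which the algebra acts. -/
abbrev BicyclicModule (K L : IntermediateField κ E) : Type v :=
  LaurentModule κ E (Module.finrank κ K) (Module.finrank κ L)

/-- The action of the first factor. -/
def leftAction : RatFuncCyclicAlgebra σ (RatFunc₂.x κ) →ₐ[RatFunc₂ κ]
    Module.End (RatFunc₂ κ) (BicyclicModule K L) :=
  cyclicAction _ _ σ (RatFunc₂.x κ) 0 1 (compositumAut hdisj hcomp σ 1)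
    (compositumAut_algebraMap_left σ 1 hdisj hcomp) (compositumAut_left_pow σ hdisj hcomp) (by
      rw [ratEmbedding_x, mul_zero, mul_one])

/-- The action of the second factor. -/
def rightAction : RatFuncCyclicAlgebra τ (RatFunc₂.y κ) →ₐ[RatFunc₂ κ]
    Module.End (RatFunc₂ κ) (BicyclicModule K L) :=
  cyclicAction _ _ τ (RatFunc₂.y κ) 1 0 (compositumAut hdisj hcomp 1 τ)
    (compositumAut_algebraMap_right 1 τ hdisj hcomp) (compositumAut_right_pow τ hdisj hcomp) (by
      rw [ratEmbedding_y, mul_zero, mul_one])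

theorem leftAction_of (f : RatFunc₂ K) :
    leftAction σ hdisj hcomp (CyclicAlgebra.of _ _ f) = ratMul _ _ K f := by
  rw [leftAction, cyclicAction_of]

theorem leftAction_gen : leftAction σ hdisj hcomp (CyclicAlgebra.gen _ _) =
    shiftAut _ _ 0 1 (compositumAut hdisj hcomp σ 1) := by
  rw [leftAction, cyclicAction_gen]

theorem rightAction_of (f : RatFunc₂ L) :
    rightAction τ hdisj hcomp (CyclicAlgebra.of _ _ f) = ratMul _ _ L f := by
  rw [rightAction, cyclicAction_of]

theorem rightAction_gen : rightAction τ hdisj hcomp (CyclicAlgebra.gen _ _) =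
    shiftAut _ _ 1 0 (compositumAut hdisj hcomp 1 τ) := by
  rw [rightAction, cyclicAction_gen]

/-- It suffices to check generators: multiplications commute, the automorphism of each factor is
trivial on the field of the other, and the two automorphisms commute. -/
theorem commute_leftAction_rightAction (a : RatFuncCyclicAlgebra σ (RatFunc₂.x κ))
    (b : RatFuncCyclicAlgebra τ (RatFunc₂.y κ)) :
    Commute (leftAction σ hdisj hcomp a) (rightAction τ hdisj hcomp b) := by
  refine CyclicAlgebra.commute_of_commute _ (fun f => ?_) ?_ a
  · refine (CyclicAlgebra.commute_of_commute _ (fun f' => ?_) ?_ b).symm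
    · rw [leftAction_of, rightAction_of]
      exact (Commute.all _ _).map (Algebra.lmul (RatFunc₂ κ) (BicyclicModule K L))
    · rw [leftAction_of, rightAction_gen]
      exact shiftAut_commute_ratMul _ _ _ _ _ (compositumAut_algebraMap_left 1 τ hdisj hcomp) f
  · refine (CyclicAlgebra.commute_of_commute _ (fun f' => ?_) ?_ b).symm
    · rw [leftAction_gen, rightAction_of]
      exact (shiftAut_commute_ratMul _ _ _ _ _ (compositumAut_algebraMap_right σ 1 hdisj hcomp) f').symm
    · rw [leftAction_gen, rightAction_gen]
      change _ * _ = _ * _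
      rw [shiftAut_mul, shiftAut_mul, compositumAut_commute, add_comm 1 0, add_comm 0 1]

/-- The action of the tensor product over `κ(x, y)`. -/
def tensorAction : BicyclicAlgebra σ τ →ₐ[RatFunc₂ κ]
    Module.End (RatFunc₂ κ) (BicyclicModule K L) :=
  Algebra.TensorProduct.lift (leftAction σ hdisj hcomp) (rightAction τ hdisj hcomp)
    (commute_leftAction_rightAction σ τ hdisj hcomp)

theorem tensorAction_tmul (a : RatFuncCyclicAlgebra σ (RatFunc₂.x κ))
    (b : RatFuncCyclicAlgebra τ (RatFunc₂.y κ)) : tensorAction σ τ hdisj hcomp (a ⊗ₜ b) =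
      leftAction σ hdisj hcomp a * rightAction τ hdisj hcomp b :=
  Algebra.TensorProduct.lift_tmul _ _ _ a b

/-- The action of the scalars `κ((x))((y))`. -/
def scalarAction (K L : IntermediateField κ E) :
    LaurentSeries₂ κ →ₐ[RatFunc₂ κ] Module.End (RatFunc₂ κ) (BicyclicModule K L) :=
  (Algebra.lmul (RatFunc₂ κ) (BicyclicModule K L)).comp (LaurentModule.ofLaurent κ E _ _)

theorem scalarAction_commute_shiftAut (f : LaurentSeries₂ κ) (j i : ℤ) (g : E ≃ₐ[κ] E) :
    Commute (shiftAut _ _ j i g) (scalarAction K L f) := by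
  refine LinearMap.ext fun h => ?_
  refine (shiftFun_mul j i g (laurentEmbedding κ E _ _ f) h).trans ?_
  rw [laurentEmbedding, RingHom.comp_apply, map_algebraMap_map]
  rfl

theorem commute_scalarAction (f : LaurentSeries₂ κ) (d : BicyclicAlgebra σ τ) :
    Commute (scalarAction K L f) (tensorAction σ τ hdisj hcomp d) := by
  induction d using TensorProduct.induction_on with
  | zero => simp
  | add x y hx hy =>
    rw [map_add]
    exact hx.add_right hy
  | tmul a b =>
    rw [tensorAction_tmul]
    refine Commute.mul_right (CyclicAlgebra.commute_of_commute _ (fun c => ?_) ?_ a).symm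
      (CyclicAlgebra.commute_of_commute _ (fun c => ?_) ?_ b).symm
    · rw [leftAction_of]
      exact (Commute.all _ _).map (Algebra.lmul (RatFunc₂ κ) (BicyclicModule K L))
    · rw [leftAction_gen]
      exact scalarAction_commute_shiftAut f _ _ _
    · rw [rightAction_of]
      exact (Commute.all _ _).map (Algebra.lmul (RatFunc₂ κ) (BicyclicModule K L))
    · rw [rightAction_gen]
      exact scalarAction_commute_shiftAut f _ _ _

/-- The action of the tensor product over `κ((x))((y))`. -/
def completeAction : LaurentSeries₂ κ ⊗[RatFunc₂ κ] BicyclicAlgebra σ τ →ₐ[RatFunc₂ κ]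
    Module.End (RatFunc₂ κ) (BicyclicModule K L) :=
  Algebra.TensorProduct.lift (scalarAction K L) (tensorAction σ τ hdisj hcomp)
    (commute_scalarAction σ τ hdisj hcomp)

theorem completeAction_tmul (f : LaurentSeries₂ κ) (d : BicyclicAlgebra σ τ) :
    completeAction σ τ hdisj hcomp (f ⊗ₜ d) =
      scalarAction K L f * tensorAction σ τ hdisj hcomp d :=
  Algebra.TensorProduct.lift_tmul _ _ _ f d

theorem completeAction_one_tmul (d : BicyclicAlgebra σ τ) :
    completeAction σ τ hdisj hcomp (1 ⊗ₜ d) = tensorAction σ τ hdisj hcomp d := by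
  rw [completeAction_tmul, map_one, one_mul]

theorem tensorAction_ofField (e : E) (h : LaurentSeries₂ E) :
    tensorAction σ τ hdisj hcomp (BicyclicAlgebra.ofField σ τ hdisj hcomp e) h =
      (mono 0 0 e * h : LaurentSeries₂ E) := by
  induction e using compositum_induction hdisj hcomp with
  | h a b =>
    rw [BicyclicAlgebra.ofField_mul, BicyclicAlgebra.ofLeft_apply, BicyclicAlgebra.ofRight_apply,
      Algebra.TensorProduct.tmul_mul_tmul, one_mul, mul_one, tensorAction_tmul, leftAction_of,
      rightAction_of]
    change ratEmbedding _ _ K (algebraMap K _ a) * (ratEmbedding _ _ L (algebraMap L _ b) * h) =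
      (mono 0 0 (a * b : E) * h : LaurentSeries₂ E)
    rw [ratEmbedding_algebraMap, ratEmbedding_algebraMap, ← mul_assoc, mono_mul_mono]
    rfl
  | hadd x y hx hy =>
    rw [map_add, map_add, mono_add, add_mul, ← hx, ← hy]
    rfl

/-- Forgetting linearity of endomorphisms. -/
def endToAddMonoidEnd (R M : Type*) [Semiring R] [AddCommMonoid M] [Module R M] :
    Module.End R M →+* AddMonoid.End M where
  toFun f := f.toAddMonoidHom
  map_one' := rfl
  map_zero' := rfl
  map_mul' _ _ := rfl
  map_add' _ _ := rfl

/-- The action of the tensor product over `κ((x))((y))` by additive maps. -/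
def addAction : LaurentSeries₂ κ ⊗[RatFunc₂ κ] BicyclicAlgebra σ τ →+*
    AddMonoid.End (LaurentSeries₂ E) :=
  (endToAddMonoidEnd (RatFunc₂ κ) (BicyclicModule K L)).comp
    (completeAction σ τ hdisj hcomp).toRingHom

theorem addAction_apply (d : LaurentSeries₂ κ ⊗[RatFunc₂ κ] BicyclicAlgebra σ τ)
    (h : LaurentSeries₂ E) :
    addAction σ τ hdisj hcomp d h = completeAction σ τ hdisj hcomp d h := rfl

theorem addAction_tmul_one (f : LaurentSeries₂ κ) (h : LaurentSeries₂ E) :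
    addAction σ τ hdisj hcomp (f ⊗ₜ 1) h =
      laurentEmbedding κ E (Module.finrank κ K) (Module.finrank κ L) f * h := by
  rw [addAction_apply, completeAction_tmul, map_one, mul_one]
  rfl

theorem addAction_ofField (e : E) (h : LaurentSeries₂ E) :
    addAction σ τ hdisj hcomp (1 ⊗ₜ BicyclicAlgebra.ofField σ τ hdisj hcomp e) h =
      mono 0 0 e * h := by
  rw [addAction_apply, completeAction_one_tmul, tensorAction_ofField]

theorem addAction_u (h : LaurentSeries₂ E) :
    addAction σ τ hdisj hcomp (1 ⊗ₜ (BicyclicAlgebra.u σ τ : BicyclicAlgebra σ τ)) h =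
      shiftFun 0 1 (compositumAut hdisj hcomp σ 1) h := by
  rw [addAction_apply, completeAction_one_tmul, BicyclicAlgebra.val_u, tensorAction_tmul,
    leftAction_gen, map_one, mul_one]
  rfl

theorem addAction_v (h : LaurentSeries₂ E) :
    addAction σ τ hdisj hcomp (1 ⊗ₜ (BicyclicAlgebra.v σ τ : BicyclicAlgebra σ τ)) h =
      shiftFun 1 0 (compositumAut hdisj hcomp 1 τ) h := by
  rw [addAction_apply, completeAction_one_tmul, BicyclicAlgebra.val_v, tensorAction_tmul,
    rightAction_gen, map_one, one_mul]
  rfl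

end Action

variable {σ τ}

theorem finite_baseChange_bicyclicAlgebra :
    Module.Finite (LaurentSeries₂ κ) (LaurentSeries₂ κ ⊗[RatFunc₂ κ] BicyclicAlgebra σ τ) :=
  Module.Finite.base_change _ _ _

theorem finrank_baseChange_bicyclicAlgebra :
    Module.finrank (LaurentSeries₂ κ) (LaurentSeries₂ κ ⊗[RatFunc₂ κ] BicyclicAlgebra σ τ) =
      Module.finrank (RatFunc₂ κ) (BicyclicAlgebra σ τ) :=
  Module.finrank_baseChange

/-- The algebra `(K/k', σ, x) ⊗ (L/k', τ, y)` over `k' = κ((x))((y))` with its action on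
`E((X))((Y))`. -/
def splitModel [IsGalois κ K] [IsGalois κ L] (hσ : ∀ g : K ≃ₐ[κ] K, g ∈ Subgroup.zpowers σ)
    (hτ : ∀ g : L ≃ₐ[κ] L, g ∈ Subgroup.zpowers τ) :
    SplitModel (compositumAut hdisj hcomp σ 1) (compositumAut hdisj hcomp 1 τ)
      (Module.finrank κ K) (Module.finrank κ L)
      (LaurentSeries₂ κ ⊗[RatFunc₂ κ] BicyclicAlgebra σ τ) where
  bicyclic := isBicyclic_compositumAut hdisj hcomp hσ hτ
  finrank_eq := hdisj.finrank_eq_mul hcomp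
  act := addAction σ τ hdisj hcomp
  act_algebraMap f h := addAction_tmul_one σ τ hdisj hcomp f h
  ι := (Algebra.TensorProduct.includeRight : BicyclicAlgebra σ τ →ₐ[RatFunc₂ κ]
    LaurentSeries₂ κ ⊗[RatFunc₂ κ] BicyclicAlgebra σ τ).toRingHom.comp
      (BicyclicAlgebra.ofField σ τ hdisj hcomp)
  act_ι e h := addAction_ofField σ τ hdisj hcomp e h
  u := unitsBaseChange (RatFunc₂ κ) (LaurentSeries₂ κ) (BicyclicAlgebra σ τ) (BicyclicAlgebra.u σ τ)
  v := unitsBaseChange (RatFunc₂ κ) (LaurentSeries₂ κ) (BicyclicAlgebra σ τ) (BicyclicAlgebra.v σ τ)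
  act_u h := addAction_u σ τ hdisj hcomp h
  act_v h := addAction_v σ τ hdisj hcomp h
  finite := finite_baseChange_bicyclicAlgebra
  finrank_le := finrank_baseChange_bicyclicAlgebra.trans_le (finrank_bicyclicAlgebra_le σ τ)

end Bicyclic
end

noncomputable section

/-! ### The maps between `T(κ)/R` and `SK₁` -/

section TorusMaps

variable {κ : Type u} {E : Type v} [Field κ] [Field E] [Algebra κ E]

theorem exists_conj_mul {D : Type*} [Ring D] (ι : E →+* D) {g g' : E ≃ₐ[κ] E}
    (h : ∃ w : Dˣ, ∀ e, w * ι e = ι (g e) * w) (h' : ∃ w : Dˣ, ∀ e, w * ι e = ι (g' e) * w) :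
    ∃ w : Dˣ, ∀ e, w * ι e = ι ((g * g') e) * w := by
  obtain ⟨w, hw⟩ := h
  obtain ⟨w', hw'⟩ := h'
  refine ⟨w * w', fun e => ?_⟩
  rw [Units.val_mul, mul_assoc, hw', ← mul_assoc, hw, mul_assoc]
  rfl

/-- The automorphisms of `E` induced by inner automorphisms of `D`. -/
def innerSubgroup (κ : Type*) {E D : Type*} [Field κ] [Field E] [Algebra κ E] [Ring D]
    (ι : E →+* D) : Subgroup (E ≃ₐ[κ] E) where
  carrier := {g | ∃ w : Dˣ, ∀ e, w * ι e = ι (g e) * w}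
  one_mem' := ⟨1, fun e => by rw [Units.val_one, one_mul, mul_one]; rfl⟩
  mul_mem' := exists_conj_mul ι
  inv_mem' := by
    rintro g ⟨w, hw⟩
    refine ⟨w⁻¹, fun e => ?_⟩
    have h := hw (g⁻¹ e)
    rw [AlgEquiv.aut_inv, AlgEquiv.apply_symm_apply] at h
    rw [Units.inv_mul_eq_iff_eq_mul, ← mul_assoc, AlgEquiv.aut_inv, h, mul_assoc, Units.mul_inv,
      mul_one]

/-- If conjugation by `w` induces `g` on `E`, then `g(a) / a = w a w⁻¹ a⁻¹`. This makes the map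
`T(κ) → SK₁` constant on R-equivalence classes. -/
theorem map_mem_commutator {D : Type*} [Ring D] (ι : E →+* D)
    (hw : ∀ g : E ≃ₐ[κ] E, ∃ w : Dˣ, ∀ e, w * ι e = ι (g e) * w) {a : Eˣ}
    (ha : a ∈ augmentationSubgroup κ E) : Units.map (ι : E →* D) a ∈ commutator Dˣ := by
  rw [augmentationSubgroup] at ha
  induction ha using Subgroup.closure_induction with
  | mem x hx =>
    obtain ⟨g, a, rfl⟩ := hx
    obtain ⟨w, hw⟩ := hw g
    have h : Units.map (ι : E →* D) (Units.map (g : E →* E) a / a) =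
        w * Units.map (ι : E →* D) a * w⁻¹ * (Units.map (ι : E →* D) a)⁻¹ := by
      rw [map_div, div_eq_mul_inv, mul_left_inj, eq_mul_inv_iff_mul_eq]
      exact Units.ext (hw a).symm
    rw [h, commutator_def]
    exact Subgroup.commutator_mem_commutator (Subgroup.mem_top _) (Subgroup.mem_top _)
  | one => rw [map_one]; exact one_mem _
  | mul x y _ _ hx hy => rw [map_mul]; exact mul_mem hx hy
  | inv x _ hx => rw [map_inv]; exact inv_mem hx

variable [FiniteDimensional κ E] [IsGalois κ E]

/-- The homomorphism `T(κ) → SL₁(D)` for an algebra `D` of degree `[E : κ]` that contains `E`. -/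
def NormOneTorus.toSL1 {k : Type u} {D : Type w} [Field k] [Algebra κ k] [Ring D] [Algebra k D]
    (ι : E →+* D) (hι : ∀ c, ι (algebraMap κ E c) = algebraMap k D (algebraMap κ k c))
    (hw : ∀ g : E ≃ₐ[κ] E, ∃ w : Dˣ, ∀ e, w * ι e = ι (g e) * w)
    (hdim : Module.finrank k D = Module.finrank κ E ^ 2) : NormOneTorus κ E κ →* SL1 k D :=
  ((Units.map (ι : E →* D)).comp NormOneTorus.toUnits).codRestrict _ fun P => by
    have h := isReducedNorm_norm ι hι hw hdim (NormOneTorus.toUnits P : E)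
    rw [NormOneTorus.norm_toUnits, map_one] at h
    exact h

/-- The homomorphism `T(κ)/R → SK₁(D)` for an algebra `D` of degree `[E : κ]` that contains `E`. -/
def TorusModR.toSK1 {k : Type u} {D : Type w} [Field k] [Algebra κ k] [Ring D] [Algebra k D]
    (ι : E →+* D) (hι : ∀ c, ι (algebraMap κ E c) = algebraMap k D (algebraMap κ k c))
    (hw : ∀ g : E ≃ₐ[κ] E, ∃ w : Dˣ, ∀ e, w * ι e = ι (g e) * w)
    (hdim : Module.finrank k D = Module.finrank κ E ^ 2) : TorusModR κ E →* SK1 k D :=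
  QuotientGroup.map _ _ (NormOneTorus.toSL1 ι hι hw hdim) fun P hP =>
    by
    rw [Subgroup.mem_comap, Subgroup.mem_subgroupOf]
    exact map_mem_commutator ι hw ((mem_RTrivial_iff P).1 hP)

/-- The homomorphism `T(κ)/R → Eˣ / I Eˣ`, where `I` is the augmentation ideal of the group ring. -/
def TorusModR.toUnits : TorusModR κ E →* Eˣ ⧸ augmentationSubgroup κ E :=
  QuotientGroup.map _ _ NormOneTorus.toUnits fun P hP => (mem_RTrivial_iff P).1 hP

theorem TorusModR.toUnits_injective :
    Function.Injective (TorusModR.toUnits : TorusModR κ E →* Eˣ ⧸ augmentationSubgroup κ E) := by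
  rw [injective_iff_map_eq_one]
  intro P hP
  induction P using QuotientGroup.induction_on with
  | H P =>
    rw [QuotientGroup.eq_one_iff, mem_RTrivial_iff]
    exact (QuotientGroup.eq_one_iff _).1 hP

namespace SplitModel

variable {σ τ : E ≃ₐ[κ] E} {n m : ℕ} [NeZero n] [NeZero m] {B : Type w} [Ring B]
  [Algebra (LaurentSeries₂ κ) B] (M : SplitModel σ τ n m B)

theorem leading_mem_range {d : Bˣ} (hd : d ∈ SL1 (LaurentSeries₂ κ) B) :
    M.leading d ∈ (TorusModR.toUnits : TorusModR κ E →* _).range := by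
  obtain ⟨⟨j, i, a⟩, h⟩ := exists_hasLeading_unit (M := M) d
  obtain ⟨P, rfl⟩ := NormOneTorus.exists_toUnits_eq (h.norm_eq_one hd).2.2
  exact ⟨QuotientGroup.mk P, (leading_eq h).symm⟩

theorem commutator_le_ker_leading : commutator Bˣ ≤ M.leading.ker := by
  rw [commutator_def, Subgroup.commutator_le]
  intro a _ b _
  rw [MonoidHom.mem_ker, commutatorElement_def, map_mul, map_mul, map_mul, map_inv, map_inv]
  generalize M.leading a = x
  generalize M.leading b = y
  induction x using QuotientGroup.induction_on with
  | H x =>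
    induction y using QuotientGroup.induction_on with
    | H y => exact congrArg QuotientGroup.mk (by
        rw [mul_right_comm x y, mul_inv_cancel, one_mul, mul_inv_cancel] :
          x * y * x⁻¹ * y⁻¹ = 1)

/-- The homomorphism `SK₁(B) → T(κ)/R` induced by the leading coefficient. -/
def toTorusModR : SK1 (LaurentSeries₂ κ) B →* TorusModR κ E :=
  (MonoidHom.ofInjective TorusModR.toUnits_injective).symm.toMonoidHom.comp
    (QuotientGroup.lift _ ((M.leading.comp (SL1 (LaurentSeries₂ κ) B).subtype).codRestrict _
      fun d => M.leading_mem_range d.2) fun _ hd =>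
        Subtype.ext (M.commutator_le_ker_leading (Subgroup.mem_subgroupOf.1 hd)))

theorem toUnits_toTorusModR (d : SL1 (LaurentSeries₂ κ) B) :
    TorusModR.toUnits (M.toTorusModR (QuotientGroup.mk d)) = M.leading d :=
  congrArg Subtype.val
    ((MonoidHom.ofInjective (TorusModR.toUnits_injective (κ := κ) (E := E))).apply_symm_apply _)

theorem toTorusModR_injective (hn : (n : κ) ≠ 0) (hm : (m : κ) ≠ 0) :
    Function.Injective M.toTorusModR := by
  rw [injective_iff_map_eq_one]
  intro d h
  induction d using QuotientGroup.induction_on with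
  | H d =>
    have h1 := M.toUnits_toTorusModR d
    rw [h, map_one] at h1
    rw [QuotientGroup.eq_one_iff]
    exact Subgroup.mem_subgroupOf.2 (M.mem_commutator_of_leading_eq_one hn hm d.2 h1.symm)

end SplitModel

end TorusMaps

/-! ### The algebra over `κ(x, y)` has degree `[E : κ]` and `E` inside -/

section Bicyclic

attribute [local instance] RatFunc₂.algebra

variable {κ : Type u} {E : Type v} [Field κ] [Field E] [Algebra κ E] [FiniteDimensional κ E]
  {K L : IntermediateField κ E} [IsGalois κ K] [IsGalois κ L] {σ : K ≃ₐ[κ] K} {τ : L ≃ₐ[κ] L}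
  (hdisj : K.LinearDisjoint L) (hcomp : K ⊔ L = ⊤)
  (hσ : ∀ g : K ≃ₐ[κ] K, g ∈ Subgroup.zpowers σ) (hτ : ∀ g : L ≃ₐ[κ] L, g ∈ Subgroup.zpowers τ)
include hdisj hcomp hσ hτ

theorem BicyclicAlgebra.exists_conj (g : E ≃ₐ[κ] E) : ∃ w : (BicyclicAlgebra σ τ)ˣ,
    ∀ e, w * ofField σ τ hdisj hcomp e = ofField σ τ hdisj hcomp (g e) * w := by
  change g ∈ innerSubgroup κ (ofField σ τ hdisj hcomp)
  obtain ⟨j, i, rfl⟩ := (isBicyclic_compositumAut hdisj hcomp hσ hτ).surjective g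
  have hu : compositumAut hdisj hcomp σ 1 ∈ innerSubgroup κ (ofField σ τ hdisj hcomp) :=
    ⟨u σ τ, u_mul_ofField σ τ hdisj hcomp⟩
  have hv : compositumAut hdisj hcomp 1 τ ∈ innerSubgroup κ (ofField σ τ hdisj hcomp) :=
    ⟨v σ τ, v_mul_ofField σ τ hdisj hcomp⟩
  exact mul_mem (zpow_mem hu i) (zpow_mem hv j)

/-- The dimension is unchanged by the extension to `κ((x))((y))`, where the action on series
determines it. -/
theorem BicyclicAlgebra.finrank_eq :
    Module.finrank (RatFunc₂ κ) (BicyclicAlgebra σ τ) = Module.finrank κ E ^ 2 := by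
  have := isGalois_of_sup_eq_top hcomp
  rw [← finrank_baseChange_bicyclicAlgebra, (splitModel hdisj hcomp hσ hτ).finrank_model,
    ← hdisj.finrank_eq_mul hcomp]

end Bicyclic
end

theorem mainTheorem10 {κ : Type*} {E : Type*} [Field κ] [Field E] [Algebra κ E]
    [FiniteDimensional κ E] (K L : IntermediateField κ E) [IsGalois κ K] [IsGalois κ L]
    (σ : K ≃ₐ[κ] K) (τ : L ≃ₐ[κ] L)
    (hσ : ∀ g : K ≃ₐ[κ] K, g ∈ Subgroup.zpowers σ) (hτ : ∀ g : L ≃ₐ[κ] L, g ∈ Subgroup.zpowers τ)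
    (hdisj : K.LinearDisjoint L) (hcomp : K ⊔ L = ⊤) :
    let k := RatFunc₂ κ
    let k' := LaurentSeries₂ κ
    let D := RatFuncCyclicAlgebra σ (RatFunc₂.x κ) ⊗[k] RatFuncCyclicAlgebra τ (RatFunc₂.y κ)
    let D' := k' ⊗[k] D
    ∃ (i : TorusModR κ E →* SK1 k D) (j : SK1 k' D' →* TorusModR κ E),
      (j.comp (SK1.baseChange k k' D)).comp i = MonoidHom.id _ ∧
      Function.Surjective (j.comp (SK1.baseChange k k' D)) ∧
      Function.Surjective j ∧
      (¬ ringChar κ ∣ Module.finrank κ K * Module.finrank κ L → Function.Bijective j) := by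
  intro k k' D D'
  have : IsGalois κ E := isGalois_of_sup_eq_top hcomp
  let M := splitModel hdisj hcomp hσ hτ
  let ι : E →+* D := BicyclicAlgebra.ofField σ τ hdisj hcomp
  have hι : ∀ c, ι (algebraMap κ E c) = algebraMap k D (algebraMap κ k c) :=
    BicyclicAlgebra.ofField_algebraMap σ τ hdisj hcomp
  let i : TorusModR κ E →* SK1 k D := TorusModR.toSK1 ι hι
    (BicyclicAlgebra.exists_conj hdisj hcomp hσ hτ)
    (BicyclicAlgebra.finrank_eq hdisj hcomp hσ hτ)
  -- An element `a` of `E` is its own leading term, so `j` returns the class that `i` started from.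
  -- Classes are compared in the quotient of `Eˣ`, into which `T(κ)/R` embeds.
  have hij : (M.toTorusModR.comp (SK1.baseChange k k' D)).comp i = MonoidHom.id _ := by
    ext P
    apply TorusModR.toUnits_injective
    exact (M.toUnits_toTorusModR _).trans
      (SplitModel.leading_eq (M := M) (SplitModel.hasLeading_ι (NormOneTorus.toUnits P).ne_zero))
  have hsurj : Function.Surjective (M.toTorusModR.comp (SK1.baseChange k k' D)) :=
    fun P => ⟨i P, DFunLike.congr_fun hij P⟩
  have hsurj' : Function.Surjective M.toTorusModR :=
    fun P => ⟨SK1.baseChange k k' D (i P), DFunLike.congr_fun hij P⟩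
  refine ⟨i, M.toTorusModR, hij, hsurj, hsurj', fun hchar => ⟨M.toTorusModR_injective ?_ ?_, hsurj'⟩⟩
  · exact fun h => hchar (((ringChar.spec κ _).1 h).mul_right _)
  · exact fun h => hchar (((ringChar.spec κ _).1 h).mul_left _)
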